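/- Let $G$ be a connected reductive linear algebraic group over $\mathbb{C}$ with Lie algebra $\mathfrak g$, let $T$ be a maximal torus of $G$, let $\Phi$ be the root system of $G$ with respect to $T$, and let $\Pi$ be a base of $\Phi$. For $\Delta\subseteq\Pi$ let $L=L_\Delta$ be the corresponding standard Levi subgroup of $G$, i.e. the Levi factor containing $T$ of the standard parabolic subgroup attached to $\Delta$; equivalently $L_\Delta=C_G\big((\bigcap_{\alpha\in\Delta}\ker\alpha)^\circ\big)$. Write $\mathfrak l=\mathrm{Lie}(L)$, let $Z(L)$ be the centre of $L$, and put $L_{\mathrm{ad}}=L/Z(L)$, whose Lie algebra is $\mathfrak l_{\mathrm{ad}}=\mathfrak l/\mathrm{Lie}(Z(L))$. For an algebraic group $H$, a coadjoint $H$-orbit $\mathcal O\subseteq\mathrm{Lie}(H)^*$ is called nilpotent if $0\in\overline{\mathcal O}$, and its $H$-equivariant fundamental group is $\pi_1^H(\mathcal O)=H_e/(H_e)^\circ$, where $e\in\mathcal O$ and $H_e$ is the stabiliser of $e$ in $H$ (up to isomorphism it does not depend on $e$). Each nilpotent $L$-orbit $\mathcal O_L\subseteq\mathfrak l^*$ lies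 in the image of the inclusion $\mathfrak l_{\mathrm{ad}}^*\hookrightarrow\mathfrak l^*$, and its preimage in $\mathfrak l_{\mathrm{ad}}^*$ is a nilpotent $L_{\mathrm{ad}}$-orbit, again denoted by $\mathcal O_L$. 1. Suppose that $Z(G)=1$. Then for every standard Levi subgroup $L$ of $G$ the centre $Z(L)$ is connected, and $\pi_1^L(\mathcal O_L)\cong\pi_1^{L_{\mathrm{ad}}}(\mathcal O_L)$ for every nilpotent $L$-orbit $\mathcal O_L$. 2. Let $L$ be a standard Levi subgroup of $G$ such that $Z(G)\cap L=1$. Then the same conclusion holds for $L$: the centre $Z(L)$ is connected, and $\pi_1^L(\mathcal O_L)\cong\pi_1^{L_{\mathrm{ad}}}(\mathcal O_L)$ for every nilpotent $L$-orbit $\mathcal O_L$. -/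

import Mathlib

noncomputable section

/-! ### The Zariski topology -/

/-- The Zariski topology on the affine space `ℂ^σ`: the complements of zero sets of polynomials
form a basis of open sets. -/
@[reducible] def zariskiTopology (σ : Type*) : TopologicalSpace (σ → ℂ) :=
  TopologicalSpace.generateFrom
    (Set.range fun p : MvPolynomial σ ℂ => {x : σ → ℂ | MvPolynomial.eval x p ≠ 0})

/-- The Zariski topology on the dual of a vector space `V`; the polynomial functions on `V*` are the
polynomials in the evaluations at vectors of `V`. -/
@[reducible] def zariskiDual (V : Type*) [AddCommGroup V] [Module ℂ V] :
    TopologicalSpace (Module.Dual ℂ V) :=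
  TopologicalSpace.induced (fun (χ : Module.Dual ℂ V) (v : V) => χ v) (zariskiTopology V)

/-- The group `GL_n(ℂ)`, as a type of its own so that it can carry the Zariski topology. -/
def ZGL (n : ℕ) : Type := GL (Fin n) ℂ

instance (n : ℕ) : Group (ZGL n) := inferInstanceAs (Group (GL (Fin n) ℂ))

namespace ZGL

variable {n : ℕ}

/-- The underlying matrix. -/
def mat (g : ZGL n) : Matrix (Fin n) (Fin n) ℂ := Units.val (g : GL (Fin n) ℂ)

@[simp] lemma mat_mul (g h : ZGL n) : (g * h).mat = g.mat * h.mat := rfl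

@[simp] lemma mat_one : (1 : ZGL n).mat = 1 := rfl

@[simp] lemma mat_mul_inv (g : ZGL n) : g.mat * (g⁻¹).mat = 1 := by
  rw [← mat_mul, mul_inv_cancel, mat_one]

@[simp] lemma mat_inv_mul (g : ZGL n) : (g⁻¹).mat * g.mat = 1 := by
  rw [← mat_mul, inv_mul_cancel, mat_one]

/-- The matrix entries, as a point of the affine space of dimension `n²`. -/
def coords (g : ZGL n) : Fin n × Fin n → ℂ := fun ij => g.mat ij.1 ij.2

/-- The Zariski topology on `GL_n(ℂ)`, as an open subset of the space of matrices. Subgroups carry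
the subspace topology and quotients of subgroups the quotient topology. -/
instance : TopologicalSpace (ZGL n) :=
  TopologicalSpace.induced coords (zariskiTopology (Fin n × Fin n))

end ZGL

/-- A map whose composites with all polynomials are polynomial is Zariski continuous. -/
lemma continuous_of_polynomial {n : ℕ} (f : ZGL n → ZGL n)
    (F : Fin n × Fin n → MvPolynomial (Fin n × Fin n) ℂ)
    (hF : ∀ g ij, (f g).coords ij = MvPolynomial.eval g.coords (F ij)) : Continuous f := by
  refine continuous_induced_rng.2 ?_
  refine (@continuous_generateFrom_iff _ _ (ZGL.coords ∘ f) _ _).2 ?_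
  rintro _ ⟨p, rfl⟩
  refine (@isOpen_induced_iff _ _ (zariskiTopology _) _ _).2 ⟨{x | MvPolynomial.eval x (MvPolynomial.bind₁ F p) ≠ 0},
    TopologicalSpace.isOpen_generateFrom_of_mem ⟨_, rfl⟩, ?_⟩
  ext g
  have : (f g).coords = fun ij => MvPolynomial.eval g.coords (F ij) := funext (hF g)
  simp only [Set.mem_preimage, Set.mem_ofPred_eq, Function.comp, this]
  rw [MvPolynomial.eval, MvPolynomial.eval₂Hom_bind₁]
  rfl

instance (n : ℕ) : SeparatelyContinuousMul (ZGL n) where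
  continuous_const_mul {a} := by
    refine continuous_of_polynomial _
      (fun ij => ∑ k, MvPolynomial.C (a.mat ij.1 k) * MvPolynomial.X (k, ij.2)) ?_
    intro g ij
    simp [ZGL.coords, Matrix.mul_apply]
  continuous_mul_const {a} := by
    refine continuous_of_polynomial _
      (fun ij => ∑ k, MvPolynomial.X (ij.1, k) * MvPolynomial.C (a.mat k ij.2)) ?_
    intro g ij
    simp [ZGL.coords, Matrix.mul_apply]

instance {A : Type*} [Group A] [TopologicalSpace A] [SeparatelyContinuousMul A]
    (H : Subgroup A) : SeparatelyContinuousMul H :=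
  inferInstanceAs (SeparatelyContinuousMul H.toSubmonoid)

instance {A : Type*} [Group A] [TopologicalSpace A] [SeparatelyContinuousMul A]
    (N : Subgroup A) [N.Normal] : SeparatelyContinuousMul (A ⧸ N) where
  continuous_const_mul {a} := by
    induction a using QuotientGroup.induction_on with
    | H a =>
      refine (QuotientGroup.isQuotientMap_mk N).continuous_iff.2 ?_
      exact QuotientGroup.continuous_mk.comp (SeparatelyContinuousMul.continuous_const_mul (a := a))
  continuous_mul_const {a} := by
    induction a using QuotientGroup.induction_on with
    | H a =>
      refine (QuotientGroup.isQuotientMap_mk N).continuous_iff.2 ?_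
      exact QuotientGroup.continuous_mk.comp (SeparatelyContinuousMul.continuous_mul_const (a := a))

/-! ### Identity components and equivariant fundamental groups -/

/-- The identity component `A°`: the connected component of `1`. -/
def identityComponent (A : Type*) [Group A] [TopologicalSpace A] [SeparatelyContinuousMul A] :
    Subgroup A where
  carrier := connectedComponent 1
  one_mem' := mem_connectedComponent
  mul_mem' {x y} hx hy := by
    have h : (x * ·) '' connectedComponent (1 : A) ⊆ connectedComponent x := by
      have := (SeparatelyContinuousMul.continuous_const_mul
        (a := x)).image_connectedComponent_subset (1 : A)
      simpa using this
    rw [connectedComponent_eq hx]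
    exact h ⟨y, hy, rfl⟩
  inv_mem' {x} hx := by
    have h : (x⁻¹ * ·) '' connectedComponent x ⊆ connectedComponent (1 : A) := by
      have := (SeparatelyContinuousMul.continuous_const_mul
        (a := x⁻¹)).image_connectedComponent_subset x
      simpa using this
    rw [← connectedComponent_eq hx] at h
    exact h ⟨1, mem_connectedComponent, by simp⟩

instance (A : Type*) [Group A] [TopologicalSpace A] [SeparatelyContinuousMul A] :
    (identityComponent A).Normal where
  conj_mem x hx g := by
    have hc : Continuous fun y : A => g * y * g⁻¹ :=
      (SeparatelyContinuousMul.continuous_mul_const (a := g⁻¹)).comp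
        (SeparatelyContinuousMul.continuous_const_mul (a := g))
    have h := hc.image_connectedComponent_subset (1 : A)
    simp only [mul_one, mul_inv_cancel] at h
    exact h ⟨x, hx, rfl⟩

/-- The stabiliser `A_e` of a vector `e` of a representation of `A`. -/
def vectorStabilizer {A V : Type*} [Group A] [AddCommGroup V] [Module ℂ V]
    (ρ : Representation ℂ A V) (e : V) : Subgroup A where
  carrier := {a | ρ a e = e}
  one_mem' := by simp
  mul_mem' {a b} ha hb := by
    simp only [Set.mem_ofPred_eq] at ha hb ⊢
    rw [map_mul, Module.End.mul_apply, hb, ha]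
  inv_mem' {a} ha := by
    simp only [Set.mem_ofPred_eq] at ha ⊢
    conv_lhs => rw [← ha]
    rw [← Module.End.mul_apply, ← map_mul, inv_mul_cancel, map_one, Module.End.one_apply]

/-- The `A`-equivariant fundamental group `A_e / A_e°` of the orbit of `e`. -/
abbrev EquivariantFundamentalGroup {A V : Type*} [Group A] [TopologicalSpace A]
    [SeparatelyContinuousMul A] [AddCommGroup V] [Module ℂ V]
    (ρ : Representation ℂ A V) (e : V) : Type _ :=
  vectorStabilizer ρ e ⧸ identityComponent (vectorStabilizer ρ e)

/-- `O` is a nilpotent orbit for a representation of `A` on a dual space `V*`: it is a single orbit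
and `0` lies in its Zariski closure. -/
def IsNilpotentOrbit {A V : Type*} [Group A] [AddCommGroup V] [Module ℂ V]
    (ρ : Representation ℂ A (Module.Dual ℂ V)) (O : Set (Module.Dual ℂ V)) : Prop :=
  (∃ e, O = Set.range fun a : A => ρ a e) ∧ 0 ∈ @closure _ (zariskiDual V) O

/-! ### Lie algebras and (co)adjoint actions -/

/-- The derivative at the identity matrix, in the direction `X`, of a polynomial in the matrix
entries. -/
def derivAtOne {n : ℕ} (X : Matrix (Fin n) (Fin n) ℂ) (p : MvPolynomial (Fin n × Fin n) ℂ) : ℂ :=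
  ∑ ij, X ij.1 ij.2 * MvPolynomial.eval (ZGL.coords (1 : ZGL n)) (MvPolynomial.pderiv ij p)

/-- The Lie algebra of a closed subgroup `H` of `GL_n(ℂ)`: the tangent space at the identity, as a
subspace of `𝔤𝔩_n(ℂ)`. -/
def lieAlg {n : ℕ} (H : Subgroup (ZGL n)) : Submodule ℂ (Matrix (Fin n) (Fin n) ℂ) where
  carrier := {X | ∀ p : MvPolynomial (Fin n × Fin n) ℂ,
    (∀ h ∈ H, MvPolynomial.eval h.coords p = 0) → derivAtOne X p = 0}
  zero_mem' p _ := by simp [derivAtOne]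
  add_mem' {X Y} hX hY p hp := by
    have h1 := hX p hp
    have h2 := hY p hp
    simp only [derivAtOne, Matrix.add_apply, add_mul, Finset.sum_add_distrib] at h1 h2 ⊢
    rw [h1, h2, add_zero]
  smul_mem' c X hX p hp := by
    have h1 := hX p hp
    simp only [derivAtOne, Matrix.smul_apply, smul_eq_mul, mul_assoc, ← Finset.mul_sum] at h1 ⊢
    rw [h1, mul_zero]

/-- Chain rule for polynomials. -/
lemma eval_pderiv_bind₁ {σ : Type*} [Fintype σ] (F : σ → MvPolynomial σ ℂ) (a : σ → ℂ) (i : σ)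
    (p : MvPolynomial σ ℂ) :
    MvPolynomial.eval a (MvPolynomial.pderiv i (MvPolynomial.bind₁ F p)) =
      ∑ k, MvPolynomial.eval (fun j => MvPolynomial.eval a (F j)) (MvPolynomial.pderiv k p) *
        MvPolynomial.eval a (MvPolynomial.pderiv i (F k)) := by
  classical
  have he : ∀ q, MvPolynomial.eval a (MvPolynomial.bind₁ F q) =
      MvPolynomial.eval (fun j => MvPolynomial.eval a (F j)) q := by
    intro q
    rw [MvPolynomial.eval, MvPolynomial.eval₂Hom_bind₁]
    rfl
  induction p using MvPolynomial.induction_on with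
  | C c => simp
  | add p q hp hq => simp only [map_add, hp, hq, add_mul, Finset.sum_add_distrib]
  | mul_X p j hp =>
    simp only [map_mul, Derivation.leibniz, map_add, smul_eq_mul, hp, he,
      MvPolynomial.bind₁_X_right, MvPolynomial.pderiv_X, MvPolynomial.eval_X, add_mul,
      Finset.sum_add_distrib, Finset.mul_sum]
    congr 1
    · rw [Finset.sum_eq_single j]
      · simp
      · intro k _ hk
        simp [hk.symm]
      · simp
    · exact Finset.sum_congr rfl fun k _ => by ring

/-- Conjugation `h ↦ g h g⁻¹` in terms of matrix entries. -/
def conjPoly {n : ℕ} (g : ZGL n) (ij : Fin n × Fin n) : MvPolynomial (Fin n × Fin n) ℂ :=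
  ∑ kl : Fin n × Fin n,
    MvPolynomial.C (g.mat ij.1 kl.1 * (g⁻¹).mat kl.2 ij.2) * MvPolynomial.X kl

lemma sum_conj {n : ℕ} (g : ZGL n) (X : Matrix (Fin n) (Fin n) ℂ) (i j : Fin n) :
    ∑ kl : Fin n × Fin n, g.mat i kl.1 * (g⁻¹).mat kl.2 j * X kl.1 kl.2 =
      (g.mat * X * (g⁻¹).mat) i j := by
  simp only [Matrix.mul_apply, Finset.sum_mul, Fintype.sum_prod_type]
  rw [Finset.sum_comm]
  exact Finset.sum_congr rfl fun _ _ => Finset.sum_congr rfl fun _ _ => by ring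

lemma eval_conjPoly {n : ℕ} (g h : ZGL n) (ij : Fin n × Fin n) :
    MvPolynomial.eval h.coords (conjPoly g ij) = (g * h * g⁻¹).coords ij := by
  simp only [conjPoly, map_sum, map_mul, MvPolynomial.eval_C, MvPolynomial.eval_X]
  exact sum_conj g h.mat ij.1 ij.2

/-- If conjugation by `g` maps `H` to itself then it maps the Lie algebra of `H` to itself. -/
lemma conj_mem_lieAlg {n : ℕ} {H : Subgroup (ZGL n)} {g : ZGL n}
    (hg : ∀ h ∈ H, g * h * g⁻¹ ∈ H) {X : Matrix (Fin n) (Fin n) ℂ} (hX : X ∈ lieAlg H) :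
    g.mat * X * (g⁻¹).mat ∈ lieAlg H := by
  classical
  intro p hp
  have he : ∀ h : ZGL n, (fun j => MvPolynomial.eval h.coords (conjPoly g j)) =
      (g * h * g⁻¹).coords := fun h => funext fun j => eval_conjPoly g h j
  have h1 := hX (MvPolynomial.bind₁ (conjPoly g) p) (by
    intro h hh
    have : MvPolynomial.eval h.coords (MvPolynomial.bind₁ (conjPoly g) p) =
        MvPolynomial.eval (fun j => MvPolynomial.eval h.coords (conjPoly g j)) p := by
      rw [MvPolynomial.eval, MvPolynomial.eval₂Hom_bind₁]
      rfl
    rw [this, he]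
    exact hp _ (hg h hh))
  simp only [derivAtOne, eval_pderiv_bind₁, he, mul_one, mul_inv_cancel, Finset.mul_sum] at h1
  rw [Finset.sum_comm] at h1
  simp only [derivAtOne]
  rw [← h1]
  refine Finset.sum_congr rfl fun kl _ => ?_
  rw [← sum_conj, Finset.sum_mul]
  refine Finset.sum_congr rfl fun ij _ => ?_
  have : MvPolynomial.eval (ZGL.coords (1 : ZGL n)) (MvPolynomial.pderiv ij (conjPoly g kl)) =
      g.mat kl.1 ij.1 * (g⁻¹).mat ij.2 kl.2 := by
    simp only [conjPoly, map_sum, MvPolynomial.pderiv_C_mul, MvPolynomial.pderiv_X]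
    rw [Finset.sum_eq_single ij]
    · simp
    · intro b _ hb
      simp [hb]
    · simp
  rw [this]
  ring

/-- If `g` commutes with `H` then it fixes the Lie algebra of `H`. -/
lemma conj_eq_self {n : ℕ} {H : Subgroup (ZGL n)} {g : ZGL n}
    (hg : ∀ h ∈ H, g * h = h * g) {X : Matrix (Fin n) (Fin n) ℂ} (hX : X ∈ lieAlg H) :
    g.mat * X * (g⁻¹).mat = X := by
  classical
  have key : g.mat * X = X * g.mat := by
    ext i j
    have h1 := hX (∑ k, (MvPolynomial.C (g.mat i k) * MvPolynomial.X (k, j) -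
      MvPolynomial.C (g.mat k j) * MvPolynomial.X (i, k))) (by
        intro h hh
        have := congrFun (congrFun (congrArg ZGL.mat (hg h hh)) i) j
        simp only [ZGL.mat_mul, Matrix.mul_apply] at this
        simp only [map_sum, map_sub, map_mul, MvPolynomial.eval_C, MvPolynomial.eval_X,
          Finset.sum_sub_distrib, ZGL.coords, this]
        rw [sub_eq_zero]
        exact Finset.sum_congr rfl fun _ _ => mul_comm _ _)
    have h2 : ∀ (c : ℂ) (k l : Fin n), derivAtOne X (MvPolynomial.C c * MvPolynomial.X (k, l)) =
        c * X k l := by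
      intro c k l
      simp only [derivAtOne, MvPolynomial.pderiv_C_mul, MvPolynomial.pderiv_X]
      rw [Finset.sum_eq_single (k, l)]
      · simp [mul_comm]
      · intro b _ hb
        simp [Ne.symm hb]
      · simp
    have hsub : ∀ p q, derivAtOne X (p - q) = derivAtOne X p - derivAtOne X q := by
      intro p q
      simp [derivAtOne, mul_sub]
    have hsum : ∀ F : Fin n → MvPolynomial (Fin n × Fin n) ℂ,
        derivAtOne X (∑ k, F k) = ∑ k, derivAtOne X (F k) := by
      intro F
      simp only [derivAtOne, map_sum, Finset.mul_sum]
      exact Finset.sum_comm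
    have h3 : derivAtOne X (∑ k, (MvPolynomial.C (g.mat i k) * MvPolynomial.X (k, j) -
        MvPolynomial.C (g.mat k j) * MvPolynomial.X (i, k))) =
        ∑ k, (g.mat i k * X k j - g.mat k j * X i k) := by
      rw [hsum]
      exact Finset.sum_congr rfl fun k _ => by rw [hsub, h2, h2]
    rw [h3, Finset.sum_sub_distrib, sub_eq_zero] at h1
    rw [Matrix.mul_apply, Matrix.mul_apply, h1]
    exact Finset.sum_congr rfl fun _ _ => mul_comm _ _
  rw [key, mul_assoc, ZGL.mat_mul_inv, mul_one]

/-- The adjoint representation of `H` on its Lie algebra. -/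
def adjointRep {n : ℕ} (H : Subgroup (ZGL n)) : Representation ℂ H (lieAlg H) where
  toFun g :=
    { toFun := fun X => ⟨(g : ZGL n).mat * X.1 * ((g : ZGL n)⁻¹).mat,
        conj_mem_lieAlg (fun _ hh => H.mul_mem (H.mul_mem g.2 hh) (H.inv_mem g.2)) X.2⟩
      map_add' := fun X Y => by ext1; simp [mul_add, add_mul]
      map_smul' := fun c X => by ext1; simp }
  map_one' := by ext1 X; ext1; simp
  map_mul' g h := by ext1 X; ext1; simp [mul_assoc]

/-- The coadjoint representation of `H` on the dual of its Lie algebra. -/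
def coadjointRep {n : ℕ} (H : Subgroup (ZGL n)) :
    Representation ℂ H (Module.Dual ℂ (lieAlg H)) :=
  (adjointRep H).dual

/-! ### The adjoint quotient `H_ad = H / Z(H)` -/

/-- The centre `Z(H)`, as a subgroup of the ambient general linear group. -/
def centerIn {n : ℕ} (H : Subgroup (ZGL n)) : Subgroup (ZGL n) :=
  (Subgroup.center H).map H.subtype

/-- The Lie algebra of `Z(H)`, inside the Lie algebra of `H`. -/
def centerLie {n : ℕ} (H : Subgroup (ZGL n)) : Submodule ℂ (lieAlg H) :=
  (lieAlg (centerIn H)).comap (lieAlg H).subtype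

/-- The group `H_ad = H / Z(H)`, with the quotient of the Zariski topology. -/
abbrev AdQuotient {n : ℕ} (H : Subgroup (ZGL n)) : Type := H ⧸ Subgroup.center H

/-- The Lie algebra of `H_ad`, which is the quotient of the Lie algebra of `H` by that of `Z(H)`. -/
abbrev AdLie {n : ℕ} (H : Subgroup (ZGL n)) : Type := lieAlg H ⧸ centerLie H

lemma centerLie_le_comap {n : ℕ} (H : Subgroup (ZGL n)) (g : H) :
    centerLie H ≤ (centerLie H).comap (adjointRep H g) := by
  intro X hX
  refine conj_mem_lieAlg (H := centerIn H) (g := (g : ZGL n)) ?_ hX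
  rintro _ ⟨z, hz, rfl⟩
  exact ⟨g * z * g⁻¹, (inferInstance : (Subgroup.center H).Normal).conj_mem z hz g, rfl⟩

/-- The action of `H` on the Lie algebra of `H_ad`. -/
def adjointRepOnAdLie {n : ℕ} (H : Subgroup (ZGL n)) : Representation ℂ H (AdLie H) :=
  (adjointRep H).quotient (centerLie H) (centerLie_le_comap H)

instance {n : ℕ} (H : Subgroup (ZGL n)) :
    Representation.IsTrivial ((adjointRepOnAdLie H).comp (Subgroup.center H).subtype) where
  out z := by
    ext X
    change Submodule.Quotient.mk (adjointRep H z.1 X) = Submodule.Quotient.mk X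
    congr 1
    ext1
    exact conj_eq_self (fun h hh =>
      congrArg Subtype.val ((Subgroup.mem_center_iff.1 z.2 ⟨h, hh⟩).symm)) X.2

/-- The adjoint representation of `H_ad` on its Lie algebra. -/
def adjointRepAd {n : ℕ} (H : Subgroup (ZGL n)) : Representation ℂ (AdQuotient H) (AdLie H) :=
  (adjointRepOnAdLie H).ofQuotient (Subgroup.center H)

/-- The coadjoint representation of `H_ad` on the dual of its Lie algebra. -/
def coadjointRepAd {n : ℕ} (H : Subgroup (ZGL n)) :
    Representation ℂ (AdQuotient H) (Module.Dual ℂ (AdLie H)) :=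
  (adjointRepAd H).dual

/-- The subset of `Lie(H_ad)*` that corresponds to a subset `O` of `Lie(H)*` under the inclusion
`Lie(H_ad)* → Lie(H)*` dual to the projection `Lie(H) → Lie(H_ad)`. -/
def adOrbit {n : ℕ} (H : Subgroup (ZGL n)) (O : Set (Module.Dual ℂ (lieAlg H))) :
    Set (Module.Dual ℂ (AdLie H)) :=
  {e | e ∘ₗ (centerLie H).mkQ ∈ O}

/-! ### Reductive groups, maximal tori, roots and standard Levi subgroups -/

/-- `G` is a connected reductive algebraic group: a Zariski closed connected subgroup of `GL_n(ℂ)`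
with trivial unipotent radical. -/
structure IsConnectedReductive {n : ℕ} (G : Subgroup (ZGL n)) : Prop where
  isClosed : IsClosed (G : Set (ZGL n))
  isConnected : IsConnected (G : Set (ZGL n))
  unipotentRadical_eq_bot : ∀ U : Subgroup (ZGL n), U ≤ G →
    IsClosed (U : Set (ZGL n)) → IsConnected (U : Set (ZGL n)) →
    (∀ g ∈ G, ∀ u ∈ U, g * u * g⁻¹ ∈ U) → (∀ u ∈ U, IsNilpotent (u.mat - 1)) → U = ⊥

/-- `T` is a torus: a closed, connected, diagonalizable subgroup of `GL_n(ℂ)`. -/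
structure IsTorus {n : ℕ} (T : Subgroup (ZGL n)) : Prop where
  isClosed : IsClosed (T : Set (ZGL n))
  isConnected : IsConnected (T : Set (ZGL n))
  diagonalizable : ∃ P : ZGL n, ∀ t ∈ T, (P * t * P⁻¹).mat.IsDiag

/-- `T` is a maximal torus of `G`. -/
structure IsMaximalTorus {n : ℕ} (G T : Subgroup (ZGL n)) : Prop where
  le : T ≤ G
  isTorus : IsTorus T
  maximal : ∀ S : Subgroup (ZGL n), IsTorus S → S ≤ G → T ≤ S → S = T

/-- The set `Φ` of roots of `G` with respect to `T`: the nontrivial characters of `T` that occur in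
the Lie algebra of `G` (such a character is automatically a morphism of algebraic groups). The
group of characters is written multiplicatively. -/
def rootSet {n : ℕ} (G T : Subgroup (ZGL n)) : Set (T →* ℂˣ) :=
  {α | α ≠ 1 ∧ ∃ X ∈ lieAlg G, X ≠ 0 ∧
    ∀ t : T, (t : ZGL n).mat * X * ((t : ZGL n)⁻¹).mat = (α t : ℂ) • X}

/-- `simple` is a base of the root system `Φ`: it consists of roots, it is linearly independent, and each root or
its inverse is a combination of elements of `simple` with coefficients in `ℕ`. -/
structure IsRootBase {n : ℕ} (G T : Subgroup (ZGL n)) (simple : Set (T →* ℂˣ)) : Prop where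
  subset : simple ⊆ rootSet G T
  linearIndep : ∀ c : (T →* ℂˣ) →₀ ℤ, (c.support : Set (T →* ℂˣ)) ⊆ simple →
    (c.prod fun α m => α ^ m) = 1 → c = 0
  mem_or_inv_mem : ∀ β ∈ rootSet G T, β ∈ Submonoid.closure simple ∨ β⁻¹ ∈ Submonoid.closure simple

/-- The torus `S_Δ = (⋂_{α ∈ Δ} ker α)°`. -/
def leviTorus {n : ℕ} (T : Subgroup (ZGL n)) (Delta : Set (T →* ℂˣ)) : Subgroup (ZGL n) :=
  ((identityComponent (⨅ α ∈ Delta, MonoidHom.ker α : Subgroup T)).map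
    (Subgroup.subtype _)).map T.subtype

/-- The standard Levi subgroup `L_Δ`: the centralizer in `G` of the torus `(⋂_{α ∈ Δ} ker α)°`. It
is the Levi factor containing `T` of the standard parabolic subgroup attached to `Δ`. -/
def standardLevi {n : ℕ} (G T : Subgroup (ZGL n)) (Delta : Set (T →* ℂˣ)) : Subgroup (ZGL n) :=
  G ⊓ Subgroup.centralizer (leviTorus T Delta : Set (ZGL n))

end

/-!
The heart of the matter is that the centre of a standard Levi subgroup `L_Δ` is connected when
`Z(G) = 1`. The second part reduces to the first, because `Z(G)` is contained in every `L_Δ`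
(`center_eq_bot_of_centerIn_inf_eq_bot`).

*Connected centre.* If `Z(G) = 1` then the simple roots separate the points of `T`
(`eq_one_of_simple_eq_one`), so that they generate the character lattice; as they are also
independent, every system of values on them is taken along a one-parameter subgroup of `T`
(`exists_exp_of_simple`). Hence `⋂_{α ∈ Δ} ker α` is connected (`isConnected_iInf_ker`). It
is the centre of `L_Δ` (`centerIn_standardLevi`): a central element of `L_Δ` commutes with `T`, so it
lies in `T` (`mem_of_commute_torus`), and it commutes with the root subgroups of the roots in `Δ`.

Both facts on `T` follow from `eq_one_of_conj_simple_eq`: an element of `C_G(T)` that fixes a root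
vector for each simple root is trivial. This is a statement on the Lie algebra `𝔤` of `G`.
Zariski closed subgroups contain the exponentials of their Lie algebras (`exp_mem`), and a connected
group is determined by its Lie algebra (`le_of_lieAlg_le`); since the unipotent radical and the centre
are trivial, `𝔤` has no abelian ideals (`eq_bot_of_abelian_ideal`) and its Killing form is
nondegenerate by Cartan's criterion. The Lie algebra of `T` is a Cartan subalgebra
(`IsMaximalTorus.isCartanSubalgebra`): by the Jordan decomposition, whose semisimple part stays in `𝔤`
(`semisimple_part_mem_lieAlg`), its centralizer is a sum of itself and of nilpotent matrices that
are orthogonal to `𝔤`. An automorphism that fixes the Cartan subalgebra and the simple root vectors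
is the identity (`map_eq_self_of_rootSpace_eq`): a positive root that is not simple has a positive
pairing with some simple root, and bracketing with a root vector of the negative of that simple root
gives a root vector of a lower root.

*Orbits.* A nilpotent orbit vanishes on the Lie algebra of the centre, since it is constant there and
has `0` in its closure; so it comes from an orbit of the adjoint quotient. The stabiliser in `L` maps
onto the stabiliser in `L / Z(L)` by an open map with kernel `Z(L)`, and connectedness of `Z(L)` makes
this an isomorphism on component groups (`nonempty_componentGroup_mulEquiv`).
-/

open MvPolynomial

/-! ### Zariski closed sets and one-parameter subgroups -/

/-- Polynomial functions in the matrix entries are Zariski continuous: their zero loci are closed. -/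
lemma isClosed_zeroLocus {n : ℕ} (p : MvPolynomial (Fin n × Fin n) ℂ) :
    IsClosed {g : ZGL n | eval g.coords p = 0} := by
  rw [← isOpen_compl_iff]
  exact (@isOpen_induced_iff _ _ (zariskiTopology _) _ _).2
    ⟨{x | eval x p ≠ 0}, TopologicalSpace.isOpen_generateFrom_of_mem ⟨p, rfl⟩, rfl⟩

/-- The nonvanishing loci of polynomials form a basis of the Zariski topology on `ℂ^σ`. -/
lemma isTopologicalBasis_zariski (σ : Type*) :
    @TopologicalSpace.IsTopologicalBasis _ (zariskiTopology σ)
      (Set.range fun p : MvPolynomial σ ℂ => {x : σ → ℂ | eval x p ≠ 0}) := by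
  let _ := zariskiTopology σ
  refine ⟨?_, ?_, rfl⟩
  · rintro _ ⟨p, rfl⟩ _ ⟨q, rfl⟩ x hx
    refine ⟨_, ⟨p * q, rfl⟩, ?_, ?_⟩
    · simpa using hx
    · intro y hy
      simpa using hy
  · refine Set.eq_univ_of_forall fun x => ⟨_, ⟨1, rfl⟩, ?_⟩
    simp

lemma exists_polynomial_of_notMem_closed {n : ℕ} {C : Set (ZGL n)} (hC : IsClosed C) {g : ZGL n}
    (hg : g ∉ C) : ∃ p : MvPolynomial (Fin n × Fin n) ℂ,
      (∀ h ∈ C, eval h.coords p = 0) ∧ eval g.coords p ≠ 0 := by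
  obtain ⟨U, hU, hUC⟩ := (@isOpen_induced_iff _ _ (zariskiTopology _) _ _).1 hC.isOpen_compl
  have hgU : g.coords ∈ U := by
    have : g ∈ ZGL.coords ⁻¹' U := hUC ▸ hg
    exact this
  let _ := zariskiTopology (Fin n × Fin n)
  obtain ⟨_, ⟨p, rfl⟩, h1, h2⟩ :=
    (isTopologicalBasis_zariski (Fin n × Fin n)).exists_subset_of_mem_open hgU hU
  refine ⟨p, fun h hh => ?_, h1⟩
  by_contra hne
  have : h ∈ ZGL.coords ⁻¹' U := h2 hne
  rw [hUC] at this
  exact this hh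

lemma mem_of_isClosed {n : ℕ} {C : Set (ZGL n)} (hC : IsClosed C) {g : ZGL n}
    (hg : ∀ p : MvPolynomial (Fin n × Fin n) ℂ, (∀ h ∈ C, eval h.coords p = 0) →
      eval g.coords p = 0) : g ∈ C := by
  by_contra h
  obtain ⟨p, hp, hp'⟩ := exists_polynomial_of_notMem_closed hC h
  exact hp' (hg p hp)

namespace ZGL

variable {n : ℕ}

@[ext] lemma ext {g h : ZGL n} (H : g.mat = h.mat) : g = h := Units.ext H

lemma isUnit_mat (g : ZGL n) : IsUnit g.mat := ⟨(g : GL (Fin n) ℂ), rfl⟩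

lemma mat_inv (g : ZGL n) : (g⁻¹).mat = (g.mat)⁻¹ :=
  (Matrix.inv_eq_right_inv (by simp)).symm

@[simp] lemma coords_apply (g : ZGL n) (ij : Fin n × Fin n) : g.coords ij = g.mat ij.1 ij.2 := rfl

/-- The element `exp X` of `GL_n(ℂ)`. -/
noncomputable def exp (X : Matrix (Fin n) (Fin n) ℂ) : ZGL n :=
  (Matrix.isUnit_exp X).unit

@[simp] lemma mat_exp (X : Matrix (Fin n) (Fin n) ℂ) : (exp X).mat = NormedSpace.exp X := rfl

@[simp] lemma exp_zero : exp (0 : Matrix (Fin n) (Fin n) ℂ) = 1 := by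
  ext1; simp

lemma exp_add {X Y : Matrix (Fin n) (Fin n) ℂ} (h : Commute X Y) :
    exp (X + Y) = exp X * exp Y := by
  ext1; simp [Matrix.exp_add_of_commute _ _ h]

lemma conj_exp (g : ZGL n) (X : Matrix (Fin n) (Fin n) ℂ) :
    g * exp X * g⁻¹ = exp (g.mat * X * (g⁻¹).mat) := by
  ext1
  simp [mat_inv, Matrix.exp_conj _ _ g.isUnit_mat]

lemma hasDerivAt_exp (X : Matrix (Fin n) (Fin n) ℂ) (c : ℂ) (ij : Fin n × Fin n) :
    HasDerivAt (fun u : ℂ => (exp (u • X)).coords ij) (((exp (c • X)).mat * X) ij.1 ij.2) c := by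
  let _ : NormedRing (Matrix (Fin n) (Fin n) ℂ) := Matrix.linftyOpNormedRing
  let _ : NormedAlgebra ℂ (Matrix (Fin n) (Fin n) ℂ) := Matrix.linftyOpNormedAlgebra
  have h := hasDerivAt_exp_smul_const (𝕂 := ℂ) X c
  let l : Matrix (Fin n) (Fin n) ℂ →L[ℂ] ℂ :=
    LinearMap.toContinuousLinearMap (Matrix.entryLinearMap ℂ ℂ ij.1 ij.2)
  exact l.hasFDerivAt.comp_hasDerivAt c h

lemma mat_exp_commute {X Y : Matrix (Fin n) (Fin n) ℂ} (h : Commute X Y) :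
    Commute (exp X).mat Y := by
  let _ : NormedRing (Matrix (Fin n) (Fin n) ℂ) := Matrix.linftyOpNormedRing
  let _ : NormedAlgebra ℂ (Matrix (Fin n) (Fin n) ℂ) := Matrix.linftyOpNormedAlgebra
  exact h.exp_left

end ZGL

/-- The left invariant vector field `g ↦ g X` on the space of matrices, as a derivation of the
polynomial ring. -/
noncomputable def leftInvDeriv {n : ℕ} (X : Matrix (Fin n) (Fin n) ℂ) :
    Derivation ℂ (MvPolynomial (Fin n × Fin n) ℂ) (MvPolynomial (Fin n × Fin n) ℂ) :=
  mkDerivation ℂ fun ij => ∑ k, MvPolynomial.X (ij.1, k) * C (X k ij.2)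

lemma eval_leftInvDeriv_X {n : ℕ} (X : Matrix (Fin n) (Fin n) ℂ) (g : ZGL n)
    (ij : Fin n × Fin n) :
    eval g.coords (leftInvDeriv X (MvPolynomial.X ij)) = (g.mat * X) ij.1 ij.2 := by
  simp [leftInvDeriv, mkDerivation_X, Matrix.mul_apply]

lemma hasDerivAt_eval_exp {n : ℕ} (X : Matrix (Fin n) (Fin n) ℂ)
    (p : MvPolynomial (Fin n × Fin n) ℂ) (c : ℂ) :
    HasDerivAt (fun u : ℂ => eval (ZGL.exp (u • X)).coords p)
      (eval (ZGL.exp (c • X)).coords (leftInvDeriv X p)) c := by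
  induction p using MvPolynomial.induction_on with
  | C a => simpa using hasDerivAt_const c a
  | add p q hp hq =>
    simp only [map_add]
    exact hp.add hq
  | mul_X p ij hp =>
    have := hp.mul (ZGL.hasDerivAt_exp X c ij)
    simp only [map_mul, eval_X, Derivation.leibniz, smul_eq_mul, map_add, eval_leftInvDeriv_X]
    convert! this using 1
    ring

/-- A derivation of a polynomial ring is a combination of the partial derivatives. -/
lemma eval_leftInvDeriv {n : ℕ} (X : Matrix (Fin n) (Fin n) ℂ) (g : ZGL n)
    (p : MvPolynomial (Fin n × Fin n) ℂ) :
    eval g.coords (leftInvDeriv X p) =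
      ∑ ij, (g.mat * X) ij.1 ij.2 * eval g.coords (pderiv ij p) := by
  classical
  induction p using MvPolynomial.induction_on with
  | C a => simp
  | add p q hp hq => simp [hp, hq, mul_add, Finset.sum_add_distrib]
  | mul_X p ij hp =>
    simp only [map_mul, eval_X, Derivation.leibniz, smul_eq_mul, map_add, eval_leftInvDeriv_X, hp,
      mul_add, Finset.sum_add_distrib, pderiv_X, Finset.mul_sum]
    congr 1
    · rw [Finset.sum_eq_single ij]
      · simp [mul_comm]
      · intro b _ hb
        simp [hb.symm]
      · simp
    · exact Finset.sum_congr rfl fun k _ => by ring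

/-- Left translation by `g`, in terms of matrix entries. -/
noncomputable def leftMulPoly {n : ℕ} (g : ZGL n) (ij : Fin n × Fin n) :
    MvPolynomial (Fin n × Fin n) ℂ :=
  ∑ k, C (g.mat ij.1 k) * MvPolynomial.X (k, ij.2)

lemma eval_bind₁ {σ : Type*} (F : σ → MvPolynomial σ ℂ) (a : σ → ℂ) (p : MvPolynomial σ ℂ) :
    eval a (bind₁ F p) = eval (fun j => eval a (F j)) p := by
  rw [eval, eval₂Hom_bind₁]
  rfl

lemma eval_leftMulPoly {n : ℕ} (g h : ZGL n) :
    (fun ij => eval h.coords (leftMulPoly g ij)) = (g * h).coords := by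
  funext ij
  simp [leftMulPoly, Matrix.mul_apply]

lemma derivAtOne_bind₁_leftMulPoly {n : ℕ} (X : Matrix (Fin n) (Fin n) ℂ) (g : ZGL n)
    (p : MvPolynomial (Fin n × Fin n) ℂ) :
    derivAtOne X (bind₁ (leftMulPoly g) p) = eval g.coords (leftInvDeriv X p) := by
  classical
  rw [eval_leftInvDeriv]
  simp only [derivAtOne, eval_pderiv_bind₁, eval_leftMulPoly, mul_one, Finset.mul_sum]
  rw [Finset.sum_comm]
  refine Finset.sum_congr rfl fun kl _ => ?_
  have h : ∀ ij : Fin n × Fin n, eval (ZGL.coords (1 : ZGL n)) (pderiv ij (leftMulPoly g kl)) =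
      if ij.2 = kl.2 then g.mat kl.1 ij.1 else 0 := by
    intro ij
    simp only [leftMulPoly, map_sum, pderiv_C_mul, pderiv_X, map_mul, eval_C]
    split_ifs with h
    · rw [Finset.sum_eq_single ij.1]
      · simp [← h]
      · intro b _ hb
        rw [Pi.single_apply, if_neg]
        · simp
        · rintro rfl; exact hb rfl
      · simp
    · refine Finset.sum_eq_zero fun b _ => ?_
      rw [Pi.single_apply, if_neg]
      · simp
      · rintro rfl; exact h rfl
  simp only [h, Matrix.mul_apply, Finset.sum_mul, Fintype.sum_prod_type]
  refine Finset.sum_congr rfl fun k _ => ?_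
  rw [Finset.sum_eq_single kl.2]
  · simp; ring
  · intro b _ hb
    simp [hb]
  · simp

/-- The left invariant vector fields attached to the Lie algebra of `H` are tangent to `H`. -/
lemma eval_leftInvDeriv_eq_zero {n : ℕ} {H : Subgroup (ZGL n)} {X : Matrix (Fin n) (Fin n) ℂ}
    (hX : X ∈ lieAlg H) {p : MvPolynomial (Fin n × Fin n) ℂ}
    (hp : ∀ h ∈ H, eval h.coords p = 0) {g : ZGL n} (hg : g ∈ H) :
    eval g.coords (leftInvDeriv X p) = 0 := by
  rw [← derivAtOne_bind₁_leftMulPoly]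
  refine hX _ fun h hh => ?_
  rw [eval_bind₁, eval_leftMulPoly]
  exact hp _ (H.mul_mem hg hh)

/-- The exponentials of elements of the Lie algebra of a closed subgroup lie in the subgroup: a
polynomial that vanishes on the subgroup has all derivatives zero along the one-parameter
subgroup. -/
lemma exp_mem {n : ℕ} {H : Subgroup (ZGL n)} (hH : IsClosed (H : Set (ZGL n)))
    {X : Matrix (Fin n) (Fin n) ℂ} (hX : X ∈ lieAlg H) : ZGL.exp X ∈ H := by
  refine mem_of_isClosed hH fun p hp => ?_
  set f : MvPolynomial (Fin n × Fin n) ℂ → ℂ → ℂ := fun p u => eval (ZGL.exp (u • X)).coords p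
    with hf
  have hd : ∀ p, Differentiable ℂ (f p) := fun p u => (hasDerivAt_eval_exp X p u).differentiableAt
  have hi : ∀ k p, iteratedDeriv k (f p) = f ((leftInvDeriv X)^[k] p) := by
    intro k
    induction k with
    | zero => simp
    | succ k ih =>
      intro p
      rw [iteratedDeriv_succ', Function.iterate_succ_apply, ← ih]
      congr 1
      funext u
      exact (hasDerivAt_eval_exp X p u).deriv
  have h0 : ∀ k p, (∀ h ∈ H, eval h.coords p = 0) →
      ∀ h ∈ H, eval h.coords ((leftInvDeriv X)^[k] p) = 0 := by
    intro k
    induction k with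
    | zero => intro p hp; simpa using hp
    | succ k ih =>
      intro p hp
      rw [Function.iterate_succ_apply]
      exact ih _ fun h hh => eval_leftInvDeriv_eq_zero hX hp hh
  have := Complex.taylorSeries_eq_of_entire' (c := 0) (z := 1) (hd p)
  simp only [hi] at this
  have hz : ∀ k, f ((leftInvDeriv X)^[k] p) 0 = 0 := by
    intro k
    simpa [hf] using h0 k p hp 1 H.one_mem
  simp only [hz, mul_zero, zero_mul, tsum_zero] at this
  simpa [hf] using this.symm

lemma exp_smul_mem {n : ℕ} {H : Subgroup (ZGL n)} (hH : IsClosed (H : Set (ZGL n)))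
    {X : Matrix (Fin n) (Fin n) ℂ} (hX : X ∈ lieAlg H) (c : ℂ) : ZGL.exp (c • X) ∈ H :=
  exp_mem hH (Submodule.smul_mem _ c hX)

lemma eval_one_leftInvDeriv {n : ℕ} (X : Matrix (Fin n) (Fin n) ℂ)
    (p : MvPolynomial (Fin n × Fin n) ℂ) :
    eval (ZGL.coords (1 : ZGL n)) (leftInvDeriv X p) = derivAtOne X p := by
  rw [eval_leftInvDeriv]
  simp [derivAtOne]

lemma mem_lieAlg_of_exp_mem {n : ℕ} {H : Subgroup (ZGL n)} {X : Matrix (Fin n) (Fin n) ℂ}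
    (h : ∀ c : ℂ, ZGL.exp (c • X) ∈ H) : X ∈ lieAlg H := by
  intro p hp
  have h1 := hasDerivAt_eval_exp X p 0
  have h2 := (h1.congr_of_eventuallyEq (f₁ := fun _ => 0)
    (Filter.Eventually.of_forall fun u => (hp _ (h u)).symm)).unique
    (hasDerivAt_const (0 : ℂ) (0 : ℂ))
  rwa [zero_smul, ZGL.exp_zero, eval_one_leftInvDeriv] at h2

lemma lieAlg_mono {n : ℕ} {H K : Subgroup (ZGL n)} (h : H ≤ K) : lieAlg H ≤ lieAlg K := by
  intro X hX p hp
  exact hX p fun g hg => hp g (h hg)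

/-- One-parameter subgroups are continuous for the Zariski topology on the target. -/
lemma continuous_exp_smul {n : ℕ} (X : Matrix (Fin n) (Fin n) ℂ) :
    Continuous fun c : ℂ => ZGL.exp (c • X) := by
  refine continuous_induced_rng.2 ?_
  rw [@continuous_generateFrom_iff]
  rintro _ ⟨p, rfl⟩
  have h : Continuous fun u : ℂ => eval (ZGL.exp (u • X)).coords p :=
    continuous_iff_continuousAt.2 fun u => (hasDerivAt_eval_exp X p u).continuousAt
  exact isOpen_ne.preimage h

/-- A linear functional that is constant along `exp(cX) Y exp(-cX)` vanishes at the commutator of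
`X` and `Y`. -/
lemma map_commutator_eq_zero {n : ℕ} {X Y : Matrix (Fin n) (Fin n) ℂ}
    (l : Matrix (Fin n) (Fin n) ℂ →ₗ[ℂ] ℂ) (a : ℂ)
    (h : ∀ c : ℂ, l ((ZGL.exp (c • X)).mat * Y * ((ZGL.exp (c • X))⁻¹).mat) = a) :
    l (X * Y - Y * X) = 0 := by
  let _ : NormedRing (Matrix (Fin n) (Fin n) ℂ) := Matrix.linftyOpNormedRing
  let _ : NormedAlgebra ℂ (Matrix (Fin n) (Fin n) ℂ) := Matrix.linftyOpNormedAlgebra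
  have hinv : ∀ c : ℂ, ((ZGL.exp (c • X))⁻¹).mat = NormedSpace.exp (c • (-X)) := by
    intro c
    rw [ZGL.mat_inv, ZGL.mat_exp, smul_neg, Matrix.exp_neg]
  simp only [hinv, ZGL.mat_exp] at h
  have h1 := ((hasDerivAt_exp_smul_const (𝕂 := ℂ) X 0).mul_const Y).mul
    (hasDerivAt_exp_smul_const (𝕂 := ℂ) (-X) 0)
  have h2 := (LinearMap.toContinuousLinearMap l).hasFDerivAt.comp_hasDerivAt (0 : ℂ) h1
  have h3 := h2.congr_of_eventuallyEq (f₁ := fun _ => a)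
    (Filter.Eventually.of_forall fun c => (h c).symm)
  have h4 := h3.unique (hasDerivAt_const 0 a)
  simp only [zero_smul, NormedSpace.exp_zero, one_mul, mul_one, mul_neg] at h4
  rw [sub_eq_add_neg]
  exact h4

lemma commutator_mem_of_conj_exp_mem {n : ℕ} {X Y : Matrix (Fin n) (Fin n) ℂ}
    (W : Submodule ℂ (Matrix (Fin n) (Fin n) ℂ))
    (h : ∀ c : ℂ, (ZGL.exp (c • X)).mat * Y * ((ZGL.exp (c • X))⁻¹).mat ∈ W) :
    X * Y - Y * X ∈ W := by
  by_contra hW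
  obtain ⟨l, hl, hl'⟩ := Submodule.exists_le_ker_of_notMem hW
  exact hl (map_commutator_eq_zero l 0 fun c => hl' (h c))

/-! ### A connected group is determined by its Lie algebra -/

/-- The ideal of polynomials in the matrix entries that vanish on `S`. -/
noncomputable def matVanishingIdeal {n : ℕ} (S : Set (ZGL n)) :
    Ideal (MvPolynomial (Fin n × Fin n) ℂ) where
  carrier := {p | ∀ h ∈ S, eval h.coords p = 0}
  zero_mem' := by simp
  add_mem' {p q} hp hq h hh := by simp [hp h hh, hq h hh]
  smul_mem' c p hp h hh := by simp [hp h hh]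

/-- The maximal ideal of polynomials that vanish at the identity matrix. -/
noncomputable def idealAtOne (n : ℕ) : Ideal (MvPolynomial (Fin n × Fin n) ℂ) :=
  RingHom.ker (eval (ZGL.coords (1 : ZGL n)))

lemma mem_idealAtOne {n : ℕ} {p : MvPolynomial (Fin n × Fin n) ℂ} :
    p ∈ idealAtOne n ↔ eval (ZGL.coords (1 : ZGL n)) p = 0 := RingHom.mem_ker

/-- The coordinate `x_ij - δ_ij`, which vanishes at the identity matrix. -/
noncomputable def coordAtOne {n : ℕ} (ij : Fin n × Fin n) : MvPolynomial (Fin n × Fin n) ℂ :=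
  MvPolynomial.X ij - C (ZGL.coords (1 : ZGL n) ij)

lemma coordAtOne_mem {n : ℕ} (ij : Fin n × Fin n) : coordAtOne ij ∈ idealAtOne n := by
  simp [mem_idealAtOne, coordAtOne]

/-- The first order Taylor expansion at the identity matrix. -/
lemma sub_taylor_mem {n : ℕ} (p : MvPolynomial (Fin n × Fin n) ℂ) :
    p - C (eval (ZGL.coords (1 : ZGL n)) p) -
      ∑ ij, C (eval (ZGL.coords (1 : ZGL n)) (pderiv ij p)) * coordAtOne ij ∈ idealAtOne n ^ 2 := by
  classical
  induction p using MvPolynomial.induction_on with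
  | C a => simp
  | add p q hp hq =>
    convert! add_mem hp hq using 1
    simp only [map_add, add_mul, Finset.sum_add_distrib]
    ring
  | mul_X p j hp =>
    have h1 : (p - C (eval (ZGL.coords (1 : ZGL n)) p)) * coordAtOne j ∈ idealAtOne n ^ 2 := by
      rw [pow_two]
      refine Ideal.mul_mem_mul ?_ (coordAtOne_mem j)
      simp [mem_idealAtOne]
    convert! add_mem h1 (Ideal.mul_mem_left _ (C (ZGL.coords (1 : ZGL n) j)) hp) using 1
    have h2 : ∑ ij, C (eval (ZGL.coords (1 : ZGL n)) (pderiv ij (p * MvPolynomial.X j))) *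
        coordAtOne ij = C (eval (ZGL.coords (1 : ZGL n)) p) * coordAtOne j +
          C (ZGL.coords (1 : ZGL n) j) *
          ∑ ij, C (eval (ZGL.coords (1 : ZGL n)) (pderiv ij p)) * coordAtOne ij := by
      simp only [Derivation.leibniz, smul_eq_mul, pderiv_X, map_add, map_mul, eval_X, add_mul,
        Finset.sum_add_distrib, Finset.mul_sum, mul_assoc]
      congr 1
      rw [Finset.sum_eq_single j]
      · simp
      · intro b _ hb
        simp [hb.symm]
      · simp
    rw [h2]
    simp only [map_mul, eval_X, coordAtOne]
    ring

/-- The differential at the identity matrix. -/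
noncomputable def diffAtOne (n : ℕ) :
    MvPolynomial (Fin n × Fin n) ℂ →ₗ[ℂ] Module.Dual ℂ (Matrix (Fin n) (Fin n) ℂ) where
  toFun p :=
    { toFun := fun X => derivAtOne X p
      map_add' := fun X Y => by simp [derivAtOne, add_mul, Finset.sum_add_distrib]
      map_smul' := fun c X => by simp [derivAtOne, mul_assoc, Finset.mul_sum] }
  map_add' p q := by ext; simp [derivAtOne, mul_add, Finset.sum_add_distrib]
  map_smul' c p := by
    ext
    simp [derivAtOne, smul_eq_C_mul, Finset.mul_sum, mul_left_comm]

lemma diffAtOne_apply {n : ℕ} (p : MvPolynomial (Fin n × Fin n) ℂ) (X : Matrix (Fin n) (Fin n) ℂ) :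
    diffAtOne n p X = derivAtOne X p := rfl

lemma mem_sq_of_diffAtOne_eq_zero {n : ℕ} {p : MvPolynomial (Fin n × Fin n) ℂ}
    (hp : p ∈ idealAtOne n) (h : diffAtOne n p = 0) : p ∈ idealAtOne n ^ 2 := by
  classical
  have h1 : ∀ ij, eval (ZGL.coords (1 : ZGL n)) (pderiv ij p) = 0 := by
    intro ij
    have := LinearMap.congr_fun h (Matrix.single ij.1 ij.2 1)
    rw [diffAtOne_apply, derivAtOne, Finset.sum_eq_single ij] at this
    · simpa using this
    · intro b _ hb
      rw [Matrix.single_apply_of_ne, zero_mul]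
      rintro ⟨h1, h2⟩
      exact hb (Prod.ext h1.symm h2.symm)
    · simp
  simpa [h1, mem_idealAtOne.1 hp] using sub_taylor_mem p

/-- The cotangent space of `H` at the identity is dual to the Lie algebra of `H`. -/
lemma mem_sq_sup_of_derivAtOne_eq_zero {n : ℕ} {H : Subgroup (ZGL n)}
    {p : MvPolynomial (Fin n × Fin n) ℂ} (hp : p ∈ idealAtOne n)
    (h : ∀ X ∈ lieAlg H, derivAtOne X p = 0) :
    p ∈ idealAtOne n ^ 2 ⊔ matVanishingIdeal (H : Set (ZGL n)) := by
  set W := ((matVanishingIdeal (H : Set (ZGL n))).restrictScalars ℂ).map (diffAtOne n)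
  have hW : diffAtOne n p ∈ W := by
    rw [← Subspace.dualCoannihilator_dualAnnihilator_eq (W := W), Submodule.mem_dualAnnihilator]
    intro X hX
    refine h X fun q hq => ?_
    rw [Submodule.mem_dualCoannihilator] at hX
    exact hX _ (Submodule.mem_map_of_mem (f := diffAtOne n) hq)
  obtain ⟨q, hq, hqp⟩ := hW
  have hq1 : q ∈ idealAtOne n := mem_idealAtOne.2 (hq 1 H.one_mem)
  rw [← sub_add_cancel p q]
  refine Submodule.add_mem_sup (mem_sq_of_diffAtOne_eq_zero (sub_mem hp hq1) ?_) hq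
  rw [map_sub, hqp, sub_self]

/-- A vector field that vanishes at the identity, is tangent to every subgroup whose Lie algebra
contains that of `G`, and whose linear part at the identity restricts to the identity of the Lie
algebra of `G`; here `π` is a projection to that Lie algebra. -/
noncomputable def eulerField {n : ℕ} {W : Submodule ℂ (Matrix (Fin n) (Fin n) ℂ)}
    (π : Matrix (Fin n) (Fin n) ℂ →ₗ[ℂ] W) :
    Derivation ℂ (MvPolynomial (Fin n × Fin n) ℂ) (MvPolynomial (Fin n × Fin n) ℂ) :=
  ∑ kl : Fin n × Fin n,
    coordAtOne kl • leftInvDeriv (π (Matrix.single kl.1 kl.2 1) : Matrix (Fin n) (Fin n) ℂ)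

lemma eulerField_apply {n : ℕ} {W : Submodule ℂ (Matrix (Fin n) (Fin n) ℂ)}
    (π : Matrix (Fin n) (Fin n) ℂ →ₗ[ℂ] W) (p : MvPolynomial (Fin n × Fin n) ℂ) :
    eulerField π p = ∑ kl : Fin n × Fin n,
      coordAtOne kl * leftInvDeriv (π (Matrix.single kl.1 kl.2 1) : Matrix (Fin n) (Fin n) ℂ) p := by
  have : ∀ (s : Finset (Fin n × Fin n)) (D : Fin n × Fin n → Derivation ℂ
      (MvPolynomial (Fin n × Fin n) ℂ) (MvPolynomial (Fin n × Fin n) ℂ)),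
      (∑ kl ∈ s, D kl) p = ∑ kl ∈ s, D kl p := by
    classical
    intro s D
    induction s using Finset.induction_on with
    | empty => simp
    | insert a s ha ih => simp [Finset.sum_insert ha, ih]
  rw [eulerField, this]
  rfl

section

variable {n : ℕ} {G H : Subgroup (ZGL n)} (π : Matrix (Fin n) (Fin n) ℂ →ₗ[ℂ] lieAlg G)

lemma eulerField_mem_mul (hGH : lieAlg G ≤ lieAlg H) {p : MvPolynomial (Fin n × Fin n) ℂ}
    (hp : p ∈ matVanishingIdeal (H : Set (ZGL n))) :
    eulerField π p ∈ idealAtOne n * matVanishingIdeal (H : Set (ZGL n)) := by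
  rw [eulerField_apply]
  refine sum_mem fun kl _ => Ideal.mul_mem_mul (coordAtOne_mem kl) ?_
  intro h hh
  exact eval_leftInvDeriv_eq_zero (hGH (π _).2) hp hh

lemma eulerField_mem_idealAtOne (p : MvPolynomial (Fin n × Fin n) ℂ) :
    eulerField π p ∈ idealAtOne n := by
  rw [eulerField_apply]
  exact sum_mem fun kl _ => Ideal.mul_mem_right _ _ (coordAtOne_mem kl)

lemma derivAtOne_mul {X : Matrix (Fin n) (Fin n) ℂ} {p q : MvPolynomial (Fin n × Fin n) ℂ}
    (hp : p ∈ idealAtOne n) :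
    derivAtOne X (p * q) = derivAtOne X p * eval (ZGL.coords (1 : ZGL n)) q := by
  simp only [derivAtOne, Derivation.leibniz, map_add, smul_eq_mul, map_mul,
    mem_idealAtOne.1 hp, zero_mul, zero_add, Finset.sum_mul]
  exact Finset.sum_congr rfl fun _ _ => by ring

lemma derivAtOne_coordAtOne (X : Matrix (Fin n) (Fin n) ℂ) (ij : Fin n × Fin n) :
    derivAtOne X (coordAtOne ij) = X ij.1 ij.2 := by
  classical
  rw [derivAtOne, Finset.sum_eq_single ij]
  · simp [coordAtOne]
  · intro b _ hb
    simp [coordAtOne, hb.symm]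
  · simp

lemma derivAtOne_eulerField (hπ : ∀ X : lieAlg G, π X = X) {X : Matrix (Fin n) (Fin n) ℂ}
    (hX : X ∈ lieAlg G) (p : MvPolynomial (Fin n × Fin n) ℂ) :
    derivAtOne X (eulerField π p) = derivAtOne X p := by
  have h1 : X = ∑ kl : Fin n × Fin n, X kl.1 kl.2 •
      (π (Matrix.single kl.1 kl.2 1) : Matrix (Fin n) (Fin n) ℂ) := by
    have h2 : (π X : Matrix (Fin n) (Fin n) ℂ) = X := congrArg Subtype.val (hπ ⟨X, hX⟩)
    conv_lhs => rw [← h2, Matrix.matrix_eq_sum_single X]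
    simp only [map_sum, Fintype.sum_prod_type, AddSubmonoidClass.coe_finsetSum]
    refine Finset.sum_congr rfl fun i _ => Finset.sum_congr rfl fun j _ => ?_
    rw [← SetLike.val_smul, ← map_smul, Matrix.smul_single, smul_eq_mul, mul_one]
  rw [eulerField_apply, ← diffAtOne_apply, map_sum, LinearMap.sum_apply]
  simp only [diffAtOne_apply, derivAtOne_mul (coordAtOne_mem _), derivAtOne_coordAtOne,
    eval_one_leftInvDeriv]
  conv_rhs => rw [h1, ← diffAtOne_apply, map_sum]
  simp only [map_smul, diffAtOne_apply, smul_eq_mul]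

lemma eulerField_sub_mem (hπ : ∀ X : lieAlg G, π X = X) {p : MvPolynomial (Fin n × Fin n) ℂ}
    (hp : p ∈ idealAtOne n) :
    eulerField π p - p ∈ idealAtOne n ^ 2 ⊔ matVanishingIdeal (G : Set (ZGL n)) := by
  refine mem_sq_sup_of_derivAtOne_eq_zero (sub_mem (eulerField_mem_idealAtOne π p) hp) ?_
  intro X hX
  rw [← diffAtOne_apply, map_sub, LinearMap.sub_apply, diffAtOne_apply, diffAtOne_apply,
    derivAtOne_eulerField π hπ hX, sub_self]

lemma mul_sup_le {R : Type*} [CommRing R] (m I : Ideal R) (a b : ℕ) :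
    m ^ a * (m ^ b ⊔ I) ≤ m ^ (a + b) ⊔ I := by
  rw [Ideal.mul_sup, ← pow_add]
  exact sup_le_sup_left Ideal.mul_le_right _

/-- Euler's identity: the Euler field acts as multiplication by `k` in degree `k` of the graded
ring of the local ring of `G` at the identity. -/
lemma eulerField_sub_smul_mem (hπ : ∀ X : lieAlg G, π X = X) (k : ℕ)
    {p : MvPolynomial (Fin n × Fin n) ℂ} (hp : p ∈ idealAtOne n ^ k) :
    eulerField π p - (k : MvPolynomial (Fin n × Fin n) ℂ) * p ∈
      idealAtOne n ^ (k + 1) ⊔ matVanishingIdeal (G : Set (ZGL n)) := by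
  induction k generalizing p with
  | zero =>
    refine Ideal.mem_sup_left ?_
    simpa using eulerField_mem_idealAtOne π p
  | succ k ih =>
    rw [pow_succ'] at hp
    induction hp using Submodule.mul_induction_on' with
    | mem_mul_mem a ha b hb =>
      have h1 := Ideal.mul_mem_mul (I := idealAtOne n ^ 1) (by simpa using ha) (ih hb)
      have h2 := Ideal.mul_mem_mul hb (eulerField_sub_mem π hπ ha)
      have h3 := add_mem (mul_sup_le _ _ _ _ h1) ((add_comm 1 (k + 1) ▸ mul_sup_le _ _ k 2) h2)
      have h4 : eulerField π (a * b) - ((k + 1 : ℕ) : MvPolynomial (Fin n × Fin n) ℂ) * (a * b) =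
          a * (eulerField π b - k * b) + b * (eulerField π a - a) := by
        rw [Derivation.leibniz]
        push_cast
        simp only [smul_eq_mul]
        ring
      rw [h4, add_comm (k + 1) 1]
      exact h3
    | add a _ b _ ha hb =>
      convert! add_mem ha hb using 1
      rw [map_add]
      ring

/-- The equations of `H` lie in the ideal of `G` modulo every power of the maximal ideal of the
identity. The Euler field sends equations of `H` into a higher power modulo the ideal of `G`, whereas
it multiplies a part of degree `k > 0` by `k` up to higher order. -/
lemma matVanishingIdeal_le_pow_sup (hGH : lieAlg G ≤ lieAlg H) (k : ℕ) :
    matVanishingIdeal (H : Set (ZGL n)) ≤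
      idealAtOne n ^ k ⊔ matVanishingIdeal (G : Set (ZGL n)) := by
  obtain ⟨π, hπ⟩ := (lieAlg G).subtype.exists_leftInverse_of_injective (by simp)
  replace hπ : ∀ X : lieAlg G, π X = X := fun X => LinearMap.congr_fun hπ X
  induction k with
  | zero => simp
  | succ k ih =>
    intro p hp
    rcases Nat.eq_zero_or_pos k with rfl | hk
    · refine Ideal.mem_sup_left ?_
      rw [zero_add, pow_one, mem_idealAtOne]
      exact hp 1 H.one_mem
    obtain ⟨y, hy, i, hi, rfl⟩ := Submodule.mem_sup.1 (ih hp)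
    have h1 := eulerField_sub_smul_mem π hπ k hy
    have h2 : eulerField π (y + i) ∈
        idealAtOne n ^ (k + 1) ⊔ matVanishingIdeal (G : Set (ZGL n)) := by
      have h3 : eulerField π (y + i) ∈
          idealAtOne n ^ 1 * (idealAtOne n ^ k ⊔ matVanishingIdeal (G : Set (ZGL n))) := by
        rw [pow_one]
        exact Ideal.mul_mono_right ih (eulerField_mem_mul π hGH hp)
      rw [add_comm k 1]
      exact mul_sup_le _ _ 1 k h3
    have h3 : eulerField π i ∈ matVanishingIdeal (G : Set (ZGL n)) :=
      Ideal.mul_le_right (J := matVanishingIdeal (G : Set (ZGL n))) (I := idealAtOne n)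
        (eulerField_mem_mul π le_rfl hi)
    have h4 : (k : MvPolynomial (Fin n × Fin n) ℂ) * y ∈
        idealAtOne n ^ (k + 1) ⊔ matVanishingIdeal (G : Set (ZGL n)) := by
      convert! sub_mem (sub_mem h2 h1) (Ideal.mem_sup_right h3) using 1
      rw [map_add]
      ring
    refine add_mem ?_ (Ideal.mem_sup_right hi)
    have h5 := Ideal.mul_mem_left _ (C ((k : ℂ)⁻¹)) h4
    rwa [← mul_assoc, ← map_natCast (C : ℂ →+* MvPolynomial (Fin n × Fin n) ℂ), ← C_mul,
      inv_mul_cancel₀ (by exact_mod_cast hk.ne'), C_1, one_mul] at h5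

/-- By Krull's intersection theorem, every equation of `H` holds on `G` in a neighbourhood of the
identity. -/
lemma exists_mul_mem_matVanishingIdeal (hGH : lieAlg G ≤ lieAlg H)
    {p : MvPolynomial (Fin n × Fin n) ℂ} (hp : p ∈ matVanishingIdeal (H : Set (ZGL n))) :
    ∃ q, eval (ZGL.coords (1 : ZGL n)) q = 1 ∧
      q * p ∈ matVanishingIdeal (G : Set (ZGL n)) := by
  set I := matVanishingIdeal (G : Set (ZGL n))
  let m : Ideal (MvPolynomial (Fin n × Fin n) ℂ ⧸ I) := (idealAtOne n).map (Ideal.Quotient.mk I)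
  have h1 : (Ideal.Quotient.mk I p) ∈ (⨅ k : ℕ, m ^ k • ⊤ :
      Submodule (MvPolynomial (Fin n × Fin n) ℂ ⧸ I) (MvPolynomial (Fin n × Fin n) ℂ ⧸ I)) := by
    rw [Submodule.mem_iInf]
    intro k
    obtain ⟨y, hy, i, hi, rfl⟩ := Submodule.mem_sup.1 (matVanishingIdeal_le_pow_sup hGH k hp)
    rw [map_add, Ideal.Quotient.eq_zero_iff_mem.2 hi, add_zero, smul_eq_mul, Ideal.mul_top,
      ← Ideal.map_pow]
    exact Ideal.mem_map_of_mem _ hy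
  obtain ⟨⟨r, hr⟩, hrp⟩ := (Ideal.mem_iInf_smul_pow_eq_bot_iff m _).1 h1
  obtain ⟨a, ha, rfl⟩ := (Ideal.mem_map_iff_of_surjective _ Ideal.Quotient.mk_surjective).1 hr
  refine ⟨1 - a, by simp [mem_idealAtOne.1 ha], ?_⟩
  rw [← Ideal.Quotient.eq_zero_iff_mem]
  simp only [smul_eq_mul] at hrp
  rw [map_mul, map_sub, map_one, sub_mul, one_mul, hrp, sub_self]

/-- A connected group `G` is contained in every closed group `H` whose Lie algebra contains that of
`G`: the subgroup `G ∩ H` of `G` is closed, and also open, as it contains a neighbourhood of the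
identity. -/
theorem le_of_lieAlg_le (hG : IsConnected (G : Set (ZGL n))) (hH : IsClosed (H : Set (ZGL n)))
    (hGH : lieAlg G ≤ lieAlg H) : G ≤ H := by
  obtain ⟨s, hs⟩ := (isNoetherianRing_iff_ideal_fg _).1 inferInstance
    (matVanishingIdeal (H : Set (ZGL n)))
  have hs' : ∀ p ∈ s, ∃ q, eval (ZGL.coords (1 : ZGL n)) q = 1 ∧
      q * p ∈ matVanishingIdeal (G : Set (ZGL n)) := fun p hp =>
    exists_mul_mem_matVanishingIdeal hGH (hs ▸ Ideal.subset_span hp)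
  choose! q hq1 hq using hs'
  -- The nonvanishing locus of `Q` is the neighbourhood of the identity on which `G` lies in `H`.
  set Q := ∏ p ∈ s, q p with hQ
  have hQ1 : eval (ZGL.coords (1 : ZGL n)) Q = 1 := by
    rw [hQ, map_prod]
    exact Finset.prod_eq_one hq1
  have hloc : ∀ g ∈ G, eval g.coords Q ≠ 0 → g ∈ H := by
    intro g hg hgQ
    refine mem_of_isClosed hH fun p hp => ?_
    have hp' : p ∈ Ideal.span (s : Set (MvPolynomial (Fin n × Fin n) ℂ)) := by
      rw [hs]; exact hp
    induction hp' using Submodule.span_induction with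
    | mem x hx =>
      have h1 := hq x hx g hg
      rw [map_mul, mul_eq_zero] at h1
      refine h1.resolve_left fun h2 => hgQ ?_
      rw [hQ, map_prod]
      exact Finset.prod_eq_zero hx h2
    | zero => simp
    | add x y hx hy h1 h2 =>
      rw [map_add, h1 (hs.le hx), h2 (hs.le hy), add_zero]
    | smul a x hx h1 => rw [smul_eq_mul, map_mul, h1 (hs.le hx), mul_zero]
  have hU : IsOpen {g : ZGL n | eval g.coords Q ≠ 0} := (isClosed_zeroLocus Q).isOpen_compl
  have hV : IsOpen (⋃ h ∈ (G ⊓ H : Subgroup (ZGL n)), (fun x : ZGL n => h⁻¹ * x) ⁻¹'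
      {g : ZGL n | eval g.coords Q ≠ 0}) :=
    isOpen_biUnion fun h _ =>
      hU.preimage (SeparatelyContinuousMul.continuous_const_mul (a := h⁻¹))
  have hVH : ∀ g ∈ G, g ∈ (⋃ h ∈ (G ⊓ H : Subgroup (ZGL n)), (fun x : ZGL n => h⁻¹ * x) ⁻¹'
      {g : ZGL n | eval g.coords Q ≠ 0}) → g ∈ H := by
    intro g hg hgV
    simp only [Set.mem_iUnion] at hgV
    obtain ⟨h, hh, hgh⟩ := hgV
    have := hloc _ (G.mul_mem (G.inv_mem hh.1) hg) hgh
    simpa using H.mul_mem hh.2 this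
  intro g hg
  by_contra hgH
  obtain ⟨x, hxG, hxV, hxH⟩ := hG.isPreconnected _ _ hV hH.isOpen_compl
    (fun x hx => by
      by_cases hxH : x ∈ H
      · left
        simp only [Set.mem_iUnion]
        exact ⟨x, ⟨hx, hxH⟩, by simp [hQ1]⟩
      · exact Or.inr hxH)
    ⟨1, G.one_mem, by
      simp only [Set.mem_iUnion]
      exact ⟨1, Subgroup.one_mem _, by simp [hQ1]⟩⟩ ⟨g, hg, hgH⟩
  exact hxH (hVH x hxG hxV)

end

/-! ### Diagonalisable matrices and the Jordan decomposition -/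

/-- Matrices as endomorphisms of `ℂ^n`. -/
noncomputable abbrev matEnd (n : ℕ) :
    Matrix (Fin n) (Fin n) ℂ ≃ₐ[ℂ] Module.End ℂ (Fin n → ℂ) := Matrix.toLinAlgEquiv'

/-- A commuting family of semisimple matrices is simultaneously diagonalisable. -/
lemma exists_conj_eq_diagonal {n : ℕ} {ι : Type*} (A : ι → Matrix (Fin n) (Fin n) ℂ)
    (hc : ∀ i j, Commute (A i) (A j))
    (hs : ∀ i, (matEnd n (A i)).IsSemisimple) :
    ∃ P : ZGL n, ∀ i, ∃ d, P.mat * A i * (P⁻¹).mat = Matrix.diagonal d := by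
  let f : ι → Module.End ℂ (Fin n → ℂ) := fun i => matEnd n (A i)
  have h1 := Module.End.iSup_iInf_maxGenEigenspace_eq_top_of_iSup_maxGenEigenspace_eq_top_of_commute
    f (fun i j _ => (hc i j).map (matEnd n))
    (fun i => Module.End.iSup_maxGenEigenspace_eq_top (f i))
  let E : Set (Fin n → ℂ) := {v | ∃ χ : ι → ℂ, ∀ i, f i v = χ i • v}
  have hE : Submodule.span ℂ E = ⊤ := by
    rw [eq_top_iff, ← h1, iSup_le_iff]
    intro χ v hv
    refine Submodule.subset_span ⟨χ, fun i => ?_⟩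
    have h2 := (Submodule.mem_iInf _).1 hv i
    rw [(hs i).isFinitelySemisimple.maxGenEigenspace_eq_eigenspace,
      Module.End.mem_eigenspace_iff] at h2
    exact h2
  obtain ⟨b, hbE, hbs, hbl⟩ := exists_linearIndependent ℂ E
  let B : Module.Basis b ℂ (Fin n → ℂ) := Module.Basis.mk hbl (by rw [Subtype.range_coe, hbs, hE])
  have : Finite b := Module.Finite.finite_basis B
  have : Fintype b := Fintype.ofFinite b
  have hcard : Fintype.card b = n := by
    rw [← Module.finrank_eq_card_basis B, Module.finrank_fin_fun]
  let B' := B.reindex (Fintype.equivFinOfCardEq hcard)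
  have hB' : ∀ j, B' j ∈ E := by
    intro j
    simp only [B', Module.Basis.reindex_apply, B, Module.Basis.mk_apply]
    exact hbE (Subtype.coe_prop _)
  let Q : GL (Fin n) ℂ := ⟨(Pi.basisFun ℂ (Fin n)).toMatrix B', B'.toMatrix (Pi.basisFun ℂ (Fin n)),
    Module.Basis.toMatrix_mul_toMatrix_flip _ _, Module.Basis.toMatrix_mul_toMatrix_flip _ _⟩
  let Q' : ZGL n := Q
  choose χ hχ using hB'
  refine ⟨Q'⁻¹, fun i => ⟨fun j => χ j i, ?_⟩⟩
  have key : A i * Q'.mat = Q'.mat * Matrix.diagonal fun j => χ j i := by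
    ext k j
    have h3 := congrFun (hχ j i) k
    simp only [f, Matrix.toLinAlgEquiv'_apply, Matrix.mulVec, dotProduct, Pi.smul_apply,
      smul_eq_mul] at h3
    rw [Matrix.mul_apply, Matrix.mul_diagonal]
    have hQ : ∀ k j, Q'.mat k j = B' j k := fun k j => by
      change (Pi.basisFun ℂ (Fin n)).toMatrix B' k j = _
      simp [Module.Basis.toMatrix_apply]
    simp only [hQ]
    rw [h3, mul_comm]
  rw [inv_inv, mul_assoc, key, ← mul_assoc, ZGL.mat_inv_mul, one_mul]

lemma isSemisimple_of_conj_isDiag {n : ℕ} {A : Matrix (Fin n) (Fin n) ℂ} {P : ZGL n}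
    {d : Fin n → ℂ} (h : P.mat * A * (P⁻¹).mat = Matrix.diagonal d) :
    (matEnd n A).IsSemisimple := by
  classical
  let p : Polynomial ℂ := ∏ μ ∈ Finset.univ.image d, (Polynomial.X - Polynomial.C μ)
  have hp : p.Separable := Polynomial.separable_prod_X_sub_C_iff'.2 fun _ _ _ _ h => h
  refine Module.End.isSemisimple_of_squarefree_aeval_eq_zero hp.squarefree ?_
  have h0 : ∀ q : Polynomial ℂ,
      P.mat * Polynomial.aeval A q * (P⁻¹).mat = Matrix.diagonal fun i => q.eval (d i) := by
    intro q
    induction q using Polynomial.induction_on' with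
    | add q r hq hr => simp [mul_add, add_mul, hq, hr]
    | monomial k a =>
      have h1 : ∀ k : ℕ, P.mat * A ^ k * (P⁻¹).mat = Matrix.diagonal fun i => d i ^ k := by
        intro k
        induction k with
        | zero => simp
        | succ k ih =>
          calc P.mat * A ^ (k + 1) * (P⁻¹).mat
              = (P.mat * A ^ k * (P⁻¹).mat) * (P.mat * A * (P⁻¹).mat) := by
                rw [pow_succ]
                simp only [mul_assoc]
                rw [← mul_assoc (P⁻¹).mat P.mat, ZGL.mat_inv_mul, one_mul]
            _ = _ := by rw [ih, h, Matrix.diagonal_mul_diagonal]; simp only [pow_succ]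
      rw [Polynomial.aeval_monomial, ← Algebra.smul_def, mul_smul_comm, smul_mul_assoc, h1]
      ext i j
      by_cases hij : i = j
      · subst hij; simp
      · simp [hij]
  have h2 : Polynomial.aeval A p = 0 := by
    have h3 := h0 p
    have h4 : (fun i => p.eval (d i)) = 0 := by
      funext i
      simp only [p, Polynomial.eval_prod, Pi.zero_apply]
      exact Finset.prod_eq_zero (Finset.mem_image_of_mem d (Finset.mem_univ i)) (by simp)
    rw [h4, Matrix.diagonal_zero'] at h3
    calc Polynomial.aeval A p
        = (P⁻¹).mat * (P.mat * Polynomial.aeval A p * (P⁻¹).mat) * P.mat := by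
          simp only [mul_assoc, ZGL.mat_inv_mul, mul_one]
          rw [← mul_assoc, ZGL.mat_inv_mul, one_mul]
      _ = 0 := by rw [h3]; simp
  rw [Polynomial.aeval_algHom_apply, h2, map_zero]

lemma exists_jordan_decomposition {n : ℕ} (X : Matrix (Fin n) (Fin n) ℂ) :
    ∃ N ∈ Algebra.adjoin ℂ {X}, ∃ S ∈ Algebra.adjoin ℂ {X}, IsNilpotent N ∧
      (matEnd n S).IsSemisimple ∧ X = N + S := by
  obtain ⟨N, hN, S, hS, h1, h2, h3⟩ :=
    (matEnd n X).exists_isNilpotent_isSemisimple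
  let e : Matrix (Fin n) (Fin n) ℂ ≃ₐ[ℂ] Module.End ℂ (Fin n → ℂ) := matEnd n
  have he : ∀ Y ∈ Algebra.adjoin ℂ {e X}, e.symm Y ∈ Algebra.adjoin ℂ {X} := by
    intro Y hY
    have := (Subalgebra.mem_map (S := Algebra.adjoin ℂ {e X}) (f := e.symm.toAlgHom)).2 ⟨Y, hY, rfl⟩
    rw [AlgHom.map_adjoin_singleton] at this
    simpa using this
  refine ⟨e.symm N, he N hN, e.symm S, he S hS, h1.map e.symm, ?_, ?_⟩
  · change (e (e.symm S)).IsSemisimple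
    rwa [e.apply_symm_apply]
  · rw [← map_add, ← h3]
    exact (e.symm_apply_apply X).symm

lemma commute_of_mem_adjoin {A : Type*} [Ring A] [Algebra ℂ A] {x y z : A}
    (hz : z ∈ Algebra.adjoin ℂ {x}) (h : Commute x y) : Commute z y :=
  (Algebra.commute_of_mem_adjoin_singleton_of_commute hz h.symm).symm

/-! ### Exponential polynomials -/

/-- Exponential polynomials `∑ q_λ(c) exp(λ c)`, as the group algebra of `ℂ` with polynomial
coefficients. -/
abbrev ExpPolynomial : Type := AddMonoidAlgebra (Polynomial ℂ) ℂ

namespace ExpPolynomial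

/-- The character `λ ↦ exp(λ c)`. -/
noncomputable def expChar (c : ℂ) : Multiplicative ℂ →* ℂ where
  toFun l := Complex.exp (l.toAdd * c)
  map_one' := by simp
  map_mul' a b := by simp [add_mul, Complex.exp_add]

/-- The ring homomorphism that sends `q exp_λ` to `q(a) exp(λ c)`. For `a = c` it is evaluation at
`c`; for `a = 0` and `c = 1` it takes the value at `1` after discarding the polynomial growth. -/
noncomputable def evalAt (a c : ℂ) : ExpPolynomial →+* ℂ :=
  AddMonoidAlgebra.liftNCRingHom (Polynomial.evalRingHom a) (expChar c) fun _ _ => mul_comm _ _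

lemma evalAt_single (a c l : ℂ) (q : Polynomial ℂ) :
    evalAt a c (AddMonoidAlgebra.single l q) = q.eval a * Complex.exp (l * c) := by
  simp [evalAt, expChar]

/-- Differentiation on the space of entire functions. -/
noncomputable def entireDeriv :
    Module.End ℂ ({ carrier := {f : ℂ → ℂ | Differentiable ℂ f}
                    add_mem' := fun hf hg => hf.add hg
                    zero_mem' := differentiable_const 0
                    smul_mem' := fun c _ hf => hf.const_smul c } : Submodule ℂ (ℂ → ℂ)) where
  toFun f := ⟨deriv f.1, f.2.deriv⟩
  map_add' f g := by
    ext c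
    exact deriv_add (f.2 c) (g.2 c)
  map_smul' a f := by
    ext c
    exact deriv_const_smul a (f.2 c)

/-- An exponential polynomial is determined by its values: the terms with different exponents lie
in different generalised eigenspaces of differentiation. -/
lemma eq_zero_of_evalAt_eq_zero {x : ExpPolynomial} (hx : ∀ c, evalAt c c x = 0) : x = 0 := by
  have hd : ∀ (q : Polynomial ℂ) (l : ℂ),
      Differentiable ℂ fun c => q.eval c * Complex.exp (l * c) := fun q l => by fun_prop
  have hD : ∀ (l : ℂ) (q : Polynomial ℂ),
      (entireDeriv - algebraMap ℂ _ l) ⟨_, hd q l⟩ = ⟨_, hd (Polynomial.derivative q) l⟩ := by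
    intro l q
    ext c
    have h1 : HasDerivAt (fun c => q.eval c * Complex.exp (l * c))
        ((Polynomial.derivative q).eval c * Complex.exp (l * c) +
          q.eval c * (Complex.exp (l * c) * (l * 1))) c :=
      (q.hasDerivAt c).mul (((hasDerivAt_id c).const_mul l).cexp)
    have h2 : deriv (fun c => q.eval c * Complex.exp (l * c)) c - l * (q.eval c * Complex.exp (l * c))
        = (Polynomial.derivative q).eval c * Complex.exp (l * c) := by
      rw [h1.deriv]; ring
    exact h2
  have hpow : ∀ (k : ℕ) (l : ℂ) (q : Polynomial ℂ),
      ((entireDeriv - algebraMap ℂ _ l) ^ k) ⟨_, hd q l⟩ =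
        ⟨_, hd (Polynomial.derivative^[k] q) l⟩ := by
    intro k l
    induction k with
    | zero => intro q; rfl
    | succ k ih =>
      intro q
      rw [pow_succ, Module.End.mul_apply, hD, ih, Function.iterate_succ_apply]
  have hgen : ∀ (l : ℂ) (q : Polynomial ℂ), (⟨_, hd q l⟩ : _) ∈ entireDeriv.maxGenEigenspace l := by
    intro l q
    rw [Module.End.mem_maxGenEigenspace]
    refine ⟨q.natDegree + 1, ?_⟩
    have := hpow (q.natDegree + 1) l q
    rw [Polynomial.iterate_derivative_eq_zero (Nat.lt_succ_self _)] at this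
    refine this.trans ?_
    ext c
    simp
  have hind := (iSupIndep_iff_finsetSum_eq_zero_imp_eq_zero _).1
    entireDeriv.independent_maxGenEigenspace x.coeff.support
    (fun l => ⟨_, hd (x.coeff l) l⟩) (fun l _ => hgen l _) (by
      ext c
      have h1 := hx c
      rw [← AddMonoidAlgebra.sum_coeff_single x, Finsupp.sum, map_sum] at h1
      simp only [evalAt_single] at h1
      rw [AddSubmonoidClass.coe_finsetSum, Finset.sum_apply]
      exact h1)
  have hcoeff : x.coeff = 0 := by
    by_contra hne
    obtain ⟨l, hl⟩ := Finsupp.support_nonempty_iff.2 hne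
    refine Finsupp.mem_support_iff.1 hl (Polynomial.funext fun c => ?_)
    have h1 := congrFun (congrArg Subtype.val (hind l hl)) c
    have h2 : (x.coeff l).eval c * Complex.exp (l * c) = 0 := h1
    simpa [Complex.exp_ne_zero] using h2
  rw [← AddMonoidAlgebra.sum_coeff_single x, hcoeff, Finsupp.sum_zero_index]

/-- Constants as exponential polynomials. -/
noncomputable def const : ℂ →+* ExpPolynomial :=
  (algebraMap (Polynomial ℂ) ExpPolynomial).comp (algebraMap ℂ (Polynomial ℂ))

lemma evalAt_comp_const (a c : ℂ) : (evalAt a c).comp const = RingHom.id ℂ := by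
  ext z
  simp [const, evalAt_single, AddMonoidAlgebra.coe_algebraMap]

/-- A polynomial relation between the values of exponential polynomials remains true after the
polynomial coefficients are evaluated at `0`. -/
lemma eval_specialise {n : ℕ} (M : Matrix (Fin n) (Fin n) ExpPolynomial)
    (p : MvPolynomial (Fin n × Fin n) ℂ)
    (h : ∀ c, eval (fun ij => (evalAt c c).mapMatrix M ij.1 ij.2) p = 0) :
    eval (fun ij => (evalAt 0 1).mapMatrix M ij.1 ij.2) p = 0 := by
  let y : ExpPolynomial := p.eval₂ const fun ij => M ij.1 ij.2
  have hy : ∀ a c, evalAt a c y = eval (fun ij => (evalAt a c).mapMatrix M ij.1 ij.2) p := by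
    intro a c
    rw [MvPolynomial.hom_eval₂, evalAt_comp_const]
    rfl
  have hy0 : y = 0 := eq_zero_of_evalAt_eq_zero fun c => by rw [hy, h]
  rw [← hy, hy0, map_zero]

end ExpPolynomial

lemma exp_smul_of_pow_eq_zero {n : ℕ} {N : Matrix (Fin n) (Fin n) ℂ} {k : ℕ} (hN : N ^ k = 0)
    (c : ℂ) : NormedSpace.exp (c • N) =
      ∑ i ∈ Finset.range k, (((i.factorial : ℂ)⁻¹) * c ^ i) • N ^ i := by
  rw [NormedSpace.exp_eq_tsum ℂ]
  simp only
  rw [tsum_eq_sum (s := Finset.range k)]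
  · exact Finset.sum_congr rfl fun i _ => by rw [smul_pow, smul_smul]
  · intro i hi
    rw [Finset.mem_range, not_lt] at hi
    rw [smul_pow, pow_eq_zero_of_le hi hN, smul_zero, smul_zero]

/-- The semisimple part of an element of the Lie algebra of a closed group exponentiates into the
group: the entries of `exp (cX)` are exponential polynomials, and the equations of the group
that they satisfy survive when the polynomial coefficients are evaluated at `0`. -/
lemma exp_semisimple_mem {n : ℕ} {G : Subgroup (ZGL n)} (hG : IsClosed (G : Set (ZGL n)))
    {N S : Matrix (Fin n) (Fin n) ℂ} (hX : N + S ∈ lieAlg G) (hNS : Commute N S)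
    (hN : IsNilpotent N) (hS : (matEnd n S).IsSemisimple) : ZGL.exp S ∈ G := by
  obtain ⟨k, hk⟩ := hN
  obtain ⟨P, hP⟩ := exists_conj_eq_diagonal (fun _ : Unit => S) (fun _ _ => Commute.refl _)
    (fun _ => hS)
  obtain ⟨d, hd⟩ := hP ()
  let ι := ExpPolynomial.const
  let M : Matrix (Fin n) (Fin n) ExpPolynomial :=
    (∑ i ∈ Finset.range k, (algebraMap (Polynomial ℂ) ExpPolynomial
      (Polynomial.monomial i ((i.factorial : ℂ)⁻¹))) • (ι.mapMatrix N) ^ i) *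
      (ι.mapMatrix (P⁻¹).mat *
      Matrix.diagonal (fun i => AddMonoidAlgebra.single (d i) (1 : Polynomial ℂ)) *
        ι.mapMatrix P.mat)
  have hιm : ∀ a c (B : Matrix (Fin n) (Fin n) ℂ),
      (ExpPolynomial.evalAt a c).mapMatrix (ι.mapMatrix B) = B := by
    intro a c B
    ext i j
    exact RingHom.congr_fun (ExpPolynomial.evalAt_comp_const a c) (B i j)
  have hexpS : ∀ c : ℂ, NormedSpace.exp (c • S) =
      (P⁻¹).mat * Matrix.diagonal (fun i => Complex.exp (d i * c)) * P.mat := by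
    intro c
    have h1 : c • S = (P⁻¹).mat * Matrix.diagonal (c • d) * P.mat := by
      rw [Matrix.diagonal_smul, ← hd]
      simp only [mul_smul_comm, smul_mul_assoc]
      congr 1
      simp only [mul_assoc, ZGL.mat_inv_mul, mul_one]
      rw [← mul_assoc, ZGL.mat_inv_mul, one_mul]
    have h2 := Matrix.exp_conj (P⁻¹).mat (Matrix.diagonal (c • d)) (ZGL.isUnit_mat _)
    rw [← ZGL.mat_inv, inv_inv] at h2
    rw [h1, h2, Matrix.exp_diagonal]
    congr 3
    funext i
    rw [Pi.coe_exp, Complex.exp_eq_exp_ℂ, Pi.smul_apply, smul_eq_mul, mul_comm]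
  have hM : ∀ a c, (ExpPolynomial.evalAt a c).mapMatrix M =
      NormedSpace.exp (a • N) * NormedSpace.exp (c • S) := by
    intro a c
    rw [exp_smul_of_pow_eq_zero hk, hexpS, map_mul, map_mul, map_mul, hιm, hιm, map_sum]
    congr 1
    · refine Finset.sum_congr rfl fun i _ => ?_
      rw [Matrix.smul_eq_diagonal_mul, map_mul, map_pow, hιm, Matrix.smul_eq_diagonal_mul]
      congr 1
      ext u v
      by_cases huv : u = v
      · subst huv
        simp [AddMonoidAlgebra.coe_algebraMap, ExpPolynomial.evalAt_single]
      · simp [huv]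
    · congr 2
      ext u v
      by_cases huv : u = v
      · subst huv
        simp [ExpPolynomial.evalAt_single]
      · simp [huv]
  refine mem_of_isClosed hG fun p hp => ?_
  have hcoords : ∀ Y : Matrix (Fin n) (Fin n) ℂ,
      (ZGL.exp Y).coords = fun ij => NormedSpace.exp Y ij.1 ij.2 := fun Y => rfl
  have h0 : ∀ c, eval (fun ij => (ExpPolynomial.evalAt c c).mapMatrix M ij.1 ij.2) p = 0 := by
    intro c
    rw [hM, ← Matrix.exp_add_of_commute _ _ ((hNS.smul_left c).smul_right c), ← smul_add,
      ← hcoords]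
    exact hp _ (exp_smul_mem hG hX c)
  have h1 := ExpPolynomial.eval_specialise M p h0
  rw [hM, zero_smul, NormedSpace.exp_zero, one_mul, one_smul] at h1
  rw [hcoords]
  exact h1

/-- The Lie algebra of a closed group contains the semisimple parts of its elements. -/
lemma semisimple_part_mem_lieAlg {n : ℕ} {G : Subgroup (ZGL n)} (hG : IsClosed (G : Set (ZGL n)))
    {N S : Matrix (Fin n) (Fin n) ℂ} (hX : N + S ∈ lieAlg G) (hNS : Commute N S)
    (hN : IsNilpotent N) (hS : (matEnd n S).IsSemisimple) : S ∈ lieAlg G := by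
  refine mem_lieAlg_of_exp_mem fun c => ?_
  refine exp_semisimple_mem hG (N := c • N) ?_ ((hNS.smul_left c).smul_right c) (hN.smul c) ?_
  · rw [← smul_add]
    exact Submodule.smul_mem _ c hX
  · rw [map_smul]
    exact Module.End.IsSemisimple_smul c hS

/-! ### Characters of diagonalisable groups -/

section Torus

variable {n : ℕ} {T : Subgroup (ZGL n)} {P : ZGL n}

/-- The character of a diagonalisable group `T` given by the `i`-th diagonal entry, in coordinates
`P` in which `T` is diagonal. -/
noncomputable def coordChar (hP : ∀ t ∈ T, (P * t * P⁻¹).mat.IsDiag) (i : Fin n) : T →* ℂˣ :=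
  MonoidHom.toHomUnits
    { toFun := fun t => (P * t * P⁻¹).mat i i
      map_one' := by simp
      map_mul' := fun s t => by
        have h : P * ((s * t : T) : ZGL n) * P⁻¹ = (P * s * P⁻¹) * (P * t * P⁻¹) := by
          push_cast
          group
        rw [h, ZGL.mat_mul, Matrix.mul_apply, Finset.sum_eq_single i]
        · intro j _ hj
          rw [hP s s.2 hj.symm, zero_mul]
        · simp }

lemma conj_eq_diagonal_coordChar (hP : ∀ t ∈ T, (P * t * P⁻¹).mat.IsDiag) (t : T) :
    (P * t * P⁻¹).mat = Matrix.diagonal fun i => (coordChar hP i t : ℂ) :=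
  (hP t t.2).diagonal_diag.symm

/-- The group generated by the coordinate characters; it is the character lattice of `T`. -/
noncomputable def charLattice (hP : ∀ t ∈ T, (P * t * P⁻¹).mat.IsDiag) : Subgroup (T →* ℂˣ) :=
  Subgroup.closure (Set.range (coordChar hP))

lemma coordChar_mem (hP : ∀ t ∈ T, (P * t * P⁻¹).mat.IsDiag) (i : Fin n) :
    coordChar hP i ∈ charLattice hP := Subgroup.subset_closure ⟨i, rfl⟩

/-- A weight of the adjoint action is a quotient of two coordinate characters. -/
lemma mem_charLattice_of_weight (hP : ∀ t ∈ T, (P * t * P⁻¹).mat.IsDiag) {α : T →* ℂˣ}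
    {X : Matrix (Fin n) (Fin n) ℂ} (hX : X ≠ 0)
    (h : ∀ t : T, (t : ZGL n).mat * X * ((t : ZGL n)⁻¹).mat = (α t : ℂ) • X) :
    α ∈ charLattice hP := by
  set Y := P.mat * X * (P⁻¹).mat with hY
  have hXY : X = (P⁻¹).mat * Y * P.mat := by
    rw [hY]
    simp only [mul_assoc, ZGL.mat_inv_mul, mul_one]
    rw [← mul_assoc, ZGL.mat_inv_mul, one_mul]
  have hY0 : Y ≠ 0 := by
    intro h0
    rw [h0] at hXY
    exact hX (by simpa using hXY)
  obtain ⟨i, j, hij⟩ : ∃ i j, Y i j ≠ 0 := by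
    by_contra hne
    push Not at hne
    exact hY0 (Matrix.ext hne)
  have key : ∀ t : T, (coordChar hP i t : ℂ) * Y i j = (α t : ℂ) * Y i j * coordChar hP j t := by
    intro t
    have h1 : (P * t * P⁻¹).mat * Y = (α t : ℂ) • (Y * (P * t * P⁻¹).mat) := by
      have h2 : (t : ZGL n).mat * X = (α t : ℂ) • (X * (t : ZGL n).mat) := by
        rw [← smul_mul_assoc, ← h t, mul_assoc, ZGL.mat_inv_mul, mul_one]
      calc (P * t * P⁻¹).mat * Y = P.mat * ((t : ZGL n).mat * X) * (P⁻¹).mat := by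
            rw [hY]
            simp only [ZGL.mat_mul, mul_assoc]
            rw [← mul_assoc (P⁻¹).mat P.mat, ZGL.mat_inv_mul, one_mul]
        _ = _ := by
            rw [h2, hY]
            simp only [ZGL.mat_mul, mul_smul_comm, smul_mul_assoc, mul_assoc]
            rw [← mul_assoc (P⁻¹).mat P.mat, ZGL.mat_inv_mul, one_mul]
    rw [conj_eq_diagonal_coordChar hP] at h1
    have h3 := congrFun (congrFun h1 i) j
    rw [Matrix.diagonal_mul, Matrix.smul_apply, Matrix.mul_diagonal, smul_eq_mul, ← mul_assoc] at h3
    exact h3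
  have hα : α = coordChar hP i * (coordChar hP j)⁻¹ := by
    ext t
    rw [MonoidHom.mul_apply, MonoidHom.inv_apply, eq_comm, mul_inv_eq_iff_eq_mul.2]
    ext
    push_cast
    have := key t
    field_simp at this
    exact this
  rw [hα]
  exact mul_mem (coordChar_mem hP i) (inv_mem (coordChar_mem hP j))

/-- Every homomorphism from the character lattice of a closed diagonalisable group `T` to `ℂˣ` is
evaluation at an element of `T`. By Dedekind's independence of characters, a polynomial that
vanishes on `T` is already zero in the group algebra of the character lattice. -/
lemma exists_eval_eq (hT : IsClosed (T : Set (ZGL n))) (hP : ∀ t ∈ T, (P * t * P⁻¹).mat.IsDiag)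
    (f : charLattice hP →* ℂˣ) : ∃ t : T, ∀ χ : charLattice hP, χ.1 t = f χ := by
  let e : Fin n → charLattice hP := fun i => ⟨coordChar hP i, coordChar_mem hP i⟩
  let D : GL (Fin n) ℂ :=
    ⟨Matrix.diagonal fun i => (f (e i) : ℂ), Matrix.diagonal fun i => ((f (e i))⁻¹ : ℂˣ),
      by rw [Matrix.diagonal_mul_diagonal]; simp, by rw [Matrix.diagonal_mul_diagonal]; simp⟩
  let d : ZGL n := D
  have hd : d.mat = Matrix.diagonal fun i => (f (e i) : ℂ) := rfl
  have hmem : P⁻¹ * d * P ∈ T := by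
    refine mem_of_isClosed hT fun p hp => ?_
    let F : Fin n × Fin n → MvPolynomial (Fin n) ℂ := fun ij =>
      ∑ k, C ((P⁻¹).mat ij.1 k * P.mat k ij.2) * X k
    have hF : ∀ (x : Fin n → ℂ) ij,
        eval x (F ij) = ((P⁻¹).mat * Matrix.diagonal x * P.mat) ij.1 ij.2 := by
      intro x ij
      rw [Matrix.mul_apply]
      simp only [F, map_sum, map_mul, eval_C, eval_X, Matrix.mul_diagonal]
      exact Finset.sum_congr rfl fun k _ => by ring
    let q := bind₁ F p
    have hq : ∀ x : Fin n → ℂ, eval x q =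
        eval (fun ij => ((P⁻¹).mat * Matrix.diagonal x * P.mat) ij.1 ij.2) p := by
      intro x
      rw [eval, eval₂Hom_bind₁]
      simp only [← hF]
      rfl
    let Θ : MvPolynomial (Fin n) ℂ →ₐ[ℂ] MonoidAlgebra ℂ (charLattice hP) :=
      aeval fun i => MonoidAlgebra.of ℂ _ (e i)
    have hΘ : ∀ (g : charLattice hP →* ℂ), MonoidAlgebra.lift ℂ ℂ (charLattice hP) g (Θ q) =
        eval (fun i => g (e i)) q := by
      intro g
      have h1 : (MonoidAlgebra.lift ℂ ℂ (charLattice hP) g).comp Θ = aeval fun i => g (e i) :=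
        algHom_ext fun i => by simp [Θ]
      rw [← AlgHom.comp_apply, h1, aeval_eq_eval]
    have hT0 : ∀ t : T, eval (fun i => ((coordChar hP i t : ℂˣ) : ℂ)) q = 0 := by
      intro t
      rw [hq, ← conj_eq_diagonal_coordChar]
      have h1 := hp t t.2
      have h2 : P⁻¹ * (P * t * P⁻¹) * P = t := by group
      rw [← h2] at h1
      exact h1
    have hΘ0 : Θ q = 0 := by
      let ev : T → charLattice hP →* ℂ := fun t =>
        { toFun := fun χ => (χ.1 t : ℂ)
          map_one' := by simp
          map_mul' := fun a b => by simp }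
      have h1 : ∀ t, MonoidAlgebra.lift ℂ ℂ (charLattice hP) (ev t) (Θ q) = 0 := fun t =>
        (hΘ (ev t)).trans (hT0 t)
      have hind := (linearIndependent_monoidHom T ℂ).comp
        (fun χ : charLattice hP => (Units.coeHom ℂ).comp χ.1) (fun χ ψ h => by
          ext t
          exact DFunLike.congr_fun h t)
      have h2 := linearIndependent_iff.1 hind (Θ q).coeff (by
        funext t
        have h3 := h1 t
        rw [MonoidAlgebra.lift_apply, Finsupp.sum] at h3
        rw [Finsupp.linearCombination_apply, Finsupp.sum, Finset.sum_apply]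
        exact h3)
      ext χ
      rw [h2]
      rfl
    have h4 := hΘ ((Units.coeHom ℂ).comp f)
    rw [hΘ0, map_zero, hq] at h4
    exact h4.symm
  refine ⟨⟨_, hmem⟩, ?_⟩
  have hgen : ∀ i, coordChar hP i ⟨_, hmem⟩ = f (e i) := by
    intro i
    have h1 := conj_eq_diagonal_coordChar hP ⟨_, hmem⟩
    have h2 : P * (P⁻¹ * d * P) * P⁻¹ = d := by group
    rw [h2, hd] at h1
    ext
    exact (congrFun (Matrix.diagonal_injective h1) i).symm
  rintro ⟨χ, hχ⟩
  induction hχ using Subgroup.closure_induction with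
  | mem x hx =>
    obtain ⟨i, rfl⟩ := hx
    exact hgen i
  | one => exact (map_one f).symm
  | mul x y hx hy h1 h2 =>
    have := map_mul f ⟨x, hx⟩ ⟨y, hy⟩
    rw [MonoidHom.mul_apply, h1, h2, ← this]
    rfl
  | inv x hx h1 =>
    have := map_inv f ⟨x, hx⟩
    rw [MonoidHom.inv_apply, h1, ← this]
    rfl

/-- The embedding of `ℚ / ℤ` in `ℂˣ` as the group of roots of unity. -/
lemma exists_addCircle_hom : ∃ ε : AddCircle (1 : ℚ) →+ Additive ℂˣ, Function.Injective ε := by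
  let φ : ℚ →+ Additive ℂˣ :=
    { toFun := fun q => Additive.ofMul (Units.mk0 (Complex.exp ((q : ℂ) * (2 * Real.pi * Complex.I)))
        (Complex.exp_ne_zero _))
      map_zero' := Additive.toMul.injective (by ext; simp)
      map_add' := fun a b => Additive.toMul.injective (by ext; simp [add_mul, Complex.exp_add]) }
  have hφ : ∀ q, φ q = 0 ↔ ∃ m : ℤ, q = m := by
    intro q
    have h1 : φ q = 0 ↔ Complex.exp ((q : ℂ) * (2 * Real.pi * Complex.I)) = 1 := by
      rw [← ofMul_one, ← Additive.toMul.injective.eq_iff]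
      exact Units.ext_iff
    rw [h1, Complex.exp_eq_one_iff]
    refine exists_congr fun m => ?_
    rw [mul_left_inj' Complex.two_pi_I_ne_zero]
    exact_mod_cast Iff.rfl
  refine ⟨QuotientAddGroup.lift _ φ ?_, ?_⟩
  · rintro _ ⟨m, rfl⟩
    exact (hφ _).2 ⟨m, by simp⟩
  · rw [injective_iff_map_eq_zero]
    intro a
    induction a using QuotientAddGroup.induction_on with
    | H q =>
      intro h
      obtain ⟨m, rfl⟩ := (hφ q).1 h
      exact (QuotientAddGroup.eq_zero_iff _).2 ⟨m, by simp⟩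

/-- A subgroup of an abelian group is the intersection of the kernels of the homomorphisms to `ℂˣ`
that are trivial on it. -/
lemma exists_hom_ne_one {A : Type*} [CommGroup A] (B : Subgroup A) {a : A} (ha : a ∉ B) :
    ∃ f : A →* ℂˣ, (∀ b ∈ B, f b = 1) ∧ f a ≠ 1 := by
  obtain ⟨ε, hε⟩ := exists_addCircle_hom
  have ha' : Additive.ofMul (QuotientGroup.mk a : A ⧸ B) ≠ 0 := fun h =>
    ha ((QuotientGroup.eq_one_iff a).1 h)
  obtain ⟨c, hc⟩ := CharacterModule.exists_character_apply_ne_zero_of_ne_zero ha'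
  let g : (A ⧸ B) →* ℂˣ := MonoidHom.toAdditive.symm (ε.comp c)
  have hg : ∀ x : A ⧸ B, g x = (ε (c (Additive.ofMul x))).toMul := fun x => rfl
  refine ⟨g.comp (QuotientGroup.mk' B), fun b hb => ?_, fun h => hc (hε ?_)⟩
  · have : (QuotientGroup.mk' B) b = 1 := (QuotientGroup.eq_one_iff b).2 hb
    rw [MonoidHom.comp_apply, this, map_one]
  · rw [map_zero]
    exact h

/-- Linear independence of a subset of an abelian group that is written multiplicatively. -/
lemma linearIndependent_of_prod_eq_one {M : Type*} [CommGroup M] {S : Set M}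
    (hli : ∀ c : M →₀ ℤ, (c.support : Set M) ⊆ S → (c.prod fun α m => α ^ m) = 1 → c = 0) :
    LinearIndependent ℤ (fun α : S => Additive.ofMul α.1) := by
  rw [linearIndependent_iff]
  intro c hc
  have h1 := hli (c.mapDomain Subtype.val) (by
    classical
    intro α hα
    obtain ⟨β, _, rfl⟩ := Finset.mem_image.1 (Finsupp.mapDomain_support hα)
    exact β.2) (by
    rw [Finsupp.prod_mapDomain_index_inj Subtype.val_injective]
    have h2 : (c.prod fun α m => (α : M) ^ m) =
          (Finsupp.linearCombination ℤ (fun α : S => Additive.ofMul α.1) c).toMul := by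
      rw [Finsupp.linearCombination_apply, Finsupp.sum, toMul_sum]
      rfl
    rw [h2, hc, toMul_zero])
  exact Finsupp.mapDomain_injective Subtype.val_injective (h1.trans Finsupp.mapDomain_zero.symm)

/-- A function on a linearly independent subset of an abelian group, which is written
multiplicatively, extends to a homomorphism on the subgroup that the subset generates. -/
lemma exists_additive_extension {M : Type*} [CommGroup M] {S : Set M}
    (hv : LinearIndependent ℤ (fun α : S => Additive.ofMul α.1)) (l : M → ℂ) :
    ∃ L : Subgroup.closure S → ℂ, (∀ χ ψ, L (χ * ψ) = L χ + L ψ) ∧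
      ∀ α (h : α ∈ S), L ⟨α, Subgroup.subset_closure h⟩ = l α := by
  let v : S → Additive M := fun α => Additive.ofMul α.1
  let L : Submodule.span ℤ (Set.range v) →ₗ[ℤ] ℂ := (Module.Basis.span hv).constr ℤ fun α => l α.1
  have hspan : ∀ χ ∈ Subgroup.closure S, Additive.ofMul χ ∈ Submodule.span ℤ (Set.range v) := by
    intro χ hχ
    induction hχ using Subgroup.closure_induction with
    | mem x hx => exact Submodule.subset_span ⟨⟨x, hx⟩, rfl⟩
    | one => exact zero_mem _
    | mul x y _ _ h1 h2 => exact add_mem h1 h2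
    | inv x _ h1 => exact neg_mem h1
  refine ⟨fun χ => L ⟨_, hspan _ χ.2⟩, fun χ ψ => ?_, ?_⟩
  · have h1 : (⟨_, hspan _ (χ * ψ).2⟩ : Submodule.span ℤ (Set.range v)) =
        ⟨_, hspan _ χ.2⟩ + ⟨_, hspan _ ψ.2⟩ := Subtype.ext rfl
    beta_reduce
    rw [h1, map_add]
  intro α hα
  have h2 := Module.Basis.constr_basis (Module.Basis.span hv) ℤ (fun α => l α.1) ⟨α, hα⟩
  have h3 : (⟨_, hspan _ (Subgroup.subset_closure hα)⟩ : Submodule.span ℤ (Set.range v)) =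
      Module.Basis.span hv ⟨α, hα⟩ :=
    (Module.Basis.span_apply hv ⟨α, hα⟩).symm
  change L _ = _
  rw [h3]
  exact h2

/-- Characters that separate the points of a closed diagonalisable group generate its character
lattice. -/
lemma charLattice_le_closure (hT : IsClosed (T : Set (ZGL n)))
    (hP : ∀ t ∈ T, (P * t * P⁻¹).mat.IsDiag) {simple : Set (T →* ℂˣ)}
    (hsub : simple ⊆ charLattice hP) (hsep : ∀ t : T, (∀ α ∈ simple, α t = 1) → t = 1) :
    charLattice hP ≤ Subgroup.closure simple := by
  intro χ hχ
  by_contra hne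
  obtain ⟨f, hf, hfχ⟩ := exists_hom_ne_one ((Subgroup.closure simple).subgroupOf (charLattice hP))
    (a := ⟨χ, hχ⟩) (by rwa [Subgroup.mem_subgroupOf])
  obtain ⟨t, ht⟩ := exists_eval_eq hT hP f
  have ht1 : t = 1 := hsep t fun α hα => by
    rw [ht ⟨α, hsub hα⟩]
    exact hf _ (Subgroup.mem_subgroupOf.2 (Subgroup.subset_closure hα))
  exact hfχ (by rw [← ht ⟨χ, hχ⟩, ht1, map_one])

/-- If linearly independent characters `simple` separate the points of a closed diagonalisable
group `T`, then they form a basis of its character lattice, and there are one-parameter subgroups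
of `T` on which they take arbitrary values. -/
theorem exists_oneParameterSubgroup (hT : IsClosed (T : Set (ZGL n)))
    (hP : ∀ t ∈ T, (P * t * P⁻¹).mat.IsDiag) {simple : Set (T →* ℂˣ)}
    (hsub : simple ⊆ charLattice hP)
    (hli : ∀ c : (T →* ℂˣ) →₀ ℤ, (c.support : Set (T →* ℂˣ)) ⊆ simple →
      (c.prod fun α m => α ^ m) = 1 → c = 0)
    (hsep : ∀ t : T, (∀ α ∈ simple, α t = 1) → t = 1) (l : (T →* ℂˣ) → ℂ) :
    ∃ H : Matrix (Fin n) (Fin n) ℂ, ∀ c : ℂ, ∃ t : T, (t : ZGL n) = ZGL.exp (c • H) ∧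
      ∀ α ∈ simple, (α t : ℂ) = Complex.exp (c * l α) := by
  have hgen := charLattice_le_closure hT hP hsub hsep
  obtain ⟨L, hLmul, hL⟩ := exists_additive_extension (linearIndependent_of_prod_eq_one hli) l
  have hL1 : L 1 = 0 := by simpa using hLmul 1 1
  let h : Fin n → ℂ := fun i => L ⟨_, hgen (coordChar_mem hP i)⟩
  refine ⟨(P⁻¹).mat * Matrix.diagonal h * P.mat, fun c => ?_⟩
  let f : Subgroup.closure simple →* ℂˣ :=
    { toFun := fun χ => Units.mk0 (Complex.exp (c * L χ)) (Complex.exp_ne_zero _)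
      map_one' := by
        ext
        simp [hL1]
      map_mul' := fun χ ψ => by
        ext
        simp [hLmul, mul_add, Complex.exp_add] }
  obtain ⟨t, ht⟩ := exists_eval_eq hT hP (f.comp (Subgroup.inclusion hgen))
  refine ⟨t, ?_, fun α hα => ?_⟩
  · have h1 : P * t * P⁻¹ = ZGL.exp (c • Matrix.diagonal h) := by
      ext1
      rw [conj_eq_diagonal_coordChar hP, ZGL.mat_exp, ← Matrix.diagonal_smul, Matrix.exp_diagonal]
      congr 1
      funext i
      rw [ht ⟨_, coordChar_mem hP i⟩, Pi.coe_exp, ← Complex.exp_eq_exp_ℂ]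
      rfl
    have h2 : (t : ZGL n) = P⁻¹ * (P * t * P⁻¹) * P⁻¹⁻¹ := by group
    rw [h2, h1, ZGL.conj_exp, inv_inv, mul_smul_comm, smul_mul_assoc]
  · rw [ht ⟨α, hsub hα⟩, ← hL α hα]
    rfl

end Torus

/-! ### Stabilisers and Lie algebras -/

section Stabilisers

variable {n : ℕ}

/-- The subgroup of `GL_n(ℂ)` of elements that commute with a given matrix. -/
def matCentralizer (Y : Matrix (Fin n) (Fin n) ℂ) : Subgroup (ZGL n) where
  carrier := {g | Commute g.mat Y}
  one_mem' := Commute.one_left Y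
  mul_mem' hg hh := Commute.mul_left hg hh
  inv_mem' {g} hg := by
    have h : g.mat * Y = Y * g.mat := hg
    change (g⁻¹).mat * Y = Y * (g⁻¹).mat
    calc (g⁻¹).mat * Y = (g⁻¹).mat * (Y * g.mat) * (g⁻¹).mat := by simp [mul_assoc]
      _ = Y * (g⁻¹).mat := by rw [← h, ← mul_assoc, ZGL.mat_inv_mul, one_mul]

lemma mem_matCentralizer {Y : Matrix (Fin n) (Fin n) ℂ} {g : ZGL n} :
    g ∈ matCentralizer Y ↔ Commute g.mat Y := Iff.rfl

lemma commute_iff_conj_eq {Y : Matrix (Fin n) (Fin n) ℂ} {g : ZGL n} :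
    Commute g.mat Y ↔ g.mat * Y * (g⁻¹).mat = Y := by
  constructor
  · intro h
    rw [h.eq, mul_assoc, ZGL.mat_mul_inv, mul_one]
  · intro h
    change g.mat * Y = Y * g.mat
    conv_rhs => rw [← h]
    rw [mul_assoc, ZGL.mat_inv_mul, mul_one]

lemma isClosed_matCentralizer (Y : Matrix (Fin n) (Fin n) ℂ) :
    IsClosed (matCentralizer Y : Set (ZGL n)) := by
  have h : (matCentralizer Y : Set (ZGL n)) = ⋂ ij : Fin n × Fin n, {g : ZGL n |
      eval g.coords (∑ k, (MvPolynomial.X (ij.1, k) * C (Y k ij.2) -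
        C (Y ij.1 k) * MvPolynomial.X (k, ij.2))) = 0} := by
    ext g
    simp only [SetLike.mem_coe, mem_matCentralizer, Set.mem_iInter, Set.mem_ofPred_eq]
    simp only [map_sum, map_sub, map_mul, eval_X, eval_C, ZGL.coords_apply,
      Finset.sum_sub_distrib, sub_eq_zero, ← Matrix.mul_apply]
    exact ⟨fun h ij => congrFun (congrFun h ij.1) ij.2, fun h => by ext i j; exact h (i, j)⟩
  rw [h]
  exact isClosed_iInter fun ij => isClosed_zeroLocus _

lemma mem_lieAlg_matCentralizer {X Y : Matrix (Fin n) (Fin n) ℂ} (h : Commute X Y) :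
    X ∈ lieAlg (matCentralizer Y) :=
  mem_lieAlg_of_exp_mem fun c => mem_matCentralizer.2 (ZGL.mat_exp_commute (h.smul_left c))

lemma commute_of_commute_lieAlg {K : Subgroup (ZGL n)} (hK : IsConnected (K : Set (ZGL n)))
    {Y : Matrix (Fin n) (Fin n) ℂ} (h : ∀ X ∈ lieAlg K, Commute X Y) {g : ZGL n} (hg : g ∈ K) :
    Commute g.mat Y :=
  le_of_lieAlg_le hK (isClosed_matCentralizer Y)
    (fun X hX => mem_lieAlg_matCentralizer (h X hX)) hg

lemma commute_of_commute_exp {X Y : Matrix (Fin n) (Fin n) ℂ}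
    (h : ∀ c : ℂ, Commute (ZGL.exp (c • X)).mat Y) : Commute X Y := by
  refine sub_eq_zero.1 (Matrix.ext fun i j => ?_)
  refine map_commutator_eq_zero (Matrix.entryLinearMap ℂ ℂ i j) (Y i j) fun c => ?_
  rw [commute_iff_conj_eq.1 (h c)]
  rfl

/-- An element of a connected closed group that fixes the Lie algebra is central. -/
lemma commute_of_conj_eq_self {K : Subgroup (ZGL n)} (hK : IsConnected (K : Set (ZGL n)))
    {w : ZGL n} (h : ∀ X ∈ lieAlg K, w.mat * X * (w⁻¹).mat = X) {g : ZGL n} (hg : g ∈ K) :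
    g * w = w * g :=
  ZGL.ext (commute_of_commute_lieAlg hK
    (fun X hX => (commute_iff_conj_eq.2 (h X hX)).symm) hg)

lemma commutator_mem_lieAlg {H : Subgroup (ZGL n)} (hH : IsClosed (H : Set (ZGL n)))
    {X Y : Matrix (Fin n) (Fin n) ℂ} (hX : X ∈ lieAlg H) (hY : Y ∈ lieAlg H) :
    X * Y - Y * X ∈ lieAlg H :=
  commutator_mem_of_conj_exp_mem _ fun c => by
    have hc := exp_smul_mem hH hX c
    exact conj_mem_lieAlg (fun h hh => H.mul_mem (H.mul_mem hc hh) (H.inv_mem hc)) hY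

/-- A nonzero matrix generates a nontrivial one-parameter group. -/
lemma eq_zero_of_exp_smul_eq_one {X : Matrix (Fin n) (Fin n) ℂ}
    (h : ∀ c : ℂ, ZGL.exp (c • X) = 1) : X = 0 := by
  ext i j
  have h1 := ZGL.hasDerivAt_exp X 0 (i, j)
  simp only [h] at h1
  have h2 := h1.unique (hasDerivAt_const (0 : ℂ) _)
  simpa using h2

/-- An element of the Lie algebra of a closed connected group with trivial centre that is central
in the Lie algebra is zero. -/
lemma eq_zero_of_commute_lieAlg {K : Subgroup (ZGL n)} (hc : IsClosed (K : Set (ZGL n)))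
    (hK : IsConnected (K : Set (ZGL n))) (hZ : Subgroup.center K = ⊥)
    {X : Matrix (Fin n) (Fin n) ℂ} (hX : X ∈ lieAlg K)
    (h : ∀ Y ∈ lieAlg K, Commute Y X) : X = 0 := by
  refine eq_zero_of_exp_smul_eq_one fun c => ?_
  have hm := exp_smul_mem hc hX c
  have : (⟨_, hm⟩ : K) ∈ Subgroup.center K := by
    refine Subgroup.mem_center_iff.2 fun g => Subtype.ext (ZGL.ext ?_)
    exact ((ZGL.mat_exp_commute
      ((commute_of_commute_lieAlg hK h g.2).symm.smul_left c)).symm).eq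
  rw [hZ, Subgroup.mem_bot] at this
  exact congrArg Subtype.val this

/-- If a subspace `W` is stable under `ad X` then it is stable under conjugation by `exp X`. -/
lemma conj_exp_mem {W : Submodule ℂ (Matrix (Fin n) (Fin n) ℂ)} {X : Matrix (Fin n) (Fin n) ℂ}
    (h : ∀ Y ∈ W, X * Y - Y * X ∈ W) {Y : Matrix (Fin n) (Fin n) ℂ} (hY : Y ∈ W) :
    (ZGL.exp X).mat * Y * ((ZGL.exp X)⁻¹).mat ∈ W := by
  by_contra hW
  obtain ⟨l, hl, hl'⟩ := Submodule.exists_le_ker_of_notMem hW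
  refine hl ?_
  let _ : NormedRing (Matrix (Fin n) (Fin n) ℂ) := Matrix.linftyOpNormedRing
  let _ : NormedAlgebra ℂ (Matrix (Fin n) (Fin n) ℂ) := Matrix.linftyOpNormedAlgebra
  let f : Matrix (Fin n) (Fin n) ℂ → ℂ → ℂ := fun Y u =>
    l (NormedSpace.exp (u • X) * Y * NormedSpace.exp (u • (-X)))
  have hd : ∀ Y u, HasDerivAt (f Y) (f (X * Y - Y * X) u) u := by
    intro Y u
    have h1 := ((hasDerivAt_exp_smul_const (𝕂 := ℂ) X u).mul_const Y).mul
      (hasDerivAt_exp_smul_const' (𝕂 := ℂ) (-X) u)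
    have h2 := (LinearMap.toContinuousLinearMap l).hasFDerivAt.comp_hasDerivAt u h1
    refine h2.congr_deriv ?_
    change l _ = l _
    congr 1
    noncomm_ring
  have hi : ∀ k Y, iteratedDeriv k (f Y) = f ((fun Z => X * Z - Z * X)^[k] Y) := by
    intro k
    induction k with
    | zero => simp
    | succ k ih =>
      intro Y
      rw [iteratedDeriv_succ', Function.iterate_succ_apply, ← ih]
      congr 1
      funext u
      exact (hd Y u).deriv
  have h0 : ∀ k, (fun Z => X * Z - Z * X)^[k] Y ∈ W := by
    intro k
    induction k with
    | zero => exact hY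
    | succ k ih => rw [Function.iterate_succ_apply']; exact h _ ih
  have := Complex.taylorSeries_eq_of_entire' (c := 0) (z := 1)
    (fun u => (hd Y u).differentiableAt)
  have hz : ∀ k, f ((fun Z => X * Z - Z * X)^[k] Y) 0 = 0 := by
    intro k
    simpa [f] using hl' (h0 k)
  simp only [hi, hz, mul_zero, zero_mul, tsum_zero] at this
  have h1 : f Y 1 = 0 := this.symm
  rw [ZGL.mat_inv, ZGL.mat_exp, ← Matrix.exp_neg]
  simpa [f] using h1

/-- The subgroup of `GL_n(ℂ)` of elements whose conjugation action stabilises a given space of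
matrices. -/
def conjStabilizer (W : Submodule ℂ (Matrix (Fin n) (Fin n) ℂ)) : Subgroup (ZGL n) where
  carrier := {g | ∀ Y ∈ W, g.mat * Y * (g⁻¹).mat ∈ W ∧ (g⁻¹).mat * Y * g.mat ∈ W}
  one_mem' := by simp
  mul_mem' {g h} hg hh Y hY := by
    simp only [ZGL.mat_mul, mul_inv_rev]
    constructor
    · simpa only [mul_assoc] using (hg _ (hh Y hY).1).1
    · simpa only [mul_assoc] using (hh _ (hg Y hY).2).2
  inv_mem' {g} hg Y hY := by
    rw [inv_inv]
    exact (hg Y hY).symm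

/-- If `M` and `M'` are polynomial in the entries of `g`, then `l(M Y M') = 0` is a polynomial
equation in `g`. -/
lemma isClosed_map_mul_eq_zero (l : Matrix (Fin n) (Fin n) ℂ →ₗ[ℂ] ℂ)
    (M M' : Matrix (Fin n) (Fin n) (MvPolynomial (Fin n × Fin n) ℂ))
    (Y : Matrix (Fin n) (Fin n) ℂ) :
    IsClosed {g : ZGL n | l (M.map (eval g.coords) * Y * M'.map (eval g.coords)) = 0} := by
  have h : ∀ A : Matrix (Fin n) (Fin n) ℂ, l A = ∑ i, ∑ j, A i j * l (Matrix.single i j 1) := by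
    intro A
    conv_lhs => rw [Matrix.matrix_eq_sum_single A]
    simp only [map_sum]
    refine Finset.sum_congr rfl fun i _ => Finset.sum_congr rfl fun j _ => ?_
    rw [← smul_eq_mul, ← map_smul, Matrix.smul_single, smul_eq_mul, mul_one]
  let Z : Matrix (Fin n) (Fin n) (MvPolynomial (Fin n × Fin n) ℂ) := M * Y.map C * M'
  convert! isClosed_zeroLocus (∑ i, ∑ j, Z i j * C (l (Matrix.single i j 1))) using 1
  ext g
  simp only [Set.mem_ofPred_eq, map_sum, map_mul, eval_C]
  rw [h]
  have : M.map (eval g.coords) * Y * M'.map (eval g.coords) =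
      Z.map (eval g.coords) := by
    rw [Matrix.map_mul, Matrix.map_mul]
    congr 2
    ext i j
    simp
  simp only [this, Matrix.map_apply]

lemma isClosed_conjStabilizer (W : Submodule ℂ (Matrix (Fin n) (Fin n) ℂ)) :
    IsClosed (conjStabilizer W : Set (ZGL n)) := by
  -- up to the invertible factor `det g`, the inverse of `g` is the adjugate matrix
  let M : Matrix (Fin n) (Fin n) (MvPolynomial (Fin n × Fin n) ℂ) :=
    Matrix.mvPolynomialX (Fin n) (Fin n) ℂ
  have hM : ∀ g : ZGL n, M.map (eval g.coords) = g.mat := fun g => by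
    ext i j; simp [M, Matrix.mvPolynomialX]
  have hM' : ∀ g : ZGL n, M.adjugate.map (eval g.coords) = g.mat.det • (g⁻¹).mat := fun g => by
    have : M.adjugate.map (eval g.coords) = (M.map (eval g.coords)).adjugate :=
      RingHom.map_adjugate (eval g.coords) M
    rw [this, hM, ZGL.mat_inv, Matrix.inv_def, smul_smul,
      Ring.mul_inverse_cancel _ ((Matrix.isUnit_iff_isUnit_det _).1 g.isUnit_mat), one_smul]
  have hdet : ∀ g : ZGL n, g.mat.det ≠ 0 := fun g =>
    ((Matrix.isUnit_iff_isUnit_det _).1 g.isUnit_mat).ne_zero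
  have hmem : ∀ A, A ∈ W ↔ ∀ l : Matrix (Fin n) (Fin n) ℂ →ₗ[ℂ] ℂ, W ≤ LinearMap.ker l →
      l A = 0 := by
    refine fun A => ⟨fun h l hl => hl h, fun h => ?_⟩
    by_contra hA
    obtain ⟨l, hl, hl'⟩ := Submodule.exists_le_ker_of_notMem hA
    exact hl (h l hl')
  have h : (conjStabilizer W : Set (ZGL n)) = ⋂ Y ∈ W, ⋂ l : Matrix (Fin n) (Fin n) ℂ →ₗ[ℂ] ℂ,
      ⋂ (_ : W ≤ LinearMap.ker l),
        {g : ZGL n | l (M.map (eval g.coords) * Y * M.adjugate.map (eval g.coords)) = 0} ∩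
        {g : ZGL n | l (M.adjugate.map (eval g.coords) * Y * M.map (eval g.coords)) = 0} := by
    ext g
    simp only [Set.mem_iInter, Set.mem_inter_iff, Set.mem_ofPred_eq, hM, hM', SetLike.mem_coe,
      Matrix.mul_smul, Matrix.smul_mul, map_smul, smul_eq_mul, mul_eq_zero, hdet g, false_or]
    change (∀ Y ∈ W, _ ∧ _) ↔ _
    simp only [hmem]
    exact ⟨fun h Y hY l hl => ⟨(h Y hY).1 l hl, (h Y hY).2 l hl⟩,
      fun h Y hY => ⟨fun l hl => (h Y hY l hl).1, fun l hl => (h Y hY l hl).2⟩⟩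
  rw [h]
  exact isClosed_biInter fun Y _ => isClosed_iInter fun l => isClosed_iInter fun _ =>
    (isClosed_map_mul_eq_zero l M M.adjugate Y).inter (isClosed_map_mul_eq_zero l M.adjugate M Y)

/-- A subspace stable under `ad` of the Lie algebra of a connected group is stable under the
group. -/
lemma conj_mem_of_commutator_mem {K : Subgroup (ZGL n)} (hK : IsConnected (K : Set (ZGL n)))
    {W : Submodule ℂ (Matrix (Fin n) (Fin n) ℂ)}
    (h : ∀ X ∈ lieAlg K, ∀ Y ∈ W, X * Y - Y * X ∈ W) {g : ZGL n} (hg : g ∈ K)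
    {Y : Matrix (Fin n) (Fin n) ℂ} (hY : Y ∈ W) : g.mat * Y * (g⁻¹).mat ∈ W := by
  refine (le_of_lieAlg_le hK (isClosed_conjStabilizer W) (fun X hX => ?_) hg Y hY).1
  have h1 : ∀ c : ℂ, ∀ Y ∈ W, (ZGL.exp (c • X)).mat * Y * ((ZGL.exp (c • X))⁻¹).mat ∈ W :=
    fun c Y hY => conj_exp_mem (fun Z hZ => by
      simpa [smul_sub] using W.smul_mem c (h X hX Z hZ)) hY
  refine mem_lieAlg_of_exp_mem fun c Y hY => ⟨h1 c Y hY, ?_⟩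
  have h2 : ZGL.exp ((-c) • X) = (ZGL.exp (c • X))⁻¹ := by
    rw [eq_inv_iff_mul_eq_one, ← ZGL.exp_add, ← add_smul, neg_add_cancel, zero_smul, ZGL.exp_zero]
    exact ((Commute.refl X).smul_left _).smul_right _
  have h3 := h1 (-c) Y hY
  rwa [h2, inv_inv] at h3

end Stabilisers

/-! ### Abelian ideals in the Lie algebra of a reductive group with trivial centre -/

section AbelianIdeals

variable {n : ℕ}

lemma pow_eq_zero_of_isNilpotent {N : Matrix (Fin n) (Fin n) ℂ} (hN : IsNilpotent N) :
    N ^ n = 0 := by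
  have h1 : IsNilpotent (matEnd n N) := hN.map (matEnd n)
  have h2 := (LinearMap.isNilpotent_iff_charpoly _).1 h1
  have h3 := LinearMap.aeval_self_charpoly (matEnd n N)
  rw [h2, map_pow, Polynomial.aeval_X, Module.finrank_fin_fun, ← map_pow] at h3
  exact (map_eq_zero_iff _ (matEnd n).injective).1 h3

lemma isNilpotent_exp_sub_one {N : Matrix (Fin n) (Fin n) ℂ} (hN : IsNilpotent N) :
    IsNilpotent ((ZGL.exp N).mat - 1) := by
  obtain ⟨k, hk⟩ := hN
  have h1 := exp_smul_of_pow_eq_zero (pow_eq_zero_of_le (Nat.le_succ k) hk) 1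
  rw [one_smul] at h1
  rw [ZGL.mat_exp, h1, Finset.sum_range_succ']
  simp only [pow_zero, Nat.factorial_zero, Nat.cast_one, inv_one, mul_one, one_smul,
    add_sub_cancel_right, one_pow, pow_succ']
  simp only [← mul_smul_comm, ← Finset.mul_sum]
  refine Commute.isNilpotent_mul_right ?_ ⟨k, hk⟩
  exact Commute.sum_right _ _ _ fun i _ => ((Commute.refl N).pow_right i).smul_right _

/-- If `a` and `b` commute, `a` squares to zero at `y` and `b` is nilpotent then a power of
`a - b` vanishes at `y`. -/
lemma exists_sub_pow_apply_eq_zero {V : Type*} [AddCommGroup V] [Module ℂ V]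
    {a b : Module.End ℂ V} (h : Commute a b) (hb : IsNilpotent b) {y : V} (hy : a (a y) = 0) :
    ∃ k, ((a - b) ^ k) y = 0 := by
  obtain ⟨m, hm⟩ := hb
  refine ⟨m + 2, ?_⟩
  have h' : Commute a (-b) := h.neg_right
  rw [sub_eq_add_neg, h'.add_pow', LinearMap.sum_apply]
  refine Finset.sum_eq_zero fun ij hij => ?_
  replace hij := Finset.HasAntidiagonal.mem_antidiagonal.1 hij
  rw [LinearMap.smul_apply]
  refine smul_eq_zero_of_right _ ?_
  rcases le_or_gt m ij.2 with h2 | h2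
  · rw [neg_pow, pow_eq_zero_of_le h2 hm]
    simp
  · rw [(h'.pow_pow _ _).eq, ← Nat.sub_add_cancel (show 2 ≤ ij.1 by omega), pow_add, sq]
    simp [hy]

/-- The commutator with `X`, as an endomorphism of the space of matrices. -/
def commutatorEnd (X : Matrix (Fin n) (Fin n) ℂ) : Module.End ℂ (Matrix (Fin n) (Fin n) ℂ) :=
  LinearMap.mulLeft ℂ X - LinearMap.mulRight ℂ X

lemma commutatorEnd_apply (X Y : Matrix (Fin n) (Fin n) ℂ) :
    commutatorEnd X Y = X * Y - Y * X := rfl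

lemma isNilpotent_commutatorEnd {N : Matrix (Fin n) (Fin n) ℂ} (hN : IsNilpotent N) :
    IsNilpotent (commutatorEnd N) :=
  Commute.isNilpotent_sub (LinearMap.commute_mulLeft_right _ _)
    ((LinearMap.isNilpotent_mulLeft_iff ℂ N).2 hN)
    ((LinearMap.isNilpotent_mulRight_iff ℂ N).2 hN)

lemma commutatorEnd_commute {X Y : Matrix (Fin n) (Fin n) ℂ} (h : Commute X Y) :
    Commute (commutatorEnd X) (commutatorEnd Y) := by
  have h2 : X * Y = Y * X := h
  refine LinearMap.ext fun Z => ?_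
  simp only [Module.End.mul_apply, commutatorEnd_apply, mul_sub, sub_mul, ← mul_assoc, h2]
  simp only [mul_assoc, h2]
  abel

/-- The commutator with a diagonalisable matrix is diagonalisable, so a matrix killed by one of
its powers commutes with the matrix. -/
lemma commute_of_commutatorEnd_pow_eq_zero {S Y : Matrix (Fin n) (Fin n) ℂ}
    (hS : (matEnd n S).IsSemisimple) {k : ℕ} (hk : (commutatorEnd S ^ k) Y = 0) :
    Commute S Y := by
  obtain ⟨P, hP⟩ := exists_conj_eq_diagonal (fun _ : Unit => S) (fun _ _ => Commute.refl _)
    (fun _ => hS)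
  obtain ⟨d, hd⟩ := hP ()
  have hconj : ∀ Z, P.mat * (commutatorEnd S Z) * (P⁻¹).mat =
      Matrix.diagonal d * (P.mat * Z * (P⁻¹).mat) -
        (P.mat * Z * (P⁻¹).mat) * Matrix.diagonal d := by
    intro Z
    rw [← hd, commutatorEnd_apply]
    simp only [mul_sub, sub_mul, mul_assoc]
    simp only [← mul_assoc (P⁻¹).mat P.mat, ZGL.mat_inv_mul, one_mul]
  have hpow : ∀ k i j, (P.mat * ((commutatorEnd S ^ k) Y) * (P⁻¹).mat) i j =
      (d i - d j) ^ k * (P.mat * Y * (P⁻¹).mat) i j := by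
    intro k i j
    induction k with
    | zero => simp
    | succ k ih =>
      rw [pow_succ', Module.End.mul_apply, hconj, Matrix.sub_apply, Matrix.diagonal_mul,
        Matrix.mul_diagonal, ih]
      ring
  have h0 : P.mat * (commutatorEnd S Y) * (P⁻¹).mat = 0 := by
    ext i j
    have h1 := hpow k i j
    rw [hk] at h1
    have h2 := hpow 1 i j
    rw [pow_one, pow_one] at h2
    rw [h2]
    simp only [mul_zero, zero_mul, Matrix.zero_apply] at h1 ⊢
    rcases mul_eq_zero.1 h1.symm with h3 | h3
    · rw [eq_zero_of_pow_eq_zero h3, zero_mul]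
    · rw [h3, mul_zero]
  have h1 : (P⁻¹).mat * (P.mat * (commutatorEnd S Y) * (P⁻¹).mat) * P.mat =
      commutatorEnd S Y := by
    simp only [mul_assoc, ZGL.mat_inv_mul, mul_one]
    rw [← mul_assoc, ZGL.mat_inv_mul, one_mul]
  rw [h0, mul_zero, zero_mul] at h1
  exact sub_eq_zero.1 h1.symm

/-- A semisimple matrix that commutes with a nilpotent one commutes with every matrix which is
annihilated by the square of `ad (N + S)`. -/
lemma commute_semisimple_of_commutator_commutator_eq_zero {N S Y : Matrix (Fin n) (Fin n) ℂ}
    (hNS : Commute N S) (hN : IsNilpotent N) (hS : (matEnd n S).IsSemisimple)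
    (h : Commute (N + S) ((N + S) * Y - Y * (N + S))) : Commute S Y := by
  have hadd : commutatorEnd (N + S) - commutatorEnd N = commutatorEnd S := by
    ext1 Z
    simp only [LinearMap.sub_apply, commutatorEnd_apply, add_mul, mul_add]
    abel
  have hcomm : Commute (N + S) N := ((Commute.refl N).add_right hNS).symm
  obtain ⟨k, hk⟩ := exists_sub_pow_apply_eq_zero (commutatorEnd_commute hcomm)
    (isNilpotent_commutatorEnd hN) (y := Y) (by
      rw [commutatorEnd_apply, commutatorEnd_apply, sub_eq_zero]
      exact h)
  rw [hadd] at hk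
  exact commute_of_commutatorEnd_pow_eq_zero hS hk

/-- The exponentials of the elements of a commutative space of matrices. -/
noncomputable def expSubgroup (W : Submodule ℂ (Matrix (Fin n) (Fin n) ℂ))
    (hW : ∀ X ∈ W, ∀ Y ∈ W, Commute X Y) : Subgroup (ZGL n) where
  carrier := {g | ∃ X ∈ W, ZGL.exp X = g}
  one_mem' := ⟨0, W.zero_mem, ZGL.exp_zero⟩
  mul_mem' := by
    rintro _ _ ⟨X, hX, rfl⟩ ⟨Y, hY, rfl⟩
    exact ⟨X + Y, W.add_mem hX hY, ZGL.exp_add (hW X hX Y hY)⟩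
  inv_mem' := by
    rintro _ ⟨X, hX, rfl⟩
    refine ⟨-X, W.neg_mem hX, ?_⟩
    rw [eq_inv_iff_mul_eq_one, ← ZGL.exp_add ((Commute.refl X).neg_left), neg_add_cancel,
      ZGL.exp_zero]

lemma isClosed_setOf_sub_one_pow_eq_zero (k : ℕ) :
    IsClosed {g : ZGL n | (g.mat - 1) ^ k = 0} := by
  let M : Matrix (Fin n) (Fin n) (MvPolynomial (Fin n × Fin n) ℂ) :=
    Matrix.mvPolynomialX (Fin n) (Fin n) ℂ
  have hM : ∀ g : ZGL n, (eval g.coords).mapMatrix ((M - 1) ^ k) = (g.mat - 1) ^ k := fun g => by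
    rw [map_pow, map_sub, map_one]
    congr 2
    ext i j; simp [M, Matrix.mvPolynomialX]
  have h : {g : ZGL n | (g.mat - 1) ^ k = 0} =
      ⋂ ij : Fin n × Fin n, {g : ZGL n | eval g.coords (((M - 1) ^ k) ij.1 ij.2) = 0} := by
    ext g
    simp only [Set.mem_iInter, Set.mem_ofPred_eq]
    rw [← hM g]
    exact ⟨fun h ij => congrFun (congrFun h ij.1) ij.2, fun h => by ext i j; exact h (i, j)⟩
  rw [h]
  exact isClosed_iInter fun ij => isClosed_zeroLocus _

/-- The closure of a unipotent subgroup is a subgroup. Inversion is a polynomial map on unipotent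
matrices, by the geometric series. -/
def unipotentClosure (E : Subgroup (ZGL n)) (hE : ∀ g ∈ E, IsNilpotent (g.mat - 1)) :
    Subgroup (ZGL n) where
  __ := E.toSubmonoid.topologicalClosure
  inv_mem' {g} hg := by
    have hcl : closure (E : Set (ZGL n)) ⊆ {g : ZGL n | (g.mat - 1) ^ n = 0} :=
      closure_minimal (fun g hg => pow_eq_zero_of_isNilpotent (hE g hg))
        (isClosed_setOf_sub_one_pow_eq_zero n)
    let M : Matrix (Fin n) (Fin n) (MvPolynomial (Fin n × Fin n) ℂ) :=
      Matrix.mvPolynomialX (Fin n) (Fin n) ℂ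
    let F : Matrix (Fin n) (Fin n) (MvPolynomial (Fin n × Fin n) ℂ) :=
      ∑ i ∈ Finset.range n, (1 - M) ^ i
    have hF : ∀ g ∈ closure (E : Set (ZGL n)), ∀ ij : Fin n × Fin n,
        eval g.coords (F ij.1 ij.2) = (g⁻¹).coords ij := by
      intro g hg ij
      have h1 : (eval g.coords).mapMatrix F = (g⁻¹).mat := by
        have hM : (eval g.coords).mapMatrix M = g.mat := by
          ext i j; simp [M, Matrix.mvPolynomialX]
        simp only [F, map_sum, map_pow, map_sub, map_one, hM]
        have h2 := mul_neg_geom_sum (1 - g.mat) n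
        have h3 : (1 - g.mat) ^ n = 0 := by
          rw [← neg_sub, neg_pow, hcl hg, mul_zero]
        rw [h3, sub_zero, sub_sub_cancel] at h2
        rw [ZGL.mat_inv]
        exact (Matrix.inv_eq_right_inv h2).symm
      exact congrFun (congrFun h1 ij.1) ij.2
    change g⁻¹ ∈ closure (E : Set (ZGL n))
    refine mem_of_isClosed isClosed_closure fun p hp => ?_
    have h1 : ∀ h ∈ closure (E : Set (ZGL n)),
        eval h.coords (bind₁ (fun ij => F ij.1 ij.2) p) = eval (h⁻¹).coords p := fun h hh => by
      rw [eval_bind₁, funext (hF h hh)]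
    rw [← h1 g hg]
    by_contra hne
    have h2 : closure (E : Set (ZGL n)) ⊆
        {h | eval h.coords (bind₁ (fun ij => F ij.1 ij.2) p) = 0} := by
      refine closure_minimal (fun h hh => ?_) (isClosed_zeroLocus _)
      rw [Set.mem_ofPred_eq, h1 h (subset_closure hh)]
      exact hp _ (subset_closure (E.inv_mem hh))
    exact hne (h2 hg)

/-- The Lie algebra of a connected reductive group with trivial centre has no nonzero abelian
ideals: by the Jordan decomposition the elements of such an ideal are nilpotent, and the Zariski
closure of their exponentials is a connected normal unipotent subgroup. -/
lemma eq_bot_of_abelian_ideal {G : Subgroup (ZGL n)} (hG : IsConnectedReductive G)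
    (hZ : Subgroup.center G = ⊥) {W : Submodule ℂ (Matrix (Fin n) (Fin n) ℂ)}
    (hWG : W ≤ lieAlg G) (hWab : ∀ X ∈ W, ∀ Y ∈ W, Commute X Y)
    (hW : ∀ X ∈ lieAlg G, ∀ Y ∈ W, X * Y - Y * X ∈ W) : W = ⊥ := by
  have hnil : ∀ X ∈ W, IsNilpotent X := by
    intro X hX
    obtain ⟨N, hN, S, hS, hNn, hSs, hXNS⟩ := exists_jordan_decomposition X
    have hNX : Commute N X := commute_of_mem_adjoin hN (Commute.refl X)
    have hNS : Commute N S := (commute_of_mem_adjoin hS hNX.symm).symm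
    have hSG : S ∈ lieAlg G :=
      semisimple_part_mem_lieAlg hG.isClosed (hXNS ▸ hWG hX) hNS hNn hSs
    have hS0 : S = 0 := by
      refine eq_zero_of_commute_lieAlg hG.isClosed hG.isConnected hZ hSG fun Y hY => ?_
      refine (commute_semisimple_of_commutator_commutator_eq_zero hNS hNn hSs ?_).symm
      rw [← hXNS]
      refine hWab X hX _ ?_
      rw [← neg_sub]
      exact W.neg_mem (hW Y hY X hX)
    rwa [hXNS, hS0, add_zero]
  let E := expSubgroup W hWab
  have hE : ∀ g ∈ E, IsNilpotent (g.mat - 1) := by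
    rintro _ ⟨X, hX, rfl⟩
    exact isNilpotent_exp_sub_one (hnil X hX)
  let U := unipotentClosure E hE
  have hU : (U : Set (ZGL n)) = closure (E : Set (ZGL n)) := rfl
  have hEU : E ≤ U := fun g hg => subset_closure hg
  have hUbot : U = ⊥ := by
    refine hG.unipotentRadical_eq_bot U ?_ ?_ ?_ ?_ ?_
    · refine closure_minimal ?_ hG.isClosed
      rintro _ ⟨X, hX, rfl⟩
      exact exp_mem hG.isClosed (hWG hX)
    · exact isClosed_closure
    · rw [hU]
      refine IsConnected.closure ⟨⟨1, E.one_mem⟩, ?_⟩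
      refine isPreconnected_of_forall 1 ?_
      rintro _ ⟨X, hX, rfl⟩
      refine ⟨Set.range fun c : ℂ => ZGL.exp (c • X), ?_, ⟨0, by simp⟩, ⟨1, by simp⟩,
        isPreconnected_range (continuous_exp_smul X)⟩
      rintro _ ⟨c, rfl⟩
      exact ⟨c • X, W.smul_mem c hX, rfl⟩
    · intro g hg u hu
      have hc : Continuous fun y : ZGL n => g * y * g⁻¹ :=
        (continuous_mul_const g⁻¹).comp (continuous_const_mul g)
      refine map_mem_closure (f := fun y : ZGL n => g * y * g⁻¹) hc hu ?_
      rintro _ ⟨X, hX, rfl⟩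
      exact ⟨_, conj_mem_of_commutator_mem hG.isConnected hW hg hX, (ZGL.conj_exp g X).symm⟩
    · intro u hu
      refine ⟨n, ?_⟩
      exact closure_minimal (fun g hg => pow_eq_zero_of_isNilpotent (hE g hg))
        (isClosed_setOf_sub_one_pow_eq_zero n) hu
  rw [eq_bot_iff]
  intro X hX
  refine eq_zero_of_exp_smul_eq_one fun c => ?_
  have : ZGL.exp (c • X) ∈ U := hEU ⟨_, W.smul_mem c hX, rfl⟩
  rwa [hUbot] at this

end AbelianIdeals

/-! ### The Lie algebra of a maximal torus is a Cartan subalgebra -/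

section CartanSubalgebra

attribute [local instance] LieRing.ofAssociativeRing

variable {n : ℕ}

/-- The Lie algebra of a closed subgroup, as a Lie subalgebra of the algebra of matrices. -/
def lieSubalgebra {G : Subgroup (ZGL n)} (hG : IsClosed (G : Set (ZGL n))) :
    LieSubalgebra ℂ (Matrix (Fin n) (Fin n) ℂ) where
  __ := lieAlg G
  lie_mem' hX hY := commutator_mem_lieAlg hG hX hY

/-- The Lie algebra of a closed subgroup `T` of `G`, inside that of `G`. -/
def lieSubalgebraOf {G T : Subgroup (ZGL n)} (hG : IsClosed (G : Set (ZGL n)))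
    (hT : IsClosed (T : Set (ZGL n))) : LieSubalgebra ℂ (lieSubalgebra hG) where
  __ := (lieAlg T).comap (lieSubalgebra hG).toSubmodule.subtype
  lie_mem' hX hY := commutator_mem_lieAlg hT hX hY

/-- A reductive group with trivial centre has no abelian ideals in its Lie algebra, so that Cartan's
criterion applies. -/
lemma isKilling_lieSubalgebra {G : Subgroup (ZGL n)} (hG : IsConnectedReductive G)
    (hZ : Subgroup.center G = ⊥) : LieAlgebra.IsKilling ℂ (lieSubalgebra hG.isClosed) := by
  have : LieAlgebra.HasTrivialRadical ℂ (lieSubalgebra hG.isClosed) := by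
    rw [LieAlgebra.hasTrivialRadical_iff_no_abelian_ideals]
    intro I hI
    have h : (I.toSubmodule.map (lieSubalgebra hG.isClosed).toSubmodule.subtype) = ⊥ := by
      refine eq_bot_of_abelian_ideal hG hZ ?_ ?_ ?_
      · rintro _ ⟨X, hX, rfl⟩
        exact X.2
      · rintro _ ⟨X, hX, rfl⟩ _ ⟨Y, hY, rfl⟩
        have h1 : ⁅(⟨X, hX⟩ : I), (⟨Y, hY⟩ : I)⁆ = 0 := hI.trivial _ _
        have h2 : X.1 * Y.1 - Y.1 * X.1 = 0 :=
          congrArg (fun Z : I => (Z : lieSubalgebra hG.isClosed).1) h1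
        exact sub_eq_zero.1 h2
      · rintro X hX _ ⟨Y, hY, rfl⟩
        exact ⟨⁅(⟨X, hX⟩ : lieSubalgebra hG.isClosed), Y⁆, lie_mem_right _ _ I _ _ hY, rfl⟩
    rw [LieSubmodule.eq_bot_iff]
    intro X hX
    refine Subtype.ext ?_
    have : X.1 ∈ I.toSubmodule.map (lieSubalgebra hG.isClosed).toSubmodule.subtype := ⟨X, hX, rfl⟩
    rwa [h] at this
  infer_instance

lemma isDiag_conj_of_mem_lieAlg {T : Subgroup (ZGL n)} (hT : IsClosed (T : Set (ZGL n)))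
    {P : ZGL n} (hP : ∀ t ∈ T, (P * t * P⁻¹).mat.IsDiag) {X : Matrix (Fin n) (Fin n) ℂ}
    (hX : X ∈ lieAlg T) : (P.mat * X * (P⁻¹).mat).IsDiag := by
  intro i j hij
  have h1 := ZGL.hasDerivAt_exp (P.mat * X * (P⁻¹).mat) 0 (i, j)
  have h2 : ∀ c : ℂ, (ZGL.exp (c • (P.mat * X * (P⁻¹).mat))).coords (i, j) = 0 := by
    intro c
    have h3 := hP _ (exp_smul_mem hT hX c) hij
    rw [ZGL.conj_exp] at h3
    simpa using h3
  simp only [h2] at h1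
  simpa using h1.unique (hasDerivAt_const (0 : ℂ) (0 : ℂ))

lemma isDiag_of_eq_diagonal {A : Matrix (Fin n) (Fin n) ℂ} {d : Fin n → ℂ}
    (h : A = Matrix.diagonal d) : A.IsDiag := h ▸ Matrix.isDiag_diagonal d

lemma isSemisimple_of_conj_isDiag' {A : Matrix (Fin n) (Fin n) ℂ} {P : ZGL n}
    (h : (P.mat * A * (P⁻¹).mat).IsDiag) : (matEnd n A).IsSemisimple :=
  isSemisimple_of_conj_isDiag ((Matrix.isDiag_iff_diagonal_diag _).1 h).symm

lemma commute_of_conj_isDiag {A B : Matrix (Fin n) (Fin n) ℂ} {P : ZGL n}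
    (hA : (P.mat * A * (P⁻¹).mat).IsDiag) (hB : (P.mat * B * (P⁻¹).mat).IsDiag) :
    Commute A B := by
  have h1 : Commute (P.mat * A * (P⁻¹).mat) (P.mat * B * (P⁻¹).mat) := by
    rw [← (Matrix.isDiag_iff_diagonal_diag _).1 hA, ← (Matrix.isDiag_iff_diagonal_diag _).1 hB]
    exact Matrix.commute_diagonal _ _
  have h2 : ∀ Z, (P⁻¹).mat * (P.mat * Z * (P⁻¹).mat) * P.mat = Z := by
    intro Z
    simp only [mul_assoc, ZGL.mat_inv_mul, mul_one]
    rw [← mul_assoc, ZGL.mat_inv_mul, one_mul]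
  have h3 : ∀ A B, (P.mat * A * (P⁻¹).mat) * (P.mat * B * (P⁻¹).mat) =
      P.mat * (A * B) * (P⁻¹).mat := by
    intro A B
    simp only [mul_assoc]
    rw [← mul_assoc (P⁻¹).mat P.mat, ZGL.mat_inv_mul, one_mul]
  have h4 : (P.mat * A * (P⁻¹).mat) * (P.mat * B * (P⁻¹).mat) =
    (P.mat * B * (P⁻¹).mat) * (P.mat * A * (P⁻¹).mat) := h1
  rw [h3, h3] at h4
  change A * B = B * A
  rw [← h2 (A * B), h4, h2]

lemma IsTorus.commute {T : Subgroup (ZGL n)} (hT : IsTorus T) {s t : ZGL n} (hs : s ∈ T)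
    (ht : t ∈ T) : Commute s.mat t.mat := by
  obtain ⟨P, hP⟩ := hT.diagonalizable
  exact commute_of_conj_isDiag (P := P) (hP s hs) (hP t ht)

lemma IsTorus.commute_lieAlg {T : Subgroup (ZGL n)} (hT : IsTorus T)
    {X Y : Matrix (Fin n) (Fin n) ℂ} (hX : X ∈ lieAlg T) (hY : Y ∈ lieAlg T) : Commute X Y := by
  obtain ⟨P, hP⟩ := hT.diagonalizable
  exact commute_of_conj_isDiag (isDiag_conj_of_mem_lieAlg hT.isClosed hP hX)
    (isDiag_conj_of_mem_lieAlg hT.isClosed hP hY)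

lemma IsTorus.isSemisimple {T : Subgroup (ZGL n)} (hT : IsTorus T)
    {X : Matrix (Fin n) (Fin n) ℂ} (hX : X ∈ lieAlg T) : (matEnd n X).IsSemisimple := by
  obtain ⟨P, hP⟩ := hT.diagonalizable
  exact isSemisimple_of_conj_isDiag' (isDiag_conj_of_mem_lieAlg hT.isClosed hP hX)

lemma subset_map_identityComponent {K : Subgroup (ZGL n)} {s : Set (ZGL n)} (hs : IsPreconnected s)
    (h1 : 1 ∈ s) (hsK : s ⊆ K) : s ⊆ ((identityComponent K).map K.subtype : Subgroup (ZGL n)) := by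
  intro g hg
  have h3 : (Subtype.val : K → ZGL n) '' (Subtype.val ⁻¹' s) = s :=
    Set.image_preimage_eq_of_subset fun x hx => ⟨⟨x, hsK hx⟩, rfl⟩
  have h2 : IsPreconnected ((Subtype.val : K → ZGL n) ⁻¹' s) :=
    Topology.IsInducing.subtypeVal.isPreconnected_image.1 (h3.symm ▸ hs)
  exact ⟨⟨g, hsK hg⟩, h2.subset_connectedComponent (x := (1 : K)) h1 hg, rfl⟩

/-- The group of elements that are diagonalised by `Q` is the centralizer of a diagonalisable matrix
with distinct eigenvalues. -/
lemma mem_matCentralizer_iff_isDiag (Q g : ZGL n) :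
    g ∈ matCentralizer ((Q⁻¹).mat * Matrix.diagonal (fun i : Fin n => (i : ℂ)) * Q.mat) ↔
      (Q * g * Q⁻¹).mat.IsDiag := by
  have h0 : (Q.mat * ((Q⁻¹).mat * Matrix.diagonal (fun i : Fin n => (i : ℂ)) * Q.mat) *
      (Q⁻¹).mat) = Matrix.diagonal (fun i : Fin n => (i : ℂ)) := by
    simp only [mul_assoc, ZGL.mat_mul_inv, mul_one]
    rw [← mul_assoc, ZGL.mat_mul_inv, one_mul]
  constructor
  · intro h i j hij
    have h1 : Commute (Q * g * Q⁻¹).mat (Matrix.diagonal (fun i : Fin n => (i : ℂ))) := by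
      rw [← h0]
      change _ * _ = _ * _
      have h2 : g.mat * _ = _ * g.mat := mem_matCentralizer.1 h
      simp only [ZGL.mat_mul, mul_assoc] at h2 ⊢
      rw [← mul_assoc (Q⁻¹).mat Q.mat, ZGL.mat_inv_mul, one_mul, ← mul_assoc (Q⁻¹).mat Q.mat,
        ZGL.mat_inv_mul, one_mul]
      congr 1
      simp only [← mul_assoc] at h2 ⊢
      rw [h2]
    have h2 := congrFun (congrFun h1.eq i) j
    rw [Matrix.mul_diagonal, Matrix.diagonal_mul, mul_comm, ← sub_eq_zero, ← sub_mul,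
      mul_eq_zero] at h2
    rcases h2 with h2 | h2
    · exact absurd (Fin.ext (by exact_mod_cast (sub_eq_zero.1 h2).symm)) hij
    · exact h2
  · intro h
    refine commute_of_conj_isDiag (P := Q) h ?_
    rw [h0]
    exact Matrix.isDiag_diagonal _

/-- A semisimple element of the Lie algebra that commutes with a maximal torus is in the Lie
algebra of the torus. -/
lemma IsMaximalTorus.mem_lieAlg_of_isSemisimple {G T : Subgroup (ZGL n)}
    (hG : IsClosed (G : Set (ZGL n))) (hT : IsMaximalTorus G T) {X : Matrix (Fin n) (Fin n) ℂ}
    (hX : X ∈ lieAlg G) (hXs : (matEnd n X).IsSemisimple) (hXT : ∀ t ∈ T, Commute t.mat X) :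
    X ∈ lieAlg T := by
  obtain ⟨P, hP⟩ := hT.isTorus.diagonalizable
  obtain ⟨Q, hQ⟩ := exists_conj_eq_diagonal (ι := Option T)
    (fun o => o.elim X fun t => (t : ZGL n).mat)
    (by
      rintro (_ | s) (_ | t)
      · exact Commute.refl X
      · exact (hXT t t.2).symm
      · exact hXT s s.2
      · exact hT.isTorus.commute s.2 t.2)
    (by
      rintro (_ | t)
      · exact hXs
      · exact isSemisimple_of_conj_isDiag' (P := P) (hP t t.2))
  let D : Matrix (Fin n) (Fin n) ℂ :=
    (Q⁻¹).mat * Matrix.diagonal (fun i : Fin n => (i : ℂ)) * Q.mat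
  let K : Subgroup (ZGL n) := G ⊓ matCentralizer D
  have hKc : IsClosed (K : Set (ZGL n)) := hG.inter (isClosed_matCentralizer _)
  let S : Subgroup (ZGL n) := (identityComponent K).map K.subtype
  have hTS : T ≤ S := by
    refine subset_map_identityComponent hT.isTorus.isConnected.isPreconnected T.one_mem ?_
    intro t ht
    refine ⟨hT.le ht, (mem_matCentralizer_iff_isDiag Q t).2 ?_⟩
    obtain ⟨d, hd⟩ := hQ (some ⟨t, ht⟩)
    exact isDiag_of_eq_diagonal hd
  have hST : S = T := by
    refine hT.maximal S ⟨?_, ?_, Q, ?_⟩ ?_ hTS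
    · exact hKc.isClosedEmbedding_subtypeVal.isClosedMap _ isClosed_connectedComponent
    · exact isConnected_connectedComponent.image _ continuous_subtype_val.continuousOn
    · rintro _ ⟨t, -, rfl⟩
      exact (mem_matCentralizer_iff_isDiag Q t).1 t.2.2
    · rintro _ ⟨t, -, rfl⟩
      exact t.2.1
  refine mem_lieAlg_of_exp_mem fun c => ?_
  rw [← hST]
  refine subset_map_identityComponent (isPreconnected_range (continuous_exp_smul X))
    ⟨0, by simp⟩ ?_ ⟨c, rfl⟩
  rintro _ ⟨c, rfl⟩
  refine ⟨exp_smul_mem hG hX c, mem_matCentralizer.2 (ZGL.mat_exp_commute ?_)⟩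
  refine Commute.smul_left ?_ c
  obtain ⟨d, hd⟩ := hQ none
  refine commute_of_conj_isDiag (P := Q) (isDiag_of_eq_diagonal hd) ?_
  have h0 : Q.mat * D * (Q⁻¹).mat = Matrix.diagonal (fun i : Fin n => (i : ℂ)) := by
    simp only [D, mul_assoc, ZGL.mat_mul_inv, mul_one]
    rw [← mul_assoc, ZGL.mat_mul_inv, one_mul]
  rw [h0]
  exact Matrix.isDiag_diagonal _

lemma IsMaximalTorus.isLieAbelian {G T : Subgroup (ZGL n)} (hG : IsClosed (G : Set (ZGL n)))
    (hT : IsMaximalTorus G T) : IsLieAbelian (lieSubalgebraOf hG hT.isTorus.isClosed) :=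
  ⟨fun X Y => Subtype.ext (Subtype.ext (sub_eq_zero.2 (hT.isTorus.commute_lieAlg X.2 Y.2).eq))⟩

/-- The generalised centralizer of the torus is its centralizer, because the Lie algebra of a torus
acts by semisimple endomorphisms. -/
lemma IsMaximalTorus.mem_zeroRootSubalgebra {G T : Subgroup (ZGL n)}
    (hG : IsClosed (G : Set (ZGL n))) (hT : IsMaximalTorus G T)
    [LieRing.IsNilpotent (lieSubalgebraOf hG hT.isTorus.isClosed)] {X : lieSubalgebra hG} :
    X ∈ LieAlgebra.zeroRootSubalgebra ℂ (lieSubalgebra hG)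
      (lieSubalgebraOf hG hT.isTorus.isClosed) ↔ ∀ Y ∈ lieAlg T, Commute Y X.1 := by
  rw [LieAlgebra.mem_zeroRootSubalgebra]
  have hpow : ∀ (Y : lieSubalgebraOf hG hT.isTorus.isClosed) (k : ℕ),
      (commutatorEnd Y.1.1 ^ k) X.1 =
        ((LieModule.toEnd ℂ _ (lieSubalgebra hG) Y ^ k) X).1 := fun Y k =>
    LinearMap.congr_fun (Module.End.commute_pow_left_of_commute
      (f := (lieSubalgebra hG).toSubmodule.subtype) (g₂ := commutatorEnd Y.1.1)
      (g := LieModule.toEnd ℂ _ (lieSubalgebra hG) Y) rfl k) X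
  constructor
  · intro h Y hY
    obtain ⟨k, hk⟩ := h ⟨⟨Y, lieAlg_mono hT.le hY⟩, hY⟩
    refine commute_of_commutatorEnd_pow_eq_zero (k := k) (hT.isTorus.isSemisimple hY) ?_
    rw [hpow ⟨⟨Y, lieAlg_mono hT.le hY⟩, hY⟩ k, hk]
    rfl
  · intro h Y
    refine ⟨1, Subtype.ext ?_⟩
    rw [← hpow, pow_one, commutatorEnd_apply]
    exact sub_eq_zero.2 (h _ Y.2).eq

/-- The semisimple part of an element of the Lie algebra that commutes with the torus lies in the
Lie algebra of the torus. -/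
lemma IsMaximalTorus.exists_add_of_commute {G T : Subgroup (ZGL n)}
    (hG : IsClosed (G : Set (ZGL n))) (hT : IsMaximalTorus G T)
    {X : Matrix (Fin n) (Fin n) ℂ} (hX : X ∈ lieAlg G)
    (hXT : ∀ Y ∈ lieAlg T, Commute Y X) : ∃ N ∈ lieAlg G, ∃ S ∈ lieAlg T, IsNilpotent N ∧
      X = N + S ∧ ∀ Y ∈ lieAlg T, Commute Y N := by
  obtain ⟨N, hN, S, hS, hNn, hSs, hXNS⟩ := exists_jordan_decomposition X
  have hNX : Commute N X := commute_of_mem_adjoin hN (Commute.refl X)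
  have hNS : Commute N S := (commute_of_mem_adjoin hS hNX.symm).symm
  have hSG : S ∈ lieAlg G := semisimple_part_mem_lieAlg hG (hXNS ▸ hX) hNS hNn hSs
  refine ⟨N, ?_, S, ?_, hNn, hXNS, fun Y hY => (commute_of_mem_adjoin hN (hXT Y hY).symm).symm⟩
  · rw [← sub_eq_iff_eq_add.2 hXNS]
    exact Submodule.sub_mem _ hX hSG
  · refine hT.mem_lieAlg_of_isSemisimple hG hSG hSs fun t ht => ?_
    refine commute_of_commute_lieAlg hT.isTorus.isConnected (fun Y hY => ?_) ht
    exact (commute_of_mem_adjoin hS (hXT Y hY).symm).symm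

/-- The centralizer of a maximal torus is a nilpotent Lie algebra: the elements act on it through
their nilpotent parts. -/
lemma IsMaximalTorus.isNilpotent_zeroRootSubalgebra {G T : Subgroup (ZGL n)}
    (hG : IsClosed (G : Set (ZGL n))) (hT : IsMaximalTorus G T)
    [LieRing.IsNilpotent (lieSubalgebraOf hG hT.isTorus.isClosed)] :
    LieRing.IsNilpotent (LieAlgebra.zeroRootSubalgebra ℂ (lieSubalgebra hG)
      (lieSubalgebraOf hG hT.isTorus.isClosed)) := by
  rw [LieAlgebra.isNilpotent_iff_forall (R := ℂ)]
  intro X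
  obtain ⟨N, hN, S, hS, ⟨k, hk⟩, hXNS, -⟩ := hT.exists_add_of_commute hG X.1.2
    ((hT.mem_zeroRootSubalgebra hG).1 X.2)
  obtain ⟨k, hk⟩ := isNilpotent_commutatorEnd ⟨k, hk⟩
  refine ⟨k, ?_⟩
  ext1 Y
  have hcomp : commutatorEnd N ∘ₗ ((lieSubalgebra hG).toSubmodule.subtype ∘ₗ
      (LieAlgebra.zeroRootSubalgebra ℂ (lieSubalgebra hG)
        (lieSubalgebraOf hG hT.isTorus.isClosed)).toSubmodule.subtype) =
      ((lieSubalgebra hG).toSubmodule.subtype ∘ₗ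
      (LieAlgebra.zeroRootSubalgebra ℂ (lieSubalgebra hG)
        (lieSubalgebraOf hG hT.isTorus.isClosed)).toSubmodule.subtype) ∘ₗ LieAlgebra.ad ℂ _ X := by
    refine LinearMap.ext fun Z => ?_
    change N * Z.1.1 - Z.1.1 * N = X.1.1 * Z.1.1 - Z.1.1 * X.1.1
    have h := ((hT.mem_zeroRootSubalgebra hG).1 Z.2 S hS).eq
    rw [hXNS, add_mul, mul_add, h]
    abel
  have hpow := LinearMap.congr_fun (Module.End.commute_pow_left_of_commute hcomp k) Y
  rw [hk] at hpow
  exact Subtype.ext (Subtype.ext hpow.symm)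

/-- By the invariance of the Killing form, a nilpotent matrix in the centralizer of a maximal torus
is orthogonal to the whole Lie algebra. -/
lemma IsMaximalTorus.eq_zero_of_isNilpotent {G T : Subgroup (ZGL n)}
    (hG : IsClosed (G : Set (ZGL n))) (hT : IsMaximalTorus G T) [LieAlgebra.IsKilling ℂ (lieSubalgebra hG)]
    {N : Matrix (Fin n) (Fin n) ℂ} (hN : N ∈ lieAlg G) (hNn : IsNilpotent N)
    (hNT : ∀ Y ∈ lieAlg T, Commute Y N) : N = 0 := by
  have := hT.isLieAbelian hG
  let g := lieSubalgebra hG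
  let t := lieSubalgebraOf hG hT.isTorus.isClosed
  let c := LieAlgebra.zeroRootSubalgebra ℂ g t
  have hcn : LieRing.IsNilpotent c := hT.isNilpotent_zeroRootSubalgebra hG
  let N' : g := ⟨N, hN⟩
  have hNc : N' ∈ c := (hT.mem_zeroRootSubalgebra hG).2 hNT
  have hnil : IsNilpotent (LieModule.toEnd ℂ c g ⟨N', hNc⟩) := by
    obtain ⟨k, hk⟩ := isNilpotent_commutatorEnd hNn
    refine ⟨k, ?_⟩
    ext1 Y
    have hpow := LinearMap.congr_fun (Module.End.commute_pow_left_of_commute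
      (f := (lieSubalgebra hG).toSubmodule.subtype) (g₂ := commutatorEnd N)
      (g := LieModule.toEnd ℂ c g ⟨N', hNc⟩) rfl k) Y
    rw [hk] at hpow
    exact Subtype.ext hpow.symm
  have h1 : ∀ Y ∈ c, killingForm ℂ g N' Y = 0 := by
    intro Y hY
    change LieModule.traceForm ℂ c g ⟨N', hNc⟩ ⟨Y, hY⟩ = 0
    rw [LieModule.traceForm_eq_sum_finrank_nsmul_mul]
    refine Finset.sum_eq_zero fun χ _ => ?_
    rw [LieModule.Weight.apply_eq_zero_of_isNilpotent _ hnil χ, zero_mul, smul_zero]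
  have h2 : ∀ Y, killingForm ℂ g N' Y = 0 := by
    intro Y
    have h3 : Y ∈ (LieAlgebra.rootSpace t (0 : t → ℂ)).toSubmodule ⊔
        (LieModule.posFittingComp ℂ t g).toSubmodule := by
      have := (LieModule.isCompl_genWeightSpace_zero_posFittingComp ℂ t g).sup_eq_top
      rw [← LieSubmodule.toSubmodule_inj, LieSubmodule.sup_toSubmodule] at this
      rw [this]
      trivial
    obtain ⟨Y0, hY0, Y1, hY1, rfl⟩ := Submodule.mem_sup.1 h3
    rw [map_add, h1 Y0 hY0,
      killingForm_eq_zero_of_mem_zeroRoot_mem_posFitting ℂ g t hNc hY1, add_zero]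
  have h3 : N' ∈ LinearMap.ker (killingForm ℂ g) := LinearMap.ext h2
  rw [LieAlgebra.IsKilling.ker_killingForm_eq_bot] at h3
  exact congrArg Subtype.val h3

/-- In the semisimple case the Lie algebra of a maximal torus is its own centralizer. -/
lemma IsMaximalTorus.mem_lieAlg_of_commute {G T : Subgroup (ZGL n)}
    (hG : IsClosed (G : Set (ZGL n))) (hT : IsMaximalTorus G T) [LieAlgebra.IsKilling ℂ (lieSubalgebra hG)]
    {X : Matrix (Fin n) (Fin n) ℂ} (hX : X ∈ lieAlg G)
    (hXT : ∀ Y ∈ lieAlg T, Commute Y X) : X ∈ lieAlg T := by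
  obtain ⟨N, hN, S, hS, hNn, rfl, hNT⟩ := hT.exists_add_of_commute hG hX hXT
  rwa [hT.eq_zero_of_isNilpotent hG hN hNn hNT, zero_add]

lemma IsMaximalTorus.isCartanSubalgebra {G T : Subgroup (ZGL n)}
    (hG : IsClosed (G : Set (ZGL n))) (hT : IsMaximalTorus G T) [LieAlgebra.IsKilling ℂ (lieSubalgebra hG)] :
    (lieSubalgebraOf hG hT.isTorus.isClosed).IsCartanSubalgebra := by
  have := hT.isLieAbelian hG
  refine LieAlgebra.is_cartan_of_zeroRootSubalgebra_eq ℂ _ _ (le_antisymm (fun X hX => ?_)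
    (LieAlgebra.le_zeroRootSubalgebra _ _ _))
  exact hT.mem_lieAlg_of_commute hG X.2 ((hT.mem_zeroRootSubalgebra hG).1 hX)

end CartanSubalgebra

/-! ### Automorphisms of semisimple Lie algebras that fix simple root vectors -/

section RootVectors

open LieAlgebra LieAlgebra.IsKilling LieModule

variable {L : Type*} [LieRing L] [LieAlgebra ℂ L] {H : LieSubalgebra ℂ L}
  [H.IsCartanSubalgebra]

lemma mem_rootSpace_of_forall_lie {γ : H → ℂ} {x : L} (h : ∀ y : H, ⁅y, x⁆ = γ y • x) :
    x ∈ rootSpace H γ :=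
  weightSpace_le_genWeightSpace L γ ((mem_weightSpace γ x).2 h)

variable [FiniteDimensional ℂ L] [IsKilling ℂ L]

lemma map_mem_rootSpace {φ : L →ₗ⁅ℂ⁆ L} (hφ : ∀ y ∈ H, φ y = y) {γ : H → ℂ} {x : L}
    (hx : x ∈ rootSpace H γ) : φ x ∈ rootSpace H γ := by
  refine mem_rootSpace_of_forall_lie fun y => ?_
  have h1 : ⁅(y : L), x⁆ = γ y • x := lie_eq_smul_of_mem_rootSpace hx y
  change ⁅(y : L), φ x⁆ = _
  rw [← map_smul, ← h1, LieHom.map_lie, hφ y y.2]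

/-- Root spaces are one-dimensional. -/
lemma exists_smul_eq_of_mem_rootSpace {γ : Weight ℂ H L} (hγ : γ.IsNonZero) {x y : L}
    (hx : x ∈ rootSpace H γ) (hx0 : x ≠ 0) (hy : y ∈ rootSpace H γ) : ∃ c : ℂ, y = c • x := by
  obtain ⟨c, hc⟩ := (finrank_eq_one_iff_of_nonzero' (⟨x, hx⟩ : rootSpace H γ)
    (fun h => hx0 (congrArg Subtype.val h))).1 (finrank_rootSpace_eq_one γ hγ) ⟨y, hy⟩
  exact ⟨c, (congrArg Subtype.val hc).symm⟩

/-- An automorphism that fixes the Cartan subalgebra and the root space of `γ` fixes the root space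
of `-γ`, because the bracket of the two is a nonzero subspace of the Cartan subalgebra. -/
lemma map_eq_of_mem_rootSpace_neg {φ : L →ₗ⁅ℂ⁆ L} (hφ : ∀ y ∈ H, φ y = y) {γ : Weight ℂ H L}
    (hγ : γ.IsNonZero) (h : ∀ x ∈ rootSpace H γ, φ x = x) {x : L}
    (hx : x ∈ rootSpace H (-γ : Weight ℂ H L)) : φ x = x := by
  obtain ⟨k, e, f, t, he, hf⟩ := exists_isSl2Triple_of_weight_isNonZero hγ
  have hk : k = coroot γ := t.h_eq_coroot hγ he hf
  have hf' : f ∈ rootSpace H (-γ : Weight ℂ H L) := by simpa using hf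
  have hneg : (-γ : Weight ℂ H L).IsNonZero := by simpa using hγ
  obtain ⟨c, hc⟩ := exists_smul_eq_of_mem_rootSpace hneg hf' t.f_ne_zero (map_mem_rootSpace hφ hf')
  have hc1 : c = 1 := by
    have h1 := congrArg φ t.lie_e_f
    rw [LieHom.map_lie, h e he, hc, lie_smul, t.lie_e_f, hφ k (hk ▸ (coroot γ).2)] at h1
    have h2 : (c - 1) • k = 0 := by rw [sub_smul, one_smul, h1, sub_self]
    rcases smul_eq_zero.1 h2 with h3 | h3
    · exact sub_eq_zero.1 h3
    · exact absurd h3 t.h_ne_zero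
  obtain ⟨d, rfl⟩ := exists_smul_eq_of_mem_rootSpace hneg hf' t.f_ne_zero hx
  rw [map_smul, hc, hc1, one_smul]

/-- The signs of `α(γ^∨)` and `γ(α^∨)` agree. -/
lemma apply_coroot_pos_comm (α γ : Weight ℂ H L) (hα : α.IsNonZero) (hγ : γ.IsNonZero) {m : ℤ}
    (hm : α (coroot γ) = m) (hm0 : 0 < m) : ∃ k : ℤ, γ (coroot α) = k ∧ 0 < k := by
  let a : H.root := ⟨α, by simpa using hα⟩
  let c : H.root := ⟨γ, by simpa using hγ⟩
  have h1 : ((rootSystem H).pairingIn ℤ a c : ℂ) = α (coroot γ) :=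
    (rootSystem H).algebraMap_pairingIn ℤ a c
  have h2 : ((rootSystem H).pairingIn ℤ c a : ℂ) = γ (coroot α) :=
    (rootSystem H).algebraMap_pairingIn ℤ c a
  refine ⟨_, h2.symm, ((rootSystem H).zero_lt_pairingIn_iff' ℤ).1 ?_⟩
  rw [hm] at h1
  have : (rootSystem H).pairingIn ℤ a c = m := by exact_mod_cast h1
  rwa [this]

/-- If `γ(α^∨) > 0` and `γ ≠ α` then a root vector of `γ` is not annihilated by a root vector of
`-α`: otherwise it would be a lowest weight vector of positive weight. -/
lemma lie_ne_zero_of_apply_coroot_pos {α γ : Weight ℂ H L} (hα : α.IsNonZero) {k : ℤ}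
    (hk : γ (coroot α) = k) (hk0 : 0 < k) {h e f x : L} (t : IsSl2Triple h e f)
    (he : e ∈ rootSpace H α) (hf : f ∈ rootSpace H (-α : H → ℂ)) (hx : x ∈ rootSpace H γ)
    (hx0 : x ≠ 0) : ⁅f, x⁆ ≠ 0 := by
  intro h0
  have hh : h = coroot α := t.h_eq_coroot hα he hf
  have hP : t.symm.HasPrimitiveVectorWith x (-(k : ℂ)) := by
    refine ⟨hx0, ?_, h0⟩
    have h1 : ⁅(coroot α : L), x⁆ = γ (coroot α) • x := lie_eq_smul_of_mem_rootSpace hx (coroot α)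
    rw [neg_lie, hh, h1, hk, neg_smul]
  obtain ⟨m, hm⟩ := hP.exists_nat
  have : -k = (m : ℤ) := by exact_mod_cast hm
  omega

/-- An automorphism that fixes the Cartan subalgebra and the root vectors of the elements of `S`
fixes the root vectors of every root that is a sum of elements of `S`. The sum can be shortened by
an element of `S` while remaining a root. -/
lemma map_eq_of_eq_sum {φ : L →ₗ⁅ℂ⁆ L} (hφ : ∀ y ∈ H, φ y = y) {S : Set (Weight ℂ H L)}
    (hS0 : ∀ α ∈ S, α.IsNonZero) (hS : ∀ α ∈ S, ∀ x ∈ rootSpace H α, φ x = x) :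
    ∀ (k : ℕ) (l : List (Weight ℂ H L)), l.length = k → (∀ α ∈ l, α ∈ S) →
      ∀ γ : Weight ℂ H L, γ.IsNonZero → (∀ y, γ y = (l.map fun α => α y).sum) →
      ∀ x ∈ rootSpace H γ, φ x = x := by
  classical
  intro k
  induction k with
  | zero =>
    intro l hl _ γ hγ hsum
    rw [List.length_eq_zero_iff] at hl
    subst hl
    exact absurd (funext fun y => by simpa using hsum y) hγ
  | succ k ih =>
    intro l hl hlS γ hγ hsum x hx
    by_cases hx0 : x = 0
    · rw [hx0, map_zero]
    -- `γ(γ^∨) = 2` is the sum of the integers `α(γ^∨)`, so one of them is positive.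
    obtain ⟨α, hαl, m, hm, hm0⟩ : ∃ α ∈ l, ∃ m : ℤ, α (coroot γ) = m ∧ 0 < m := by
      by_contra! hcon
      have h1 : ∀ l : List (Weight ℂ H L), (∀ α ∈ l, ∀ m : ℤ, α (coroot γ) = m → m ≤ 0) →
          ∃ m : ℤ, (l.map fun α => α (coroot γ)).sum = m ∧ m ≤ 0 := by
        intro l
        induction l with
        | nil => exact fun _ => ⟨0, by simp⟩
        | cons α l ihl =>
          intro h
          obtain ⟨m, hm, hm0⟩ := ihl fun β hβ => h β (List.mem_cons_of_mem _ hβ)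
          refine ⟨_ + m, ?_, add_nonpos (h α List.mem_cons_self _ (apply_coroot_eq_cast γ α)) hm0⟩
          rw [List.map_cons, List.sum_cons, hm, apply_coroot_eq_cast γ α, Int.cast_add]
      obtain ⟨m, hm, hm0⟩ := h1 l hcon
      rw [← hsum, root_apply_coroot hγ] at hm
      have : (2 : ℤ) = m := by exact_mod_cast hm
      omega
    have hα := hS0 α (hlS α hαl)
    by_cases hαγ : γ = α
    · subst hαγ
      exact hS _ (hlS _ hαl) x hx
    obtain ⟨r, hr, hr0⟩ := apply_coroot_pos_comm α γ hα hγ hm hm0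
    obtain ⟨h, e, f, t, he, hf⟩ := exists_isSl2Triple_of_weight_isNonZero hα
    have hY0 := lie_ne_zero_of_apply_coroot_pos hα hr hr0 t he hf hx hx0
    have hY : ⁅f, x⁆ ∈ rootSpace H (-α + γ : H → ℂ) :=
      lie_mem_genWeightSpace_of_mem_genWeightSpace hf hx
    let δ : Weight ℂ H L := ⟨-α + γ, fun h => hY0 (by
      have h' : rootSpace H (-α + γ : H → ℂ) = ⊥ := h
      rw [h'] at hY
      simpa using hY)⟩
    have hδ : δ.IsNonZero := by
      intro h0
      refine hαγ (Weight.ext fun y => ?_)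
      have : -α y + γ y = 0 := congrFun h0 y
      linear_combination this
    have hYφ : φ ⁅f, x⁆ = ⁅f, x⁆ := by
      refine ih (l.erase α) ?_ (fun β hβ => hlS β (List.mem_of_mem_erase hβ)) δ hδ ?_ _ hY
      · rw [List.length_erase_of_mem hαl, hl, Nat.add_sub_cancel]
      · intro y
        have h1 := hsum y
        rw [((List.perm_cons_erase hαl).map _).sum_eq, List.map_cons, List.sum_cons] at h1
        change -α y + γ y = _
        rw [h1]
        ring
    have hfφ : φ f = f := by
      refine map_eq_of_mem_rootSpace_neg hφ hα (hS α (hlS α hαl)) ?_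
      simpa using hf
    obtain ⟨c, hc⟩ := exists_smul_eq_of_mem_rootSpace hγ hx hx0 (map_mem_rootSpace hφ hx)
    rw [LieHom.map_lie, hfφ, hc, lie_smul] at hYφ
    have h2 : (c - 1) • ⁅f, x⁆ = 0 := by rw [sub_smul, one_smul, hYφ, sub_self]
    rw [hc, sub_eq_zero.1 ((smul_eq_zero.1 h2).resolve_right hY0), one_smul]

/-- An automorphism that fixes the Cartan subalgebra and the root vectors of a set of roots `S` is
trivial if every root or its negative is a sum of elements of `S`. -/
theorem map_eq_self_of_rootSpace_eq {φ : L →ₗ⁅ℂ⁆ L} (hφ : ∀ y ∈ H, φ y = y)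
    {S : Set (Weight ℂ H L)}
    (hS0 : ∀ α ∈ S, α.IsNonZero) (hS : ∀ α ∈ S, ∀ x ∈ rootSpace H α, φ x = x)
    (hgen : ∀ γ : Weight ℂ H L, γ.IsNonZero → ∃ l : List (Weight ℂ H L), (∀ α ∈ l, α ∈ S) ∧
      ((∀ y, γ y = (l.map fun α => α y).sum) ∨ (∀ y, -γ y = (l.map fun α => α y).sum))) (x : L) :
    φ x = x := by
  have h1 : ∀ γ : Weight ℂ H L, γ.IsNonZero → ∀ x ∈ rootSpace H γ, φ x = x := by
    intro γ hγ
    obtain ⟨l, hl, h | h⟩ := hgen γ hγ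
    · exact map_eq_of_eq_sum hφ hS0 hS _ l rfl hl γ hγ h
    · have hneg : (-γ : Weight ℂ H L).IsNonZero := by simpa using hγ
      have h2 := map_eq_of_eq_sum hφ hS0 hS _ l rfl hl (-γ) hneg (fun y => by simpa using h y)
      intro x hx
      exact map_eq_of_mem_rootSpace_neg hφ hneg h2 (by simpa using hx)
  let E : Submodule ℂ L := LinearMap.eqLocus (φ : L →ₗ[ℂ] L) LinearMap.id
  have h2 : (⊤ : LieSubmodule ℂ H L).toSubmodule ≤ E := by
    rw [← cartan_sup_iSup_rootSpace_eq_top (K := ℂ) (H := H), LieSubmodule.sup_toSubmodule,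
      LieSubmodule.iSup_toSubmodule]
    refine sup_le (fun y hy => hφ y hy) (iSup_le fun γ => ?_)
    rw [LieSubmodule.iSup_toSubmodule]
    exact iSup_le fun hγ x hx => h1 γ hγ x hx
  exact h2 trivial

end RootVectors

/-! ### Roots of the group and roots of the Lie algebra -/

section Roots

attribute [local instance] LieRing.ofAssociativeRing

open LieAlgebra LieAlgebra.IsKilling LieModule

variable {n : ℕ}

/-- The exponential of a matrix acts on eigenvectors of `ad X` by the exponential of the
eigenvalue. -/
lemma conj_exp_eq_smul {X Y : Matrix (Fin n) (Fin n) ℂ} {a : ℂ} (h : X * Y - Y * X = a • Y) :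
    (ZGL.exp X).mat * Y * ((ZGL.exp X)⁻¹).mat = Complex.exp a • Y := by
  let _ : NormedRing (Matrix (Fin n) (Fin n) ℂ) := Matrix.linftyOpNormedRing
  let _ : NormedAlgebra ℂ (Matrix (Fin n) (Fin n) ℂ) := Matrix.linftyOpNormedAlgebra
  let f : ℂ → Matrix (Fin n) (Fin n) ℂ := fun u =>
    Complex.exp (u * -a) • (NormedSpace.exp (u • X) * Y * NormedSpace.exp (u • (-X)))
  have hd : ∀ u, HasDerivAt f 0 u := by
    intro u
    have h1 := ((hasDerivAt_exp_smul_const (𝕂 := ℂ) X u).mul_const Y).mul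
      (hasDerivAt_exp_smul_const' (𝕂 := ℂ) (-X) u)
    have h2 : HasDerivAt (fun u : ℂ => Complex.exp (u * -a)) (Complex.exp (u * -a) * -a) u := by
      simpa using ((hasDerivAt_id u).mul_const (-a)).cexp
    refine (h2.smul h1).congr_deriv ?_
    have h3 : NormedSpace.exp (u • X) * X * Y * NormedSpace.exp (u • (-X)) +
        NormedSpace.exp (u • X) * Y * (-X * NormedSpace.exp (u • (-X))) =
        a • (NormedSpace.exp (u • X) * Y * NormedSpace.exp (u • (-X))) := by
      rw [← smul_mul_assoc, ← mul_smul_comm, ← h]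
      noncomm_ring
    refine (congrArg (fun Z => Complex.exp (u * -a) • Z + (Complex.exp (u * -a) * -a) •
      (NormedSpace.exp (u • X) * Y * NormedSpace.exp (u • (-X)))) h3).trans ?_
    rw [smul_smul, ← add_smul]
    convert! zero_smul ℂ _
    ring
  have hc : f 1 = f 0 := is_const_of_deriv_eq_zero (fun u => (hd u).differentiableAt)
    (fun u => (hd u).deriv) 1 0
  simp only [f, one_smul, zero_smul, one_mul, zero_mul, NormedSpace.exp_zero, Complex.exp_zero,
    mul_one] at hc
  rw [ZGL.mat_inv, ZGL.mat_exp, ← Matrix.exp_neg]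
  conv_rhs => rw [← hc]
  rw [smul_smul, ← Complex.exp_add, add_neg_cancel, Complex.exp_zero, one_smul]

/-- The adjoint action of an element of the group, as an automorphism of the Lie algebra. -/
def conjLieHom {G : Subgroup (ZGL n)} (hG : IsClosed (G : Set (ZGL n))) {g : ZGL n} (hg : g ∈ G) :
    lieSubalgebra hG →ₗ⁅ℂ⁆ lieSubalgebra hG where
  toFun X := ⟨g.mat * X.1 * (g⁻¹).mat,
    conj_mem_lieAlg (fun _ hh => G.mul_mem (G.mul_mem hg hh) (G.inv_mem hg)) X.2⟩
  map_add' X Y := Subtype.ext (by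
    change g.mat * (X.1 + Y.1) * (g⁻¹).mat = _
    rw [mul_add, add_mul]
    rfl)
  map_smul' c X := Subtype.ext (by
    change g.mat * (c • X.1) * (g⁻¹).mat = _
    rw [mul_smul_comm, smul_mul_assoc]
    rfl)
  map_lie' {X Y} := Subtype.ext (by
    change g.mat * (X.1 * Y.1 - Y.1 * X.1) * (g⁻¹).mat =
      (g.mat * X.1 * (g⁻¹).mat) * (g.mat * Y.1 * (g⁻¹).mat) -
      (g.mat * Y.1 * (g⁻¹).mat) * (g.mat * X.1 * (g⁻¹).mat)
    have h : ∀ A B, (g.mat * A * (g⁻¹).mat) * (g.mat * B * (g⁻¹).mat) =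
        g.mat * (A * B) * (g⁻¹).mat := by
      intro A B
      simp only [mul_assoc]
      rw [← mul_assoc (g⁻¹).mat g.mat, ZGL.mat_inv_mul, one_mul]
    rw [h, h, mul_sub, sub_mul])

variable {G T : Subgroup (ZGL n)} (hG : IsClosed (G : Set (ZGL n))) (hT : IsMaximalTorus G T)
  [(lieSubalgebraOf hG hT.isTorus.isClosed).IsCartanSubalgebra]

/-- A nontrivial character of the torus that occurs in the Lie algebra has a root of the Lie
algebra as its differential. -/
lemma exists_weight_of_char {α : T →* ℂˣ} (hα : α ≠ 1) {X : lieSubalgebra hG} (hX0 : X ≠ 0)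
    (hX : ∀ t : T, (t : ZGL n).mat * X.1 * ((t : ZGL n)⁻¹).mat = (α t : ℂ) • X.1) :
    ∃ γ : Weight ℂ (lieSubalgebraOf hG hT.isTorus.isClosed) (lieSubalgebra hG),
      γ.IsNonZero ∧ X ∈ rootSpace (lieSubalgebraOf hG hT.isTorus.isClosed) γ := by
  have h1 : ∀ Y : lieSubalgebraOf hG hT.isTorus.isClosed, ∃ c : ℂ,
      Y.1.1 * X.1 - X.1 * Y.1.1 = c • X.1 := by
    intro Y
    have := commutator_mem_of_conj_exp_mem (X := Y.1.1) (Y := X.1) (Submodule.span ℂ {X.1})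
      fun c => by
        have h := hX ⟨ZGL.exp (c • Y.1.1), exp_smul_mem hT.isTorus.isClosed Y.2 c⟩
        rw [h]
        exact Submodule.smul_mem _ _ (Submodule.mem_span_singleton_self _)
    obtain ⟨c, hc⟩ := Submodule.mem_span_singleton.1 this
    exact ⟨c, hc.symm⟩
  choose γ hγ using h1
  have h2 : X ∈ rootSpace (lieSubalgebraOf hG hT.isTorus.isClosed) γ :=
    mem_rootSpace_of_forall_lie fun Y => Subtype.ext (hγ Y)
  refine ⟨⟨γ, fun h => hX0 ?_⟩, fun h => hα ?_, h2⟩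
  · have h' : rootSpace (lieSubalgebraOf hG hT.isTorus.isClosed) γ = ⊥ := h
    rw [h'] at h2
    simpa using h2
  · ext t
    have h3 : ∀ Y ∈ lieAlg T, Commute Y X.1 := by
      intro Y hY
      have h4 := hγ ⟨⟨Y, lieAlg_mono hT.le hY⟩, hY⟩
      have h5 : γ ⟨⟨Y, lieAlg_mono hT.le hY⟩, hY⟩ = 0 := congrFun h _
      rw [h5, zero_smul] at h4
      exact sub_eq_zero.1 h4
    have h4 := hX t
    rw [commute_iff_conj_eq.1 (commute_of_commute_lieAlg hT.isTorus.isConnected h3 t.2)] at h4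
    have h5 : ((α t : ℂ) - 1) • X.1 = 0 := by rw [sub_smul, one_smul, ← h4, sub_self]
    rcases smul_eq_zero.1 h5 with h6 | h6
    · exact sub_eq_zero.1 h6
    · exact absurd (Subtype.ext h6) hX0

/-- Differentiation turns a product of characters into a sum of weights; the relation between the
two is expressed through the exponential. -/
lemma exists_weights_of_chars {simple : Set (T →* ℂˣ)}
    {S : Set (Weight ℂ (lieSubalgebraOf hG hT.isTorus.isClosed) (lieSubalgebra hG))}
    (h : ∀ α ∈ simple, ∃ γ ∈ S, ∀ (Y : lieSubalgebraOf hG hT.isTorus.isClosed) (s : T),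
      (s : ZGL n) = ZGL.exp Y.1.1 → (α s : ℂ) = Complex.exp (γ Y)) (l : List (T →* ℂˣ))
    (hl : ∀ α ∈ l, α ∈ simple) :
    ∃ l' : List (Weight ℂ (lieSubalgebraOf hG hT.isTorus.isClosed) (lieSubalgebra hG)),
      (∀ γ ∈ l', γ ∈ S) ∧ ∀ (Y : lieSubalgebraOf hG hT.isTorus.isClosed) (s : T),
      (s : ZGL n) = ZGL.exp Y.1.1 → (l.prod s : ℂ) = Complex.exp ((l'.map fun γ => γ Y).sum) := by
  induction l with
  | nil => exact ⟨[], by simp, by simp⟩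
  | cons α l ih =>
    obtain ⟨l', hl', h1⟩ := ih fun β hβ => hl β (List.mem_cons_of_mem _ hβ)
    obtain ⟨γ, hγ, h2⟩ := h α (hl α List.mem_cons_self)
    refine ⟨γ :: l', ?_, fun Y s hs => ?_⟩
    · rintro δ hδ
      rcases List.mem_cons.1 hδ with rfl | hδ
      · exact hγ
      · exact hl' δ hδ
    · rw [List.prod_cons, List.map_cons, List.sum_cons, Complex.exp_add, ← h1 Y s hs,
        ← h2 Y s hs]
      rfl

variable [IsKilling ℂ (lieSubalgebra hG)]

lemma char_exp_eq {α : T →* ℂˣ} {X : lieSubalgebra hG} (hX0 : X ≠ 0)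
    (hX : ∀ t : T, (t : ZGL n).mat * X.1 * ((t : ZGL n)⁻¹).mat = (α t : ℂ) • X.1)
    {γ : lieSubalgebraOf hG hT.isTorus.isClosed → ℂ}
    (hγ : X ∈ rootSpace (lieSubalgebraOf hG hT.isTorus.isClosed) γ)
    (Y : lieSubalgebraOf hG hT.isTorus.isClosed) {s : T} (hs : (s : ZGL n) = ZGL.exp Y.1.1) :
    (α s : ℂ) = Complex.exp (γ Y) := by
  have h1 : Y.1.1 * X.1 - X.1 * Y.1.1 = γ Y • X.1 :=
    congrArg Subtype.val (lie_eq_smul_of_mem_rootSpace hγ Y)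
  have h2 := conj_exp_eq_smul h1
  rw [← hs, hX s] at h2
  have h3 : ((α s : ℂ) - Complex.exp (γ Y)) • X.1 = 0 := by rw [sub_smul, h2, sub_self]
  exact sub_eq_zero.1 ((smul_eq_zero.1 h3).resolve_right fun h => hX0 (Subtype.ext h))

/-- Every root of the Lie algebra is the differential of a root of the group. -/
lemma exists_char_of_weight
    {γ : Weight ℂ (lieSubalgebraOf hG hT.isTorus.isClosed) (lieSubalgebra hG)}
    (hγ : γ.IsNonZero) : ∃ α ∈ rootSet G T, ∃ X : lieSubalgebra hG, X ≠ 0 ∧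
      X ∈ rootSpace (lieSubalgebraOf hG hT.isTorus.isClosed) γ ∧
      ∀ t : T, (t : ZGL n).mat * X.1 * ((t : ZGL n)⁻¹).mat = (α t : ℂ) • X.1 := by
  obtain ⟨X, hX, hX0⟩ := γ.exists_ne_zero
  have h1 : ∀ t : T, ∃ c : ℂ, (t : ZGL n).mat * X.1 * ((t : ZGL n)⁻¹).mat = c • X.1 := by
    intro t
    obtain ⟨c, hc⟩ := exists_smul_eq_of_mem_rootSpace hγ hX hX0
      (map_mem_rootSpace (φ := conjLieHom hG (hT.le t.2)) (fun Y hY => Subtype.ext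
        (conj_eq_self (fun h hh => ZGL.ext (hT.isTorus.commute t.2 hh)) hY)) hX)
    exact ⟨c, congrArg Subtype.val hc⟩
  choose f hf using h1
  have hX0' : X.1 ≠ 0 := fun h => hX0 (Subtype.ext h)
  let α : T →* ℂˣ := MonoidHom.toHomUnits
    { toFun := f
      map_one' := smul_left_injective ℂ hX0' (by
        change f 1 • X.1 = (1 : ℂ) • X.1
        rw [← hf]; simp)
      map_mul' := fun s t => smul_left_injective ℂ hX0' (by
        change f (s * t) • X.1 = (f s * f t) • X.1
        rw [← hf, mul_comm, mul_smul, ← hf s, ← smul_mul_assoc, ← mul_smul_comm, ← hf t]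
        simp [mul_assoc]) }
  have hα : ∀ t : T, (t : ZGL n).mat * X.1 * ((t : ZGL n)⁻¹).mat = (α t : ℂ) • X.1 := hf
  refine ⟨α, ⟨fun h => hγ ?_, X.1, X.2, hX0', hα⟩, X, hX0, hX, hα⟩
  funext Y
  have h2 : ∀ c : ℂ, ((Complex.exp (c * γ Y)) : ℂ) = 1 := by
    intro c
    have := char_exp_eq hG hT hX0 hα hX (c • Y)
      (s := ⟨_, exp_smul_mem hT.isTorus.isClosed Y.2 c⟩) rfl
    rw [h] at this
    have h3 : γ (c • Y) = c * γ Y := map_smul γ.toLinear c Y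
    rw [h3] at this
    simpa using this.symm
  have h3 : HasDerivAt (fun c : ℂ => Complex.exp (c * γ Y)) (γ Y) 0 := by
    simpa using ((hasDerivAt_id (0 : ℂ)).mul_const (γ Y)).cexp
  simp only [h2] at h3
  exact h3.unique (hasDerivAt_const (0 : ℂ) (1 : ℂ))

end Roots

section SimpleRoots

attribute [local instance] LieRing.ofAssociativeRing

open LieAlgebra LieAlgebra.IsKilling LieModule

variable {n : ℕ} {G T : Subgroup (ZGL n)}

lemma eq_of_forall_exp_mul_eq {a b : ℂ} (h : ∀ c : ℂ, Complex.exp (c * a) = Complex.exp (c * b)) :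
    a = b := by
  have h1 : ∀ a : ℂ, HasDerivAt (fun c : ℂ => Complex.exp (c * a)) a 0 := fun a => by
    simpa using ((hasDerivAt_id (0 : ℂ)).mul_const a).cexp
  have h2 := h1 a
  simp only [h] at h2
  exact h2.unique (h1 b)

/-- An element of the centralizer of the maximal torus that fixes a root vector of each simple root
is trivial. -/
theorem eq_one_of_conj_simple_eq (hG : IsConnectedReductive G) (hT : IsMaximalTorus G T)
    (hZ : Subgroup.center G = ⊥) {simple : Set (T →* ℂˣ)} (hs : IsRootBase G T simple)
    {w : ZGL n} (hw : w ∈ G) (hwT : ∀ t ∈ T, w * t = t * w)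
    (h : ∀ α ∈ simple, ∃ X ∈ lieAlg G, X ≠ 0 ∧
      (∀ t : T, (t : ZGL n).mat * X * ((t : ZGL n)⁻¹).mat = (α t : ℂ) • X) ∧
      w.mat * X * (w⁻¹).mat = X) : w = 1 := by
  have := isKilling_lieSubalgebra hG hZ
  have := hT.isCartanSubalgebra hG.isClosed
  let φ := conjLieHom hG.isClosed hw
  have hφ : ∀ Y ∈ lieSubalgebraOf hG.isClosed hT.isTorus.isClosed, φ Y = Y := fun Y hY =>
    Subtype.ext (conj_eq_self hwT hY)
  let S : Set (Weight ℂ (lieSubalgebraOf hG.isClosed hT.isTorus.isClosed)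
    (lieSubalgebra hG.isClosed)) := {γ | γ.IsNonZero ∧ ∀ x ∈ rootSpace _ γ, φ x = x}
  have hsimple : ∀ α ∈ simple, ∃ γ ∈ S,
      ∀ (Y : lieSubalgebraOf hG.isClosed hT.isTorus.isClosed) (s : T),
      (s : ZGL n) = ZGL.exp Y.1.1 → (α s : ℂ) = Complex.exp (γ Y) := by
    intro α hα
    obtain ⟨X, hX, hX0, hXT, hXw⟩ := h α hα
    have hX0' : (⟨X, hX⟩ : lieSubalgebra hG.isClosed) ≠ 0 := fun h => hX0 (congrArg Subtype.val h)
    obtain ⟨γ, hγ, hXγ⟩ := exists_weight_of_char hG.isClosed hT (hs.subset hα).1 hX0' hXT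
    refine ⟨γ, ⟨hγ, fun x hx => ?_⟩, fun Y s hs => char_exp_eq hG.isClosed hT hX0' hXT hXγ Y hs⟩
    obtain ⟨c, rfl⟩ := exists_smul_eq_of_mem_rootSpace hγ hXγ hX0' hx
    rw [map_smul]
    congr 1
    exact Subtype.ext hXw
  -- Every root is the differential of a character in the root system of `G`, and this character or
  -- its inverse is a product of simple ones.
  have hφ1 := map_eq_self_of_rootSpace_eq hφ (S := S) (fun γ hγ => hγ.1) (fun γ hγ => hγ.2) (by
    intro γ hγ
    obtain ⟨α, hα, X, hX0, hXγ, hXT⟩ := exists_char_of_weight hG.isClosed hT hγ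
    have hd : ∀ (Y : lieSubalgebraOf hG.isClosed hT.isTorus.isClosed) (s : T),
      (s : ZGL n) = ZGL.exp Y.1.1 → (α s : ℂ) = Complex.exp (γ Y) := fun Y s hs =>
        char_exp_eq hG.isClosed hT hX0 hXT hXγ Y hs
    have hmul : ∀ (γ : Weight ℂ (lieSubalgebraOf hG.isClosed hT.isTorus.isClosed)
        (lieSubalgebra hG.isClosed)) (c : ℂ) (Y), γ (c • Y) = c * γ Y :=
      fun γ c Y => map_smul γ.toLinear c Y
    have hsum : ∀ (l : List (Weight ℂ (lieSubalgebraOf hG.isClosed hT.isTorus.isClosed)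
        (lieSubalgebra hG.isClosed))) (c : ℂ) (Y),
        (l.map fun γ => γ (c • Y)).sum = c * (l.map fun γ => γ Y).sum := by
      intro l c Y
      simp only [hmul, List.sum_map_mul_left]
    rcases hs.mem_or_inv_mem α hα with h1 | h1
    · obtain ⟨l, hl, hlα⟩ := Submonoid.exists_list_of_mem_closure h1
      obtain ⟨l', hl', h2⟩ := exists_weights_of_chars hG.isClosed hT hsimple l hl
      refine ⟨l', hl', Or.inl fun Y => eq_of_forall_exp_mul_eq fun c => ?_⟩
      rw [← hmul, ← hsum, ← h2 (c • Y) ⟨_, exp_smul_mem hT.isTorus.isClosed Y.2 c⟩ rfl, hlα,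
        ← hd (c • Y) ⟨_, exp_smul_mem hT.isTorus.isClosed Y.2 c⟩ rfl]
    · obtain ⟨l, hl, hlα⟩ := Submonoid.exists_list_of_mem_closure h1
      obtain ⟨l', hl', h2⟩ := exists_weights_of_chars hG.isClosed hT hsimple l hl
      refine ⟨l', hl', Or.inr fun Y => eq_of_forall_exp_mul_eq fun c => ?_⟩
      rw [mul_neg, ← hmul, ← hsum, ← h2 (c • Y) ⟨_, exp_smul_mem hT.isTorus.isClosed Y.2 c⟩ rfl,
        hlα, Complex.exp_neg, ← hd (c • Y) ⟨_, exp_smul_mem hT.isTorus.isClosed Y.2 c⟩ rfl]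
      simp)
  have hcen : (⟨w, hw⟩ : G) ∈ Subgroup.center G := by
    refine Subgroup.mem_center_iff.2 fun g => Subtype.ext ?_
    exact commute_of_conj_eq_self hG.isConnected
      (fun X hX => congrArg Subtype.val (hφ1 ⟨X, hX⟩)) g.2
  rw [hZ, Subgroup.mem_bot] at hcen
  exact congrArg Subtype.val hcen

/-- The centralizer of a maximal torus acts on root vectors by scalars, as root spaces are
one-dimensional. -/
lemma exists_conj_eq_smul (hG : IsConnectedReductive G) (hT : IsMaximalTorus G T)
    (hZ : Subgroup.center G = ⊥) {α : T →* ℂˣ} (hα : α ≠ 1) {X : Matrix (Fin n) (Fin n) ℂ}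
    (hX : X ∈ lieAlg G) (hX0 : X ≠ 0)
    (hXT : ∀ t : T, (t : ZGL n).mat * X * ((t : ZGL n)⁻¹).mat = (α t : ℂ) • X)
    {w : ZGL n} (hw : w ∈ G) (hwT : ∀ t ∈ T, w * t = t * w) :
    ∃ c : ℂ, c ≠ 0 ∧ w.mat * X * (w⁻¹).mat = c • X := by
  have := isKilling_lieSubalgebra hG hZ
  have := hT.isCartanSubalgebra hG.isClosed
  have hX0' : (⟨X, hX⟩ : lieSubalgebra hG.isClosed) ≠ 0 := fun h => hX0 (congrArg Subtype.val h)
  obtain ⟨γ, hγ, hXγ⟩ := exists_weight_of_char hG.isClosed hT hα hX0' hXT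
  obtain ⟨c, hc⟩ := exists_smul_eq_of_mem_rootSpace hγ hXγ hX0'
    (map_mem_rootSpace (φ := conjLieHom hG.isClosed hw) (fun Y hY => Subtype.ext
      (conj_eq_self hwT hY)) hXγ)
  have hc' : w.mat * X * (w⁻¹).mat = c • X := congrArg Subtype.val hc
  refine ⟨c, fun h => hX0 ?_, hc'⟩
  rw [h, zero_smul] at hc'
  have h1 : (w⁻¹).mat * (w.mat * X * (w⁻¹).mat) * w.mat = X := by
    simp only [mul_assoc, ZGL.mat_inv_mul, mul_one]
    rw [← mul_assoc, ZGL.mat_inv_mul, one_mul]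
  rw [← h1, hc', mul_zero, zero_mul]

end SimpleRoots

/-! ### Centres of standard Levi subgroups -/

section Levi

variable {n : ℕ} {G T : Subgroup (ZGL n)} {simple : Set (T →* ℂˣ)}

/-- In a group with trivial centre the simple roots separate the points of the maximal torus. -/
lemma eq_one_of_simple_eq_one (hG : IsConnectedReductive G) (hT : IsMaximalTorus G T)
    (hZ : Subgroup.center G = ⊥) (hs : IsRootBase G T simple) (t : T)
    (ht : ∀ α ∈ simple, α t = 1) : t = 1 := by
  refine Subtype.ext (eq_one_of_conj_simple_eq hG hT hZ hs (hT.le t.2)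
    (fun s hs => ZGL.ext (hT.isTorus.commute t.2 hs)) fun α hα => ?_)
  obtain ⟨-, X, hX, hX0, hXT⟩ := hs.subset hα
  refine ⟨X, hX, hX0, hXT, ?_⟩
  rw [hXT, ht α hα, Units.val_one, one_smul]

/-- One-parameter subgroups of the torus realise arbitrary values on the simple roots. -/
lemma exists_exp_of_simple (hG : IsConnectedReductive G) (hT : IsMaximalTorus G T)
    (hZ : Subgroup.center G = ⊥) (hs : IsRootBase G T simple) (l : (T →* ℂˣ) → ℂ) :
    ∃ H : Matrix (Fin n) (Fin n) ℂ, ∀ c : ℂ, ∃ t : T, (t : ZGL n) = ZGL.exp (c • H) ∧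
      ∀ α ∈ simple, (α t : ℂ) = Complex.exp (c * l α) := by
  obtain ⟨P, hP⟩ := hT.isTorus.diagonalizable
  refine exists_oneParameterSubgroup hT.isTorus.isClosed hP (fun α hα => ?_) hs.linearIndep
    (eq_one_of_simple_eq_one hG hT hZ hs) l
  obtain ⟨-, X, -, hX0, hX⟩ := hs.subset hα
  exact mem_charLattice_of_weight hP hX0 hX

/-- A maximal torus of a group with trivial centre is its own centralizer: an element of the
centralizer acts on the simple root vectors as some element of the torus does. -/
lemma mem_of_commute_torus (hG : IsConnectedReductive G) (hT : IsMaximalTorus G T)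
    (hZ : Subgroup.center G = ⊥) (hs : IsRootBase G T simple) {z : ZGL n} (hz : z ∈ G)
    (hzT : ∀ t ∈ T, z * t = t * z) : z ∈ T := by
  classical
  have h1 : ∀ α ∈ simple, ∃ X ∈ lieAlg G, X ≠ 0 ∧
      (∀ t : T, (t : ZGL n).mat * X * ((t : ZGL n)⁻¹).mat = (α t : ℂ) • X) ∧
      ∃ c : ℂ, c ≠ 0 ∧ z.mat * X * (z⁻¹).mat = c • X := by
    intro α hα
    obtain ⟨hα1, X, hX, hX0, hXT⟩ := hs.subset hα
    exact ⟨X, hX, hX0, hXT, exists_conj_eq_smul hG hT hZ hα1 hX hX0 hXT hz hzT⟩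
  choose! X hX hX0 hXT c hc0 hcX using h1
  obtain ⟨H, hH⟩ := exists_exp_of_simple hG hT hZ hs (fun α => Complex.log (c α))
  obtain ⟨t, -, ht⟩ := hH 1
  have hzt : z * (t : ZGL n)⁻¹ = 1 := by
    refine eq_one_of_conj_simple_eq hG hT hZ hs (G.mul_mem hz (G.inv_mem (hT.le t.2)))
      (fun s hs => ?_) fun α hα => ⟨X α, hX α hα, hX0 α hα, hXT α hα, ?_⟩
    · have h2 : (t : ZGL n)⁻¹ * s = s * (t : ZGL n)⁻¹ :=
        ZGL.ext (hT.isTorus.commute (T.inv_mem t.2) hs)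
      rw [mul_assoc, h2, ← mul_assoc, hzT s hs, mul_assoc]
    · have h2 := hXT α hα t⁻¹
      have h3 : (α t : ℂ) = c α := by
        rw [ht α hα, one_mul, Complex.exp_log (hc0 α hα)]
      have h4 : (z * (t : ZGL n)⁻¹).mat * X α * ((z * (t : ZGL n)⁻¹)⁻¹).mat =
          z.mat * (((t⁻¹ : T) : ZGL n).mat * X α * (((t⁻¹ : T) : ZGL n)⁻¹).mat) * (z⁻¹).mat := by
        simp [mul_assoc]
      rw [h4, h2, mul_smul_comm, smul_mul_assoc, hcX α hα, smul_smul, map_inv,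
        Units.val_inv_eq_inv_val, h3, inv_mul_cancel₀ (hc0 α hα), one_smul]
  rw [mul_inv_eq_one.1 hzt]
  exact t.2

variable {Delta : Set (T →* ℂˣ)}

lemma mem_iInf_ker {t : T} : t ∈ (⨅ α ∈ Delta, MonoidHom.ker α : Subgroup T) ↔
    ∀ α ∈ Delta, α t = 1 := by
  simp [Subgroup.mem_iInf, MonoidHom.mem_ker]

/-- Intersections of kernels of simple roots are connected: their elements lie on one-parameter
subgroups. -/
lemma isConnected_iInf_ker (hG : IsConnectedReductive G) (hT : IsMaximalTorus G T)
    (hZ : Subgroup.center G = ⊥) (hs : IsRootBase G T simple) (hD : Delta ⊆ simple) :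
    IsConnected (((⨅ α ∈ Delta, MonoidHom.ker α : Subgroup T).map T.subtype : Subgroup (ZGL n)) :
      Set (ZGL n)) := by
  refine ⟨⟨1, Subgroup.one_mem _⟩, isPreconnected_of_forall 1 ?_⟩
  rintro _ ⟨t, ht, rfl⟩
  obtain ⟨H, hH⟩ := exists_exp_of_simple hG hT hZ hs (fun α => Complex.log (α t))
  refine ⟨Set.range fun c : ℂ => ZGL.exp (c • H), ?_, ⟨0, by simp⟩, ⟨1, ?_⟩,
    isPreconnected_range (continuous_exp_smul H)⟩
  · rintro _ ⟨c, rfl⟩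
    obtain ⟨s, hs1, hs2⟩ := hH c
    refine ⟨s, mem_iInf_ker.2 fun α hα => Units.ext ?_, hs1⟩
    rw [hs2 α (hD hα), mem_iInf_ker.1 ht α hα]
    simp
  · obtain ⟨s, hs1, hs2⟩ := hH 1
    have h1 : s * t⁻¹ = 1 := by
      refine eq_one_of_simple_eq_one hG hT hZ hs _ fun α hα => ?_
      rw [map_mul, map_inv, mul_inv_eq_one]
      refine Units.ext ?_
      rw [hs2 α hα, one_mul, Complex.exp_log (Units.ne_zero _)]
    rw [mul_inv_eq_one.1 h1] at hs1
    exact hs1.symm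

lemma leviTorus_eq (hG : IsConnectedReductive G) (hT : IsMaximalTorus G T)
    (hZ : Subgroup.center G = ⊥) (hs : IsRootBase G T simple) (hD : Delta ⊆ simple) :
    leviTorus T Delta = (⨅ α ∈ Delta, MonoidHom.ker α : Subgroup T).map T.subtype := by
  set K : Subgroup T := ⨅ α ∈ Delta, MonoidHom.ker α with hK
  have h1 : IsPreconnected (Set.univ : Set K) := by
    have hi : Topology.IsInducing (fun k : K => ((k : T) : ZGL n)) :=
      Topology.IsInducing.subtypeVal.comp Topology.IsInducing.subtypeVal
    refine hi.isPreconnected_image.1 ?_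
    convert! (isConnected_iInf_ker hG hT hZ hs hD).isPreconnected using 1
    ext g
    constructor
    · rintro ⟨k, -, rfl⟩
      exact ⟨k, k.2, rfl⟩
    · rintro ⟨k, hk, rfl⟩
      exact ⟨⟨k, hk⟩, trivial, rfl⟩
  have h2 : identityComponent K = ⊤ := by
    rw [eq_top_iff]
    intro k _
    exact h1.subset_connectedComponent (x := (1 : K)) trivial trivial
  change ((identityComponent K).map K.subtype).map T.subtype = _
  rw [h2, ← MonoidHom.range_eq_map, Subgroup.range_subtype]

/-- The centre of a standard Levi subgroup is the torus that defines it. -/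
lemma centerIn_standardLevi (hG : IsConnectedReductive G) (hT : IsMaximalTorus G T)
    (hZ : Subgroup.center G = ⊥) (hs : IsRootBase G T simple) (hD : Delta ⊆ simple) :
    centerIn (standardLevi G T Delta) =
      (⨅ α ∈ Delta, MonoidHom.ker α : Subgroup T).map T.subtype := by
  have hlevi := leviTorus_eq hG hT hZ hs hD
  have hTL : T ≤ standardLevi G T Delta := by
    refine le_inf hT.le fun t ht => ?_
    rw [Subgroup.mem_centralizer_iff]
    rw [hlevi]
    rintro _ ⟨s, -, rfl⟩
    exact ZGL.ext (hT.isTorus.commute s.2 ht)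
  refine le_antisymm ?_ ?_
  · rintro _ ⟨z, hz, rfl⟩
    have hcomm : ∀ g ∈ standardLevi G T Delta, g * (z : ZGL n) = z * g := fun g hg =>
      congrArg Subtype.val (Subgroup.mem_center_iff.1 hz ⟨g, hg⟩)
    have hzT : (z : ZGL n) ∈ T := mem_of_commute_torus hG hT hZ hs z.2.1
      fun t ht => (hcomm t (hTL ht)).symm
    refine ⟨⟨z, hzT⟩, mem_iInf_ker.2 fun α hα => ?_, rfl⟩
    obtain ⟨-, X, hX, hX0, hXT⟩ := hs.subset (hD hα)
    -- the root vector of `α` lies in the Lie algebra of the Levi subgroup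
    have hXL : ∀ c : ℂ, ZGL.exp (c • X) ∈ standardLevi G T Delta := by
      intro c
      refine ⟨exp_smul_mem hG.isClosed hX c, ?_⟩
      change _ ∈ Subgroup.centralizer _
      rw [Subgroup.mem_centralizer_iff, hlevi]
      rintro _ ⟨s, hs, rfl⟩
      have h1 := hXT s
      rw [mem_iInf_ker.1 hs α hα, Units.val_one, one_smul] at h1
      exact ZGL.ext (ZGL.mat_exp_commute ((commute_iff_conj_eq.2 h1).symm.smul_left c)).symm
    have h1 : Commute X (z : ZGL n).mat := commute_of_commute_exp fun c =>
      congrArg ZGL.mat (hcomm _ (hXL c))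
    have h2 := hXT ⟨z, hzT⟩
    rw [commute_iff_conj_eq.1 h1.symm] at h2
    have h3 : ((α ⟨z, hzT⟩ : ℂ) - 1) • X = 0 := by rw [sub_smul, one_smul, ← h2, sub_self]
    exact Units.ext (sub_eq_zero.1 ((smul_eq_zero.1 h3).resolve_right hX0))
  · rintro _ ⟨t, ht, rfl⟩
    refine ⟨⟨t, hTL t.2⟩, Subgroup.mem_center_iff.2 fun g => Subtype.ext ?_, rfl⟩
    have h1 := Subgroup.mem_centralizer_iff.1 g.2.2 t
    rw [hlevi] at h1
    exact (h1 ⟨t, ht, rfl⟩).symm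

/-- The centre of a standard Levi subgroup of a group with trivial centre is connected. -/
theorem isConnected_center_standardLevi (hG : IsConnectedReductive G) (hT : IsMaximalTorus G T)
    (hZ : Subgroup.center G = ⊥) (hs : IsRootBase G T simple) (hD : Delta ⊆ simple) :
    IsConnected (Subgroup.center (standardLevi G T Delta) : Set (standardLevi G T Delta)) := by
  refine ⟨⟨1, Subgroup.one_mem _⟩, Topology.IsInducing.subtypeVal.isPreconnected_image.1 ?_⟩
  have h := (isConnected_iInf_ker hG hT hZ hs hD).isPreconnected
  rw [← centerIn_standardLevi hG hT hZ hs hD] at h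
  exact h

lemma centerIn_le_standardLevi (hT : T ≤ G) : centerIn G ≤ standardLevi G T Delta := by
  rintro _ ⟨z, hz, rfl⟩
  refine ⟨z.2, Subgroup.mem_centralizer_iff.2 ?_⟩
  rintro _ ⟨s, -, rfl⟩
  exact congrArg Subtype.val (Subgroup.mem_center_iff.1 hz ⟨s, hT s.2⟩)

lemma center_eq_bot_of_centerIn_inf_eq_bot (hT : T ≤ G)
    (h : centerIn G ⊓ standardLevi G T Delta = ⊥) : Subgroup.center G = ⊥ := by
  rw [inf_eq_left.2 (centerIn_le_standardLevi hT)] at h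
  exact (Subgroup.map_eq_bot_iff_of_injective _ G.subtype_injective).1 h

end Levi

/-! ### Coadjoint orbits of a group and of its adjoint quotient -/

section Components

/-- A quotient homomorphism with connected kernel induces an isomorphism on component groups. -/
lemma nonempty_componentGroup_mulEquiv {A B : Type*} [Group A] [TopologicalSpace A]
    [SeparatelyContinuousMul A] [Group B] [TopologicalSpace B] [SeparatelyContinuousMul B]
    (f : A →* B) (hf : Topology.IsQuotientMap f) (hker : IsConnected (f.ker : Set A)) :
    Nonempty ((A ⧸ identityComponent A) ≃* (B ⧸ identityComponent B)) := by
  have hfib : ∀ b, IsConnected (f ⁻¹' {b}) := by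
    intro b
    obtain ⟨a, rfl⟩ := hf.surjective b
    convert! hker.image (fun x => a * x) (continuous_const_mul a).continuousOn using 1
    ext x
    simp only [Set.mem_preimage, Set.mem_singleton_iff, Set.mem_image, SetLike.mem_coe,
      MonoidHom.mem_ker]
    constructor
    · intro h
      exact ⟨a⁻¹ * x, by simp [h], by simp⟩
    · rintro ⟨y, hy, rfl⟩
      simp [hy]
  have hpre := hf.preimage_connectedComponent hfib 1
  rw [map_one] at hpre
  let F := (QuotientGroup.mk' (identityComponent B)).comp f
  have hF : Function.Surjective F := (QuotientGroup.mk'_surjective _).comp hf.surjective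
  have hFk : F.ker = identityComponent A := by
    ext x
    rw [MonoidHom.mem_ker]
    change ((f x : B) : B ⧸ identityComponent B) = 1 ↔ x ∈ connectedComponent (1 : A)
    rw [QuotientGroup.eq_one_iff, ← hpre]
    rfl
  exact ⟨(QuotientGroup.quotientMulEquivOfEq hFk.symm).trans
    (QuotientGroup.quotientKerEquivOfSurjective F hF)⟩

/-- The equivariant fundamental group does not depend on the choice of a point in the orbit. -/
lemma nonempty_equivariantFundamentalGroup_mulEquiv {A V : Type*} [Group A] [TopologicalSpace A]
    [SeparatelyContinuousMul A] [AddCommGroup V] [Module ℂ V] (ρ : Representation ℂ A V)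
    {e e' : V} {a : A} (h : e' = ρ a e) :
    Nonempty (EquivariantFundamentalGroup ρ e ≃* EquivariantFundamentalGroup ρ e') := by
  have hmul : ∀ (x y : A) (v : V), ρ (x * y) v = ρ x (ρ y v) := fun x y v => by
    rw [map_mul, Module.End.mul_apply]
  have hinv : ρ a⁻¹ e' = e := by
    rw [h, ← hmul, inv_mul_cancel, map_one, Module.End.one_apply]
  have h1 : ∀ x : A, x ∈ vectorStabilizer ρ e → a * x * a⁻¹ ∈ vectorStabilizer ρ e' := by
    intro x hx
    change ρ (a * x * a⁻¹) e' = e'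
    rw [hmul, hmul, hinv, show ρ x e = e from hx, h]
  have h2 : ∀ x : A, x ∈ vectorStabilizer ρ e' → a⁻¹ * x * a ∈ vectorStabilizer ρ e := by
    intro x hx
    change ρ (a⁻¹ * x * a) e = e
    rw [hmul, hmul, ← h, show ρ x e' = e' from hx, hinv]
  let f : vectorStabilizer ρ e ≃* vectorStabilizer ρ e' :=
    { toFun := fun x => ⟨a * x * a⁻¹, h1 x x.2⟩
      invFun := fun x => ⟨a⁻¹ * x * a, h2 x x.2⟩
      left_inv := fun x => Subtype.ext (by simp [mul_assoc])
      right_inv := fun x => Subtype.ext (by simp [mul_assoc])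
      map_mul' := fun x y => Subtype.ext (by simp [mul_assoc]) }
  have hf : Continuous f := Continuous.subtype_mk ((continuous_mul_const a⁻¹).comp
    ((continuous_const_mul a).comp continuous_subtype_val)) _
  have hf' : Continuous f.symm := Continuous.subtype_mk ((continuous_mul_const a).comp
    ((continuous_const_mul a⁻¹).comp continuous_subtype_val)) _
  refine nonempty_componentGroup_mulEquiv f.toMonoidHom
    (Topology.IsQuotientMap.of_inverse hf' hf f.right_inv) ?_
  have : f.toMonoidHom.ker = ⊥ := (MonoidHom.ker_eq_bot_iff _).2 f.injective
  rw [this]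
  exact isConnected_singleton

end Components

section Orbits

variable {n : ℕ} (H : Subgroup (ZGL n))

/-- Pulling back along the projection to `Lie(H_ad)` is equivariant. -/
lemma coadjointRepAd_comp_mkQ (g : H) (e : Module.Dual ℂ (AdLie H)) :
    (coadjointRepAd H (g : AdQuotient H) e) ∘ₗ (centerLie H).mkQ =
      coadjointRep H g (e ∘ₗ (centerLie H).mkQ) := by
  ext X
  rfl

lemma mkQ_comp_injective {e e' : Module.Dual ℂ (AdLie H)}
    (h : e ∘ₗ (centerLie H).mkQ = e' ∘ₗ (centerLie H).mkQ) : e = e' :=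
  Submodule.linearMap_qext _ h

lemma adjointRep_eq_self {X : lieAlg H} (hX : X ∈ centerLie H) (g : H) :
    adjointRep H g X = X := by
  refine Subtype.ext (conj_eq_self (H := centerIn H) ?_ hX)
  rintro _ ⟨z, hz, rfl⟩
  exact congrArg Subtype.val (Subgroup.mem_center_iff.1 hz g)

/-- The evaluation at a vector is continuous for the Zariski topology on a dual space. -/
lemma isClosed_setOf_apply_eq {V : Type*} [AddCommGroup V] [Module ℂ V] (v : V) (c : ℂ) :
    @IsClosed _ (zariskiDual V) {χ : Module.Dual ℂ V | χ v = c} := by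
  let _ := zariskiDual V
  let _ := zariskiTopology V
  rw [← isOpen_compl_iff]
  refine isOpen_induced_iff.2 ⟨{x | eval x (MvPolynomial.X v - C c) ≠ 0},
    TopologicalSpace.isOpen_generateFrom_of_mem ⟨_, rfl⟩, ?_⟩
  ext χ
  simp [sub_eq_zero]

/-- A nilpotent orbit consists of functionals that vanish on the Lie algebra of the centre: there
they are constant along the orbit. -/
lemma IsNilpotentOrbit.apply_eq_zero {O : Set (Module.Dual ℂ (lieAlg H))}
    (hO : IsNilpotentOrbit (coadjointRep H) O) {e : Module.Dual ℂ (lieAlg H)} (he : e ∈ O)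
    {X : lieAlg H} (hX : X ∈ centerLie H) : e X = 0 := by
  obtain ⟨⟨e0, rfl⟩, h0⟩ := hO
  have h1 : ∀ χ ∈ Set.range fun a : H => coadjointRep H a e0, χ X = e0 X := by
    rintro _ ⟨a, rfl⟩
    change e0 (adjointRep H a⁻¹ X) = e0 X
    rw [adjointRep_eq_self H hX]
  have h2 : (0 : Module.Dual ℂ (lieAlg H)) ∈ {χ : Module.Dual ℂ (lieAlg H) | χ X = e0 X} :=
    (@closure_minimal _ (zariskiDual _) _ _ h1 (isClosed_setOf_apply_eq X (e0 X))) h0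
  rw [h1 e he]
  exact h2.symm

/-- The dual of a quotient space carries the subspace topology of the dual. -/
lemma zariskiDual_quotient {V : Type*} [AddCommGroup V] [Module ℂ V] (W : Submodule ℂ V) :
    zariskiDual (V ⧸ W) = TopologicalSpace.induced
      (fun χ : Module.Dual ℂ (V ⧸ W) => χ ∘ₗ W.mkQ) (zariskiDual V) := by
  have h1 : zariskiTopology (V ⧸ W) = TopologicalSpace.induced
      (fun (x : V ⧸ W → ℂ) (v : V) => x (W.mkQ v)) (zariskiTopology V) := by
    rw [zariskiTopology, zariskiTopology, induced_generateFrom_eq]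
    congr 1
    ext U
    constructor
    · rintro ⟨p, rfl⟩
      obtain ⟨q, rfl⟩ := rename_surjective W.mkQ W.mkQ_surjective p
      refine ⟨_, ⟨q, rfl⟩, ?_⟩
      ext x
      simp only [Set.mem_preimage, Set.mem_ofPred_eq, eval_rename]
      rfl
    · rintro ⟨_, ⟨q, rfl⟩, rfl⟩
      refine ⟨rename W.mkQ q, ?_⟩
      ext x
      simp only [Set.mem_preimage, Set.mem_ofPred_eq, eval_rename]
      rfl
  rw [zariskiDual, zariskiDual, h1, induced_compose, induced_compose]
  rfl

/-- A nilpotent orbit of `H` is a nilpotent orbit of the adjoint quotient. -/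
lemma IsNilpotentOrbit.adOrbit {O : Set (Module.Dual ℂ (lieAlg H))}
    (hO : IsNilpotentOrbit (coadjointRep H) O) :
    IsNilpotentOrbit (coadjointRepAd H) (adOrbit H O) := by
  have hlift : ∀ e ∈ O, ∃ e' : Module.Dual ℂ (AdLie H), e' ∘ₗ (centerLie H).mkQ = e := fun e he =>
    ⟨(centerLie H).liftQ e fun X hX => hO.apply_eq_zero H he hX, Submodule.liftQ_mkQ _ _ _⟩
  obtain ⟨e, rfl⟩ := hO.1
  obtain ⟨e', he'⟩ := hlift e ⟨1, by simp⟩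
  refine ⟨⟨e', ?_⟩, ?_⟩
  · ext χ
    constructor
    · rintro ⟨a, ha⟩
      refine ⟨(a : AdQuotient H), mkQ_comp_injective H ?_⟩
      change coadjointRepAd H (a : AdQuotient H) e' ∘ₗ _ = _
      rw [coadjointRepAd_comp_mkQ, he']
      exact ha
    · rintro ⟨a, rfl⟩
      induction a using QuotientGroup.induction_on with
      | H a =>
        refine ⟨a, ?_⟩
        change _ = coadjointRepAd H (a : AdQuotient H) e' ∘ₗ _
        rw [coadjointRepAd_comp_mkQ, he']
  · rw [zariskiDual_quotient]
    let _ := zariskiDual (lieAlg H)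
    rw [closure_induced]
    convert! hO.2 using 2
    ext χ
    constructor
    · rintro ⟨χ', hχ', rfl⟩
      exact hχ'
    · intro hχ
      obtain ⟨χ', rfl⟩ := hlift χ hχ
      exact ⟨χ', hχ, rfl⟩

/-- The projection from the stabiliser in `H` to the stabiliser in the adjoint quotient is a quotient
map whose kernel is the centre, so a connected centre does not contribute to the component group. -/
lemma nonempty_equivariantFundamentalGroup_ad_mulEquiv
    (hZ : IsConnected (Subgroup.center H : Set H)) (e : Module.Dual ℂ (AdLie H)) :
    Nonempty (EquivariantFundamentalGroup (coadjointRep H) (e ∘ₗ (centerLie H).mkQ) ≃*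
      EquivariantFundamentalGroup (coadjointRepAd H) e) := by
  set e₁ := e ∘ₗ (centerLie H).mkQ with he₁
  have hmem : ∀ a : H, a ∈ vectorStabilizer (coadjointRep H) e₁ ↔
      (a : AdQuotient H) ∈ vectorStabilizer (coadjointRepAd H) e := by
    intro a
    change coadjointRep H a e₁ = e₁ ↔ coadjointRepAd H (a : AdQuotient H) e = e
    rw [he₁, ← coadjointRepAd_comp_mkQ]
    exact ⟨fun h => mkQ_comp_injective H h, fun h => by rw [h]⟩
  let f : vectorStabilizer (coadjointRep H) e₁ →* vectorStabilizer (coadjointRepAd H) e :=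
    ((QuotientGroup.mk' (Subgroup.center H)).comp (Subgroup.subtype _)).codRestrict _
      fun a => (hmem a).1 a.2
  have hcont : Continuous f := Continuous.subtype_mk
    (QuotientGroup.continuous_mk.comp continuous_subtype_val) _
  have hsurj : Function.Surjective f := by
    rintro ⟨b, hb⟩
    obtain ⟨a, rfl⟩ := QuotientGroup.mk_surjective b
    exact ⟨⟨a, (hmem a).2 hb⟩, rfl⟩
  have hopen : IsOpenMap f := by
    rintro _ ⟨U, hU, rfl⟩
    refine ⟨((↑) : H → AdQuotient H) '' U, QuotientGroup.isOpenMap_coe U hU, ?_⟩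
    ext ⟨b, hb⟩
    constructor
    · rintro ⟨a, ha, rfl⟩
      exact ⟨⟨a, (hmem a).2 hb⟩, ha, rfl⟩
    · rintro ⟨a, ha, hab⟩
      exact ⟨a, ha, congrArg Subtype.val hab⟩
  refine nonempty_componentGroup_mulEquiv f (hopen.isQuotientMap hcont hsurj) ?_
  refine ⟨⟨1, Subgroup.one_mem _⟩, Topology.IsInducing.subtypeVal.isPreconnected_image.1 ?_⟩
  convert! hZ.isPreconnected using 1
  have hker : ∀ a, a ∈ f.ker ↔ (a : H) ∈ Subgroup.center H := by
    intro a
    rw [MonoidHom.mem_ker, ← QuotientGroup.eq_one_iff (N := Subgroup.center H)]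
    exact Subtype.ext_iff
  ext a
  constructor
  · rintro ⟨a, ha, rfl⟩
    exact (hker a).1 ha
  · intro ha
    have h1 : (a : AdQuotient H) = 1 := (QuotientGroup.eq_one_iff a).2 ha
    have h2 : a ∈ vectorStabilizer (coadjointRep H) e₁ :=
      (hmem a).2 (h1 ▸ Subgroup.one_mem _)
    exact ⟨⟨a, h2⟩, (hker ⟨a, h2⟩).2 ha, rfl⟩

/-- If the centre of `H` is connected then nilpotent orbits have the same fundamental groups for `H`
and for its adjoint quotient. -/
theorem nilpotentOrbit_fundamentalGroup_ad (hZ : IsConnected (Subgroup.center H : Set H))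
    {O : Set (Module.Dual ℂ (lieAlg H))} (hO : IsNilpotentOrbit (coadjointRep H) O) :
    IsNilpotentOrbit (coadjointRepAd H) (adOrbit H O) ∧
      ∀ e ∈ O, ∀ e' ∈ adOrbit H O,
        Nonempty (EquivariantFundamentalGroup (coadjointRep H) e ≃*
          EquivariantFundamentalGroup (coadjointRepAd H) e') := by
  refine ⟨hO.adOrbit, fun e he e' he' => ?_⟩
  obtain ⟨e0, rfl⟩ := hO.1
  obtain ⟨a, rfl⟩ := he
  obtain ⟨b, hb⟩ := he'
  obtain ⟨f⟩ := nonempty_equivariantFundamentalGroup_ad_mulEquiv H hZ e'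
  obtain ⟨g⟩ := nonempty_equivariantFundamentalGroup_mulEquiv (coadjointRep H)
    (e := coadjointRep H a e0) (e' := e' ∘ₗ (centerLie H).mkQ) (a := b * a⁻¹) (by
      rw [← hb, ← Module.End.mul_apply, ← map_mul, inv_mul_cancel_right])
  exact ⟨g.trans f⟩

end Orbits

theorem mainTheorem6 {n : ℕ} (G T : Subgroup (ZGL n)) (hG : IsConnectedReductive G)
    (hT : IsMaximalTorus G T) (simple : Set (T →* ℂˣ))
    (hsimple : IsRootBase G T simple) :
    (Subgroup.center G = ⊥ → ∀ Delta ⊆ simple, ∀ L : Subgroup (ZGL n), L = standardLevi G T Delta →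
      IsConnected (Subgroup.center L : Set L) ∧
      ∀ O : Set (Module.Dual ℂ (lieAlg L)), IsNilpotentOrbit (coadjointRep L) O →
        IsNilpotentOrbit (coadjointRepAd L) (adOrbit L O) ∧
        ∀ e ∈ O, ∀ e' ∈ adOrbit L O,
          Nonempty (EquivariantFundamentalGroup (coadjointRep L) e ≃*
            EquivariantFundamentalGroup (coadjointRepAd L) e')) ∧
    (∀ Delta ⊆ simple, ∀ L : Subgroup (ZGL n), L = standardLevi G T Delta →
      centerIn G ⊓ L = ⊥ →
      IsConnected (Subgroup.center L : Set L) ∧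
      ∀ O : Set (Module.Dual ℂ (lieAlg L)), IsNilpotentOrbit (coadjointRep L) O →
        IsNilpotentOrbit (coadjointRepAd L) (adOrbit L O) ∧
        ∀ e ∈ O, ∀ e' ∈ adOrbit L O,
          Nonempty (EquivariantFundamentalGroup (coadjointRep L) e ≃*
            EquivariantFundamentalGroup (coadjointRepAd L) e')) := by
  have key : Subgroup.center G = ⊥ → ∀ Delta ⊆ simple,
      IsConnected (Subgroup.center (standardLevi G T Delta) : Set (standardLevi G T Delta)) :=
    fun hZ Delta hD => isConnected_center_standardLevi hG hT hZ hsimple hD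
  constructor
  · rintro hZ Delta hD _ rfl
    exact ⟨key hZ Delta hD, fun O hO => nilpotentOrbit_fundamentalGroup_ad _ (key hZ Delta hD) hO⟩
  · rintro Delta hD _ rfl hZL
    -- the centre of `G` lies in every Levi subgroup
    have hZ := center_eq_bot_of_centerIn_inf_eq_bot hT.le hZL
    exact ⟨key hZ Delta hD, fun O hO => nilpotentOrbit_fundamentalGroup_ad _ (key hZ Delta hD) hO⟩
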